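/- Let $M\ge 1$, $T>0$, and $0<\beta<\beta^*$. Write $C^{6,3}$ for the class of functions $g$ on $[0,1]\times[0,T]$ all of whose derivatives $\partial_x^i\partial_t^j g$ with $i+2j\le 6$ exist and are continuous on the closed rectangle. Let $A=(a_{ij})$ be an $M\times M$ matrix of functions in $C^6([0,1])$ such that on $[0,1]$ $$a_{ij}\le 0\ (i\ne j),\qquad a_{ii}>0,\qquad \sum_{j=1}^M a_{ij}\ge\beta^*\qquad (1\le i\le M),$$ and let $f:[0,1]\times[0,T]\to\mathbb R^M$ have components in $C^{6,3}$ and satisfy $\partial_x^s\partial_t^q f(0,0)=\partial_x^s\partial_t^q f(1,0)=0$ for $0\le s+2q\le 4$. For $\varepsilon\in(0,1]$ put $L_{x,\varepsilon}v=-\varepsilon v''+Av$. Then there is a constant $C>0$, depending only on $M,T,A,f,\beta^*,\beta$, with the following property. Let $\varepsilon\in(0,1]$, and let $u$, with components in $C^{6,3}$, be a solution of $$\partial_t u+L_{x,\varepsilon}u=f\ \text{ in }(0,1)\times(0,T],\qquad u(0,t)=u(1,t)=0\ (0\le t\le T),\qquad u(x,0)=0\ (0\le x\le 1).$$ Let $\Delta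 t>0$ and an integer $n\ge 0$ satisfy $(n+1)\Delta t\le T$, put $t_m=m\Delta t$, and let $\hat u^{n+1}\in C([0,1])^M\cap C^2((0,1))^M$ be a solution of the auxiliary Crank–Nicolson problem $$\Bigl(I+\tfrac{\Delta t}{2}L_{x,\varepsilon}\Bigr)\hat u^{n+1}=\Bigl(I-\tfrac{\Delta t}{2}L_{x,\varepsilon}\Bigr)u(\cdot,t_n)+\tfrac{\Delta t}{2}\bigl(f(\cdot,t_n)+f(\cdot,t_{n+1})\bigr)\ \text{ in }(0,1),\qquad \hat u^{n+1}(0)=\hat u^{n+1}(1)=0.$$ Then $\hat u^{n+1}\in C^6([0,1])^M$, and for all $0\le k\le 6$, all $x\in[0,1]$ and every component $1\le i\le M$, $$\left|\frac{d^k\hat u_i^{n+1}}{dx^k}(x)\right|\le C\left(1+\varepsilon^{-k/2}\left(e^{-x\sqrt{\beta/\varepsilon}}+e^{-(1-x)\sqrt{\beta/\varepsilon}}\right)\right).$$ In particular $C$ is independent of $\varepsilon$, $\Delta t$ and $n$. -/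

import Mathlib

open Set

/-- The mixed partial derivative `∂^(i+j) g / ∂x^i ∂t^j` at `(x, t)` of a function `g` on the closed
rectangle `[0,1] × [0,T]`. Derivatives are taken relative to the closed intervals, so that they are
one-sided on the boundary of the rectangle. -/
noncomputable def mixedDeriv (T : ℝ) (i j : ℕ) (g : ℝ → ℝ → ℝ) (x t : ℝ) : ℝ :=
  iteratedDerivWithin i (fun y => iteratedDerivWithin j (fun s => g y s) (Icc 0 T) t) (Icc 0 1) x

/-- `g` belongs to `C^{2p,p}` on the closed rectangle `[0,1] × [0,T]`: all derivatives
`∂^(i+j) g / ∂x^i ∂t^j` with `i + 2 j ≤ 2 p` exist and are continuous on the closed rectangle. -/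
def ParabolicC (p : ℕ) (T : ℝ) (g : ℝ → ℝ → ℝ) : Prop :=
  ∀ i j : ℕ, i + 2 * j ≤ 2 * p →
    (∀ x ∈ Icc (0 : ℝ) 1, ContDiffOn ℝ j (fun s => g x s) (Icc 0 T)) ∧
    (∀ t ∈ Icc (0 : ℝ) T,
      ContDiffOn ℝ i (fun y => iteratedDerivWithin j (fun s => g y s) (Icc 0 T) t) (Icc 0 1)) ∧
    ContinuousOn (fun z : ℝ × ℝ => mixedDeriv T i j g z.1 z.2) (Icc 0 1 ×ˢ Icc 0 T)

/-- The spatial operator `L v = -ε v'' + A v` on vector-valued functions on `[0,1]`. -/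
noncomputable def spatialOp {M : ℕ} (ε : ℝ) (A : ℝ → Matrix (Fin M) (Fin M) ℝ)
    (v : ℝ → Fin M → ℝ) (x : ℝ) (i : Fin M) : ℝ :=
  -ε * iteratedDerivWithin 2 (fun y => v y i) (Icc 0 1) x + ∑ j, A x i j * v x j

/-- `A` is a coupling matrix of class `C^6` on `[0,1]` that satisfies the positivity conditions
with lower bound `βs` for the row sums. -/
structure IsCouplingMatrix {M : ℕ} (A : ℝ → Matrix (Fin M) (Fin M) ℝ) (βs : ℝ) : Prop where
  smooth : ∀ i j, ContDiffOn ℝ 6 (fun x => A x i j) (Icc 0 1)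
  offDiag_nonpos : ∀ x ∈ Icc (0 : ℝ) 1, ∀ i j, i ≠ j → A x i j ≤ 0
  diag_pos : ∀ x ∈ Icc (0 : ℝ) 1, ∀ i, 0 < A x i i
  rowSum_ge : ∀ x ∈ Icc (0 : ℝ) 1, ∀ i, βs ≤ ∑ j, A x i j

/-- The source term `f` is of class `C^{6,3}` on `[0,1] × [0,T]` and satisfies the compatibility
conditions at the corners `(0,0)` and `(1,0)`. -/
structure IsCompatibleSource {M : ℕ} (T : ℝ) (f : ℝ → ℝ → Fin M → ℝ) : Prop where
  smooth : ∀ i, ParabolicC 3 T (fun x t => f x t i)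
  compat : ∀ i, ∀ s q : ℕ, s + 2 * q ≤ 4 →
    mixedDeriv T s q (fun x t => f x t i) 0 0 = 0 ∧ mixedDeriv T s q (fun x t => f x t i) 1 0 = 0

/-- `u` is a solution of class `C^{6,3}` on `[0,1] × [0,T]` of the initial-boundary value problem
`∂u/∂t + L u = f` in `(0,1) × (0,T]`, `u = 0` for `x = 0`, `x = 1` and for `t = 0`. -/
structure IsParabolicSolution {M : ℕ} (ε T : ℝ) (A : ℝ → Matrix (Fin M) (Fin M) ℝ)
    (f u : ℝ → ℝ → Fin M → ℝ) : Prop where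
  smooth : ∀ i, ParabolicC 3 T (fun x t => u x t i)
  eqn : ∀ x ∈ Ioo (0 : ℝ) 1, ∀ t ∈ Ioc (0 : ℝ) T, ∀ i,
    derivWithin (fun s => u x s i) (Icc 0 T) t + spatialOp ε A (fun y => u y t) x i = f x t i
  initial : ∀ x ∈ Icc (0 : ℝ) 1, u x 0 = 0
  boundary : ∀ t ∈ Icc (0 : ℝ) T, u 0 t = 0 ∧ u 1 t = 0

/-- `v` is a classical solution of the auxiliary Crank–Nicolson problem at the time level `n + 1`,
with step `τ`, started from `u(·, n τ)`:
`(I + τ/2 L) v = (I - τ/2 L) u(·, n τ) + τ/2 (f(·, n τ) + f(·, (n+1) τ))` in `(0,1)`,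
`v(0) = v(1) = 0`. -/
structure IsAuxCrankNicolsonSolution {M : ℕ} (ε τ : ℝ) (n : ℕ)
    (A : ℝ → Matrix (Fin M) (Fin M) ℝ) (f u : ℝ → ℝ → Fin M → ℝ) (v : ℝ → Fin M → ℝ) : Prop where
  continuousOn : ∀ i, ContinuousOn (fun x => v x i) (Icc 0 1)
  smooth : ∀ i, ContDiffOn ℝ 2 (fun x => v x i) (Ioo 0 1)
  eqn : ∀ x ∈ Ioo (0 : ℝ) 1, ∀ i,
    v x i + τ / 2 * spatialOp ε A v x i =
      u x (n * τ) i - τ / 2 * spatialOp ε A (fun y => u y (n * τ)) x i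
        + τ / 2 * (f x (n * τ) i + f x ((n + 1) * τ) i)
  boundary : v 0 = 0 ∧ v 1 = 0

-- Everything rests on maximum principles. The sign conditions on `A` give comparison principles for
-- `∂ₜ + L` and for `I + τ/2 L`, with zeroth order part at least `βs > 0` uniformly in `ε`
-- (`parabolic_abs_le`, `elliptic_abs_le`). Two barriers enter. The layer function solves `ε E'' = β
-- E`, so `1 + q * layer` is a supersolution with margin `βs - β` for every weight `q ≥ 0`. The
-- function `1 - exp(-|x - x₀| √(β/ε))` vanishes at one endpoint with slope of order `ε^(-1/2)`, so
-- whatever it dominates has a derivative of at most that order there.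
--
-- A `k`-th space derivative solves the original system up to a commutator made of lower
-- derivatives. By induction on `k` it is controlled by the layer barrier as soon as its boundary
-- values are. At an endpoint, the first space derivative of `∂ₜ^j u` is bounded through the end
-- barrier, the corner conditions making the initial data `O(|x - x₀|)`; higher ones follow from the
-- equation, two space derivatives being traded for a factor `1/ε` and one time derivative. This
-- yields `exists_endpoint_bound` and `exists_layer_bound`. Since `u` has only six space
-- derivatives, the comparison is made for its integrals over `[t, t + h]`, which have eight, and
-- then `h → 0`.
--
-- For the Crank–Nicolson step, `(I + τ/2 L)(v + u) = 2u + τ/2 (f + f⁺)` contains no space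
-- derivatives of `u`, so `v + u` obeys the same layer bounds (`exists_sum_layer_bound`) and `v = (v
-- + u) - u`. The boundary values of the derivatives of `v` come from discrete substitutes for time
-- derivatives: `q = (v - u)/τ` and `r = (2/τ)(∂ₜu - q)` satisfy `(I + τ/2 L) q = ∂ₜu + O(τ)` and
-- `(I + τ/2 L) r = -∂ₜ²u + O(τ)`, hence are bounded uniformly in `τ`.

local notation "𝕀" => Icc (0 : ℝ) 1

/-! ### One-sided calculus on closed intervals -/

theorem uniqueDiffOn_unitInterval : UniqueDiffOn ℝ 𝕀 := uniqueDiffOn_Icc zero_lt_one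

theorem hasDerivWithinAt_iteratedDerivWithin {s : Set ℝ} (hs : UniqueDiffOn ℝ s) {n k : ℕ}
    {g : ℝ → ℝ} (hg : ContDiffOn ℝ n g s) (hk : k < n) {x : ℝ} (hx : x ∈ s) :
    HasDerivWithinAt (iteratedDerivWithin k g s) (iteratedDerivWithin (k + 1) g s x) s x := by
  rw [iteratedDerivWithin_succ]
  exact ((hg.differentiableOn_iteratedDerivWithin (by exact_mod_cast hk) hs) x hx).hasDerivWithinAt

theorem iteratedDerivWithin_eq_of_chain {s : Set ℝ} (hs : UniqueDiffOn ℝ s) {m : ℕ}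
    {G : ℕ → ℝ → ℝ} (hG : ∀ k < m, ∀ x ∈ s, HasDerivWithinAt (G k) (G (k + 1) x) s x) :
    ∀ k ≤ m, EqOn (iteratedDerivWithin k (G 0) s) (G k) s := by
  intro k
  induction k with
  | zero => intro _ x _; simp
  | succ k ih =>
    intro hk x hx
    rw [iteratedDerivWithin_succ, derivWithin_congr (ih (by omega)) (ih (by omega) hx)]
    exact (hG k (by omega) x hx).derivWithin (hs x hx)

theorem contDiffOn_of_chain {s : Set ℝ} (hs : UniqueDiffOn ℝ s) {m : ℕ}
    {G : ℕ → ℝ → ℝ} (hG : ∀ k < m, ∀ x ∈ s, HasDerivWithinAt (G k) (G (k + 1) x) s x)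
    (hc : ContinuousOn (G m) s) : ContDiffOn ℝ m (G 0) s := by
  rw [contDiffOn_nat_iff_continuousOn_differentiableOn_deriv hs]
  have key := iteratedDerivWithin_eq_of_chain hs hG
  constructor
  · intro k hk
    refine ContinuousOn.congr ?_ (key k hk)
    rcases hk.lt_or_eq with h | h
    · exact fun x hx => (hG k h x hx).continuousWithinAt
    · rw [h]; exact hc
  · intro k hk
    refine DifferentiableOn.congr ?_ (key k hk.le)
    exact fun x hx => (hG k hk x hx).differentiableWithinAt

/-- Used for bootstrapping: an equation that expresses `y''` through `y` and smooth data gains two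
derivatives at a time. -/
theorem contDiffOn_add_two {s : Set ℝ} (hs : UniqueDiffOn ℝ s) {n : ℕ} {y y1 y2 : ℝ → ℝ}
    (h1 : ∀ x ∈ s, HasDerivWithinAt y (y1 x) s x) (h2 : ∀ x ∈ s, HasDerivWithinAt y1 (y2 x) s x)
    (hy2 : ContDiffOn ℝ n y2 s) : ContDiffOn ℝ (n + 2 : ℕ) y s := by
  have step : ∀ {m : ℕ} {g g1 : ℝ → ℝ}, (∀ x ∈ s, HasDerivWithinAt g (g1 x) s x) →
      ContDiffOn ℝ m g1 s → ContDiffOn ℝ (m + 1 : ℕ) g s := by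
    intro m g g1 hg hg1
    push_cast
    rw [contDiffOn_succ_iff_derivWithin hs]
    refine ⟨fun x hx => (hg x hx).differentiableWithinAt, by simp, hg1.congr ?_⟩
    exact fun x hx => (hg x hx).derivWithin (hs x hx)
  exact step h1 (step h2 hy2)

theorem exists_bound_of_contDiffOn {n : ℕ} {g : ℝ → ℝ} (hg : ContDiffOn ℝ n g 𝕀) :
    ∃ C : ℝ, ∀ k ≤ n, ∀ x ∈ 𝕀, |iteratedDerivWithin k g 𝕀 x| ≤ C := by
  have h : ∀ k : ℕ, ∃ C : ℝ, k ≤ n → ∀ x ∈ 𝕀, |iteratedDerivWithin k g 𝕀 x| ≤ C := by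
    intro k
    by_cases hk : k ≤ n
    · obtain ⟨C, hC⟩ := isCompact_Icc.exists_bound_of_continuousOn
        (hg.continuousOn_iteratedDerivWithin (m := k) (by exact_mod_cast hk)
          uniqueDiffOn_unitInterval)
      exact ⟨C, fun _ x hx => by simpa using hC x hx⟩
    · exact ⟨0, fun h => absurd h hk⟩
  choose C hC using h
  refine ⟨∑ k ∈ Finset.range (n + 1), |C k|, fun k hk x hx => (hC k hk x hx).trans ?_⟩
  exact (le_abs_self _).trans
    (Finset.single_le_sum (f := fun k => |C k|) (fun _ _ => abs_nonneg _)
      (Finset.mem_range.2 (by omega)))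

/-- Fundamental theorem of calculus on the unit interval. -/
theorem integral_eq_sub_of_hasDerivWithinAt_Icc {a b : ℝ} {g g1 : ℝ → ℝ}
    (h : ∀ x ∈ Icc a b, HasDerivWithinAt g (g1 x) (Icc a b) x) (hc : ContinuousOn g1 (Icc a b))
    {x z : ℝ} (hx : x ∈ Icc a b) (hz : z ∈ Icc a b) : ∫ y in x..z, g1 y = g z - g x := by
  have hsub : uIcc x z ⊆ Icc a b := uIcc_subset_Icc hx hz
  refine intervalIntegral.integral_eq_sub_of_hasDeriv_right
    (fun y hy => ((h y (hsub hy)).continuousWithinAt).mono hsub) (fun y hy => ?_)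
    ((hc.mono hsub).intervalIntegrable)
  have hy' : y ∈ Ioo a b := by
    constructor
    · exact lt_of_le_of_lt (le_min hx.1 hz.1) hy.1
    · exact lt_of_lt_of_le hy.2 (max_le hx.2 hz.2)
  exact ((h y (Ioo_subset_Icc_self hy')).hasDerivAt (Icc_mem_nhds hy'.1 hy'.2)).hasDerivWithinAt

/-- The point may be an endpoint, where the derivative is one-sided. Fubini and the fundamental
theorem of calculus write the parameter integral as a primitive of `∫ G1`, which is differentiable
everywhere. -/
theorem hasDerivWithinAt_integral_param {a b : ℝ} {G G1 : ℝ → ℝ → ℝ}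
    (hG : Continuous (Function.uncurry G)) (hG1 : Continuous (Function.uncurry G1))
    (h : ∀ t ∈ uIcc a b, ∀ x ∈ 𝕀, HasDerivWithinAt (fun y => G y t) (G1 x t) 𝕀 x)
    {x : ℝ} (hx : x ∈ 𝕀) :
    HasDerivWithinAt (fun y => ∫ s in a..b, G y s) (∫ s in a..b, G1 x s) 𝕀 x := by
  have hcont : Continuous (fun y => ∫ s in a..b, G1 y s) :=
    intervalIntegral.continuous_parametric_intervalIntegral_of_continuous' hG1 a b
  have h0 : (0 : ℝ) ∈ 𝕀 := ⟨le_rfl, zero_le_one⟩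
  have key : ∀ z ∈ 𝕀, ∫ s in a..b, G z s
      = (∫ s in a..b, G 0 s) + ∫ y in (0 : ℝ)..z, ∫ s in a..b, G1 y s := by
    intro z hz
    have hswap : (∫ y in (0 : ℝ)..z, ∫ s in a..b, G1 y s)
        = ∫ s in a..b, ∫ y in (0 : ℝ)..z, G1 y s := by
      refine MeasureTheory.intervalIntegral_intervalIntegral_swap ?_
      exact (hG1.continuousOn.integrableOn_compact (isCompact_uIcc.prod isCompact_uIcc)).mono_set
        (prod_mono uIoc_subset_uIcc uIoc_subset_uIcc)
    rw [hswap, ← intervalIntegral.integral_add]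
    · refine intervalIntegral.integral_congr fun s hs => ?_
      have := integral_eq_sub_of_hasDerivWithinAt_Icc (h s hs)
        (by fun_prop : Continuous fun y => G1 y s).continuousOn h0 hz
      simp only [this]; ring
    · exact (by fun_prop : Continuous fun s => G 0 s).intervalIntegrable _ _
    · refine Continuous.intervalIntegrable ?_ _ _
      exact intervalIntegral.continuous_parametric_intervalIntegral_of_continuous'
        (by fun_prop : Continuous (Function.uncurry fun s y => G1 y s)) _ _
  have hd : HasDerivWithinAt (fun z => (∫ s in a..b, G 0 s) + ∫ y in (0 : ℝ)..z,
      ∫ s in a..b, G1 y s) (∫ s in a..b, G1 x s) 𝕀 x :=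
    ((hcont.integral_hasStrictDerivAt 0 x).hasDerivAt.const_add _).hasDerivWithinAt
  exact hd.congr key (key x hx)

/-- Extension of a function on the rectangle `[0,1] × [0,T]` that is constant in the outward
directions. -/
noncomputable def extendRect (T : ℝ) (F : ℝ → ℝ → ℝ) (x t : ℝ) : ℝ :=
  F (max 0 (min 1 x)) (max 0 (min T t))

theorem extendRect_eq {T : ℝ} {F : ℝ → ℝ → ℝ} {x t : ℝ} (hx : x ∈ 𝕀) (ht : t ∈ Icc 0 T) :
    extendRect T F x t = F x t := by
  simp [extendRect, hx.1, hx.2, ht.1, ht.2]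

theorem continuous_extendRect {T : ℝ} (hT : 0 ≤ T) {F : ℝ → ℝ → ℝ}
    (hF : ContinuousOn (fun z : ℝ × ℝ => F z.1 z.2) (𝕀 ×ˢ Icc 0 T)) :
    Continuous (Function.uncurry (extendRect T F)) := by
  have h : Continuous fun z : ℝ × ℝ => ((max 0 (min 1 z.1) : ℝ), (max 0 (min T z.2) : ℝ)) := by
    fun_prop
  refine hF.comp_continuous h fun z => ⟨⟨le_max_left _ _, ?_⟩, ⟨le_max_left _ _, ?_⟩⟩
  · exact max_le zero_le_one (min_le_left _ _)
  · exact max_le hT (min_le_left _ _)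

/-! ### Time derivatives of mixed derivatives on the closed rectangle -/

section ParabolicC

variable {p : ℕ} {T : ℝ} {g : ℝ → ℝ → ℝ}

theorem mixedDeriv_zero (j : ℕ) (x t : ℝ) :
    mixedDeriv T 0 j g x t = iteratedDerivWithin j (fun s => g x s) (Icc 0 T) t := by
  simp [mixedDeriv]

theorem iteratedDerivWithin_mixedDeriv_zero (i j : ℕ) (x t : ℝ) :
    iteratedDerivWithin i (fun y => mixedDeriv T 0 j g y t) 𝕀 x = mixedDeriv T i j g x t := by
  simp [mixedDeriv]

theorem ParabolicC.contDiffOn (hg : ParabolicC p T g) {i j : ℕ} (hij : i + 2 * j ≤ 2 * p) {t : ℝ}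
    (ht : t ∈ Icc 0 T) : ContDiffOn ℝ i (fun y => mixedDeriv T 0 j g y t) 𝕀 := by
  simpa [mixedDeriv] using (hg i j hij).2.1 t ht

theorem ParabolicC.hasDerivWithinAt_left (hg : ParabolicC p T g) {i j : ℕ}
    (hij : i + 1 + 2 * j ≤ 2 * p) {x t : ℝ} (hx : x ∈ 𝕀) (ht : t ∈ Icc 0 T) :
    HasDerivWithinAt (fun y => mixedDeriv T i j g y t) (mixedDeriv T (i + 1) j g x t) 𝕀 x :=
  hasDerivWithinAt_iteratedDerivWithin uniqueDiffOn_unitInterval ((hg (i + 1) j hij).2.1 t ht)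
    (Nat.lt_succ_self i) hx

/-- `mixedDeriv` takes time derivatives innermost, so a further time derivative must be commuted
past `∂ₓ^i`. For `i = 0` this is the fundamental theorem of calculus; the induction differentiates
the integral identity in `x` on both sides and uses uniqueness of derivatives. -/
theorem ParabolicC.sub_eq_integral (hT : 0 < T) (hg : ParabolicC p T g) {i j : ℕ}
    (hij : i + 2 * (j + 1) ≤ 2 * p) {x s t : ℝ} (hx : x ∈ 𝕀) (hs : s ∈ Icc 0 T)
    (ht : t ∈ Icc 0 T) :
    mixedDeriv T i j g x t - mixedDeriv T i j g x s
      = ∫ r in s..t, extendRect T (mixedDeriv T i (j + 1) g) x r := by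
  induction i generalizing x with
  | zero =>
    have hd : ∀ r ∈ Icc 0 T, HasDerivWithinAt (fun r => mixedDeriv T 0 j g x r)
        (extendRect T (mixedDeriv T 0 (j + 1) g) x r) (Icc 0 T) r := by
      intro r hr
      rw [extendRect_eq hx hr]
      simp only [mixedDeriv_zero]
      exact hasDerivWithinAt_iteratedDerivWithin (uniqueDiffOn_Icc hT) ((hg 0 (j + 1) hij).1 x hx)
        (Nat.lt_succ_self j) hr
    have hc := continuous_extendRect hT.le (hg 0 (j + 1) hij).2.2
    rw [integral_eq_sub_of_hasDerivWithinAt_Icc hd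
      (by fun_prop : Continuous fun r => extendRect T (mixedDeriv T 0 (j + 1) g) x r).continuousOn
      hs ht]
  | succ i ih =>
    have hL := (hg.hasDerivWithinAt_left (i := i) (j := j) (by omega) hx ht).sub
      (hg.hasDerivWithinAt_left (i := i) (j := j) (by omega) hx hs)
    have hR := hasDerivWithinAt_integral_param (a := s) (b := t)
      (continuous_extendRect hT.le (hg i (j + 1) (by omega)).2.2)
      (continuous_extendRect hT.le (hg (i + 1) (j + 1) hij).2.2) (fun r hr y hy => by
        have hr' : r ∈ Icc 0 T := uIcc_subset_Icc hs ht hr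
        rw [extendRect_eq hy hr']
        refine (hg.hasDerivWithinAt_left (i := i) (j := j + 1) (by omega) hy hr').congr ?_ ?_
        · exact fun z hz => extendRect_eq hz hr'
        · exact extendRect_eq hy hr') hx
    have hR' := hR.congr (fun y hy => ih (by omega) hy) (ih (by omega) hx)
    exact (uniqueDiffOn_unitInterval x hx).eq_deriv _ hL hR'

theorem ParabolicC.hasDerivWithinAt_right (hT : 0 < T) (hg : ParabolicC p T g) {i j : ℕ}
    (hij : i + 2 * (j + 1) ≤ 2 * p) {x t : ℝ} (hx : x ∈ 𝕀) (ht : t ∈ Icc 0 T) :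
    HasDerivWithinAt (fun s => mixedDeriv T i j g x s) (mixedDeriv T i (j + 1) g x t)
      (Icc 0 T) t := by
  have hc : Continuous fun r => extendRect T (mixedDeriv T i (j + 1) g) x r := by
    have := continuous_extendRect hT.le (hg i (j + 1) hij).2.2
    fun_prop
  have hd := ((hc.integral_hasStrictDerivAt 0 t).hasDerivAt.const_add
    (mixedDeriv T i j g x 0)).hasDerivWithinAt (s := Icc 0 T)
  have h0 : (0 : ℝ) ∈ Icc 0 T := ⟨le_rfl, hT.le⟩
  rw [extendRect_eq hx ht] at hd
  have key : ∀ s ∈ Icc 0 T, mixedDeriv T i j g x s = mixedDeriv T i j g x 0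
      + ∫ r in (0 : ℝ)..s, extendRect T (mixedDeriv T i (j + 1) g) x r := by
    intro s hs
    rw [← hg.sub_eq_integral hT hij hx h0 hs]; ring
  exact hd.congr key (key t ht)

theorem ParabolicC.exists_bound (hg : ParabolicC p T g) :
    ∃ C : ℝ, ∀ i j : ℕ, i + 2 * j ≤ 2 * p → ∀ x ∈ 𝕀, ∀ t ∈ Icc 0 T,
      |mixedDeriv T i j g x t| ≤ C := by
  have h : ∀ q : ℕ × ℕ, ∃ C : ℝ, q.1 + 2 * q.2 ≤ 2 * p → ∀ x ∈ 𝕀, ∀ t ∈ Icc 0 T,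
      |mixedDeriv T q.1 q.2 g x t| ≤ C := by
    intro q
    by_cases hk : q.1 + 2 * q.2 ≤ 2 * p
    · obtain ⟨C, hC⟩ := (isCompact_Icc.prod isCompact_Icc).exists_bound_of_continuousOn
        (hg q.1 q.2 hk).2.2
      exact ⟨C, fun _ x hx t ht => by simpa using hC (x, t) ⟨hx, ht⟩⟩
    · exact ⟨0, fun h => absurd h hk⟩
  choose C hC using h
  refine ⟨∑ q ∈ Finset.range (2 * p + 1) ×ˢ Finset.range (2 * p + 1), |C q|,
    fun i j hk x hx t ht => (hC (i, j) hk x hx t ht).trans ?_⟩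
  exact (le_abs_self _).trans
    (Finset.single_le_sum (f := fun k => |C k|) (fun _ _ => abs_nonneg _)
      (Finset.mem_product.2 ⟨Finset.mem_range.2 (by simp only; omega),
        Finset.mem_range.2 (by simp only; omega)⟩))

end ParabolicC

/-! ### Regularity up to the boundary -/

/-- A continuous function on `[0,1]` whose second derivative on `(0,1)` extends continuously to
`[0,1]` is of class `C^2` on `[0,1]`. -/
theorem exists_hasDerivWithinAt_of_continuousOn {y H : ℝ → ℝ} (hy : ContinuousOn y 𝕀)
    (hy2 : ContDiffOn ℝ 2 y (Ioo 0 1)) (hH : ContinuousOn H 𝕀)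
    (h : ∀ x ∈ Ioo (0 : ℝ) 1, iteratedDerivWithin 2 y 𝕀 x = H x) :
    ∃ y1 : ℝ → ℝ, (∀ x ∈ 𝕀, HasDerivWithinAt y (y1 x) 𝕀 x) ∧
      ∀ x ∈ 𝕀, HasDerivWithinAt y1 (H x) 𝕀 x := by
  -- `K2` is a twice iterated primitive of the extended `H`. Hence `y - K2` is affine on the open
  -- interval, and by continuity on the closed one; the one-sided derivatives of `y` are read off
  -- from this formula.
  set K : ℝ → ℝ := fun x => H (max 0 (min 1 x)) with hK
  have hKc : Continuous K := hH.comp_continuous (by fun_prop) fun x =>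
    ⟨le_max_left _ _, max_le zero_le_one (min_le_left _ _)⟩
  have hKH : ∀ x ∈ 𝕀, K x = H x := fun x hx => by simp [hK, hx.1, hx.2]
  set K1 : ℝ → ℝ := fun x => ∫ s in (0 : ℝ)..x, K s
  set K2 : ℝ → ℝ := fun x => ∫ s in (0 : ℝ)..x, K1 s
  have hK1 : ∀ x, HasDerivAt K1 (K x) x := fun x => (hKc.integral_hasStrictDerivAt 0 x).hasDerivAt
  have hK1c : Continuous K1 := continuous_iff_continuousAt.2 fun x => (hK1 x).continuousAt
  have hK2 : ∀ x, HasDerivAt K2 (K1 x) x := fun x =>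
    (hK1c.integral_hasStrictDerivAt 0 x).hasDerivAt
  have hK2c : Continuous K2 := continuous_iff_continuousAt.2 fun x => (hK2 x).continuousAt
  have hd1 : ∀ x ∈ Ioo (0 : ℝ) 1, HasDerivAt y (deriv y x) x := fun x hx =>
    ((hy2.differentiableOn (by norm_num)) x hx).differentiableAt (isOpen_Ioo.mem_nhds hx)
      |>.hasDerivAt
  have hd2 : ∀ x ∈ Ioo (0 : ℝ) 1, HasDerivAt (deriv y) (H x) x := by
    intro x hx
    have hdd : ContDiffOn ℝ 1 (deriv y) (Ioo 0 1) :=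
      ((contDiffOn_succ_iff_deriv_of_isOpen (n := 1) isOpen_Ioo).1 hy2).2.2
    have h1 := (((hdd.differentiableOn one_ne_zero) x hx).differentiableAt
      (isOpen_Ioo.mem_nhds hx)).hasDerivAt
    have h2 : iteratedDerivWithin 2 y 𝕀 x = deriv (deriv y) x := by
      have hev : (derivWithin y 𝕀) =ᶠ[nhds x] deriv y := by
        filter_upwards [isOpen_Ioo.mem_nhds hx] with z hz
        exact derivWithin_of_mem_nhds (Icc_mem_nhds hz.1 hz.2)
      rw [iteratedDerivWithin_succ, iteratedDerivWithin_one,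
        derivWithin_of_mem_nhds (Icc_mem_nhds hx.1 hx.2), hev.deriv_eq]
    rwa [← h2, h x hx] at h1
  obtain ⟨a, ha⟩ : ∃ a, ∀ x ∈ Ioo (0 : ℝ) 1, deriv y x - K1 x = a := by
    refine isOpen_Ioo.exists_is_const_of_deriv_eq_zero isPreconnected_Ioo ?_ ?_
    · exact fun x hx => ((hd2 x hx).sub (hK1 x)).differentiableAt.differentiableWithinAt
    · intro x hx
      have := ((hd2 x hx).sub (hK1 x)).deriv
      rw [hKH x (Ioo_subset_Icc_self hx), sub_self] at this
      exact this
  have hd0 : ∀ x ∈ Ioo (0 : ℝ) 1, HasDerivAt (fun x => y x - K2 x - a * x) 0 x := by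
    intro x hx
    refine (((hd1 x hx).sub (hK2 x)).sub ((hasDerivAt_id x).const_mul a)).congr_deriv ?_
    rw [ha x hx]; ring
  obtain ⟨b, hb⟩ : ∃ b, ∀ x ∈ Ioo (0 : ℝ) 1, y x - K2 x - a * x = b := by
    refine isOpen_Ioo.exists_is_const_of_deriv_eq_zero isPreconnected_Ioo ?_ ?_
    · exact fun x hx => (hd0 x hx).differentiableAt.differentiableWithinAt
    · exact fun x hx => (hd0 x hx).deriv
  have hb' : ∀ x ∈ 𝕀, y x - K2 x - a * x = b := by
    have hcl : closure (Ioo (0 : ℝ) 1) = 𝕀 := closure_Ioo zero_ne_one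
    have heq : EqOn (fun x => y x - K2 x - a * x) (fun _ => b) (Ioo 0 1) := hb
    intro x hx
    refine heq.of_subset_closure (t := 𝕀) ?_ continuousOn_const Ioo_subset_Icc_self hcl.ge hx
    exact (hy.sub hK2c.continuousOn).sub (by fun_prop)
  have hyK : ∀ x ∈ 𝕀, y x = K2 x + a * x + b := fun x hx => by linarith [hb' x hx]
  refine ⟨fun x => K1 x + a, fun x hx => ?_, fun x hx => ?_⟩
  · have := ((((hK2 x).add ((hasDerivAt_id x).const_mul a)).add_const b)).hasDerivWithinAt (s := 𝕀)
    simp only [mul_one] at this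
    exact this.congr hyK (hyK x hx)
  · rw [← hKH x hx]
    exact ((hK1 x).add_const a).hasDerivWithinAt

theorem iteratedDerivWithin_iteratedDerivWithin {s : Set ℝ} (hs : UniqueDiffOn ℝ s) {g : ℝ → ℝ}
    {k m : ℕ} (hg : ContDiffOn ℝ (k + m : ℕ) g s) {x : ℝ} (hx : x ∈ s) :
    iteratedDerivWithin k (iteratedDerivWithin m g s) s x = iteratedDerivWithin (k + m) g s x := by
  have := iteratedDerivWithin_eq_of_chain hs (m := k)
    (G := fun n => iteratedDerivWithin (n + m) g s) (fun n hn y hy => by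
      have := hasDerivWithinAt_iteratedDerivWithin hs hg (k := n + m) (by omega) hy
      rwa [add_right_comm n 1 m])
  simpa using this k le_rfl hx

theorem iteratedDerivWithin_sub_apply {s : Set ℝ} (hs : UniqueDiffOn ℝ s) {g h : ℝ → ℝ} {k : ℕ}
    {x : ℝ} (hx : x ∈ s) (hg : ContDiffOn ℝ k g s) (hh : ContDiffOn ℝ k h s) :
    iteratedDerivWithin k (fun y => g y - h y) s x
      = iteratedDerivWithin k g s x - iteratedDerivWithin k h s x :=
  iteratedDerivWithin_sub hx hs (hg x hx) (hh x hx)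

theorem iteratedDerivWithin_add_apply {s : Set ℝ} (hs : UniqueDiffOn ℝ s) {g h : ℝ → ℝ} {k : ℕ}
    {x : ℝ} (hx : x ∈ s) (hg : ContDiffOn ℝ k g s) (hh : ContDiffOn ℝ k h s) :
    iteratedDerivWithin k (fun y => g y + h y) s x
      = iteratedDerivWithin k g s x + iteratedDerivWithin k h s x :=
  iteratedDerivWithin_fun_add hx hs (hg x hx) (hh x hx)

/-! ### Space derivatives of the system and the commutator with `A` -/

section Commutator

variable {M : ℕ} {A : ℝ → Matrix (Fin M) (Fin M) ℝ} {z : Fin M → ℝ → ℝ}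

/-- The lower order terms of the `k`-th derivative of the product `A z`. -/
noncomputable def leibnizRemainder (A : ℝ → Matrix (Fin M) (Fin M) ℝ) (z : Fin M → ℝ → ℝ) (k : ℕ)
    (i : Fin M) (x : ℝ) : ℝ :=
  ∑ j, ∑ l ∈ Finset.range k, (k.choose (l + 1) : ℝ) *
    iteratedDerivWithin (l + 1) (fun y => A y i j) 𝕀 x * iteratedDerivWithin (k - (l + 1)) (z j) 𝕀 x

theorem contDiffOn_matVec {n : ℕ} (hA : ∀ i j, ContDiffOn ℝ n (fun x => A x i j) 𝕀)
    (hz : ∀ j, ContDiffOn ℝ n (z j) 𝕀) (i : Fin M) :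
    ContDiffOn ℝ n (fun y => ∑ j, A y i j * z j y) 𝕀 :=
  ContDiffOn.sum fun j _ => (hA i j).mul (hz j)

theorem iteratedDerivWithin_matVec {k : ℕ} (hA : ∀ i j, ContDiffOn ℝ k (fun x => A x i j) 𝕀)
    (hz : ∀ j, ContDiffOn ℝ k (z j) 𝕀) (i : Fin M) {x : ℝ} (hx : x ∈ 𝕀) :
    iteratedDerivWithin k (fun y => ∑ j, A y i j * z j y) 𝕀 x
      = ∑ j, A x i j * iteratedDerivWithin k (z j) 𝕀 x + leibnizRemainder A z k i x := by
  rw [iteratedDerivWithin_fun_sum hx uniqueDiffOn_unitInterval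
    (fun j _ => ((hA i j).mul (hz j)) x hx), leibnizRemainder, ← Finset.sum_add_distrib]
  refine Finset.sum_congr rfl fun j _ => ?_
  have := iteratedDerivWithin_mul hx uniqueDiffOn_unitInterval (hA i j x hx) (hz j x hx)
  rw [Finset.sum_range_succ'] at this
  simp only [Nat.choose_zero_right, Nat.cast_one, one_mul, iteratedDerivWithin_zero,
    Nat.sub_zero] at this
  rw [add_comm]
  exact this

theorem abs_matVec_le {CA R : ℝ} {a z : Fin M → ℝ} (hCA : ∀ j, |a j| ≤ CA)
    (hz : ∀ j, |z j| ≤ R) : |∑ j, a j * z j| ≤ M * CA * R := by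
  calc |∑ j, a j * z j| ≤ ∑ _j : Fin M, CA * R := by
        refine (Finset.abs_sum_le_sum_abs _ _).trans (Finset.sum_le_sum fun j _ => ?_)
        rw [abs_mul]
        exact mul_le_mul (hCA j) (hz j) (abs_nonneg _) ((abs_nonneg _).trans (hCA j))
    _ = M * CA * R := by simp; ring

theorem abs_leibnizRemainder_le {CA R : ℝ} {k : ℕ} {i : Fin M} {x : ℝ} (hk : k ≤ 6)
    (hCA : ∀ l ≤ 6, ∀ j, |iteratedDerivWithin l (fun y => A y i j) 𝕀 x| ≤ CA)
    (hz : ∀ m < k, ∀ j, |iteratedDerivWithin m (z j) 𝕀 x| ≤ R) (hR : 0 ≤ R) :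
    |leibnizRemainder A z k i x| ≤ M * (64 * CA) * R := by
  have hin : ∀ j : Fin M, |∑ l ∈ Finset.range k, (k.choose (l + 1) : ℝ) *
      iteratedDerivWithin (l + 1) (fun y => A y i j) 𝕀 x *
      iteratedDerivWithin (k - (l + 1)) (z j) 𝕀 x| ≤ 64 * CA * R := by
    intro j
    have hCA0 : 0 ≤ CA := (abs_nonneg _).trans (hCA 0 (by norm_num) j)
    -- The binomial coefficients of the row sum to at most `2 ^ 6`, which is the source of the
    -- factor 64 in all later constants.
    have hsum : (∑ l ∈ Finset.range k, (k.choose (l + 1) : ℝ)) ≤ 64 := by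
      have h := Nat.sum_range_choose k
      rw [Finset.sum_range_succ'] at h
      have h2 : (2 : ℕ) ^ k ≤ 2 ^ 6 := Nat.pow_le_pow_right (by norm_num) hk
      have h3 : ∑ l ∈ Finset.range k, k.choose (l + 1) ≤ 64 := by omega
      exact_mod_cast h3
    calc _ ≤ ∑ l ∈ Finset.range k, (k.choose (l + 1) : ℝ) * (CA * R) := by
          refine (Finset.abs_sum_le_sum_abs _ _).trans (Finset.sum_le_sum fun l hl => ?_)
          have hl' := Finset.mem_range.1 hl
          rw [abs_mul, abs_mul, Nat.abs_cast, mul_assoc]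
          refine mul_le_mul_of_nonneg_left ?_ (Nat.cast_nonneg _)
          exact mul_le_mul (hCA _ (by omega) j) (hz _ (by omega) j) (abs_nonneg _) hCA0
      _ = (∑ l ∈ Finset.range k, (k.choose (l + 1) : ℝ)) * (CA * R) := by rw [Finset.sum_mul]
      _ ≤ 64 * (CA * R) := mul_le_mul_of_nonneg_right hsum (mul_nonneg hCA0 hR)
      _ = 64 * CA * R := by ring
  calc _ ≤ ∑ _j : Fin M, 64 * CA * R :=
        (Finset.abs_sum_le_sum_abs _ _).trans (Finset.sum_le_sum fun j _ => hin j)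
    _ = M * (64 * CA) * R := by simp; ring

/-- The equation `-ε z'' + A z = g`, differentiated `k` times. -/
theorem iteratedDerivWithin_of_eqn {ε : ℝ} {g : Fin M → ℝ → ℝ} {k : ℕ}
    (hA : ∀ i j, ContDiffOn ℝ k (fun x => A x i j) 𝕀)
    (hz : ∀ j, ContDiffOn ℝ (k + 2 : ℕ) (z j) 𝕀)
    (hg : ∀ x ∈ 𝕀, ∀ i, -ε * iteratedDerivWithin 2 (z i) 𝕀 x + ∑ j, A x i j * z j x = g i x)
    (i : Fin M) {x : ℝ} (hx : x ∈ 𝕀) :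
    -ε * iteratedDerivWithin (k + 2) (z i) 𝕀 x
      + ∑ j, A x i j * iteratedDerivWithin k (z j) 𝕀 x + leibnizRemainder A z k i x
      = iteratedDerivWithin k (g i) 𝕀 x := by
  have hz' : ∀ j, ContDiffOn ℝ k (z j) 𝕀 := fun j => (hz j).of_le (by norm_cast; omega)
  have h2 : ContDiffOn ℝ k (iteratedDerivWithin 2 (z i) 𝕀) 𝕀 := by
    refine contDiffOn_of_chain (G := fun n => iteratedDerivWithin (n + 2) (z i) 𝕀)
      uniqueDiffOn_unitInterval (fun n hn y hy => ?_) ?_ |>.congr (fun y _ => by simp)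
    · have := hasDerivWithinAt_iteratedDerivWithin uniqueDiffOn_unitInterval (hz i) (k := n + 2)
        (by omega) hy
      rwa [add_right_comm n 1 2]
    · exact (hz i).continuousOn_iteratedDerivWithin le_rfl uniqueDiffOn_unitInterval
  have hcongr : EqOn (g i)
      (fun x => -ε * iteratedDerivWithin 2 (z i) 𝕀 x + ∑ j, A x i j * z j x) 𝕀 :=
    fun y hy => (hg y hy i).symm
  rw [iteratedDerivWithin_congr hcongr hx,
    iteratedDerivWithin_fun_add hx uniqueDiffOn_unitInterval
      ((contDiffOn_const.mul h2) x hx) (contDiffOn_matVec hA hz' i x hx),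
    iteratedDerivWithin_const_mul_field, iteratedDerivWithin_matVec hA hz' i hx,
    iteratedDerivWithin_iteratedDerivWithin uniqueDiffOn_unitInterval (hz i) hx, add_assoc]

end Commutator

/-! ### Comparison principles -/

/-- A positive second derivative would make the point a local minimum as well, so `w` would be
locally constant and its second derivative zero. -/
theorem second_deriv_nonpos_of_isMaxOn {w w1 : ℝ → ℝ} {w2 x : ℝ} (hx : x ∈ Ioo (0 : ℝ) 1)
    (h1 : ∀ y ∈ 𝕀, HasDerivWithinAt w (w1 y) 𝕀 y) (h2 : HasDerivWithinAt w1 w2 𝕀 x)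
    (hmax : IsMaxOn w 𝕀 x) : w2 ≤ 0 := by
  have hI : 𝕀 ∈ nhds x := Icc_mem_nhds hx.1 hx.2
  have hloc : IsLocalMax w x := hmax.isLocalMax hI
  have hd : deriv w =ᶠ[nhds x] w1 := by
    filter_upwards [isOpen_Ioo.mem_nhds hx] with y hy
    exact ((h1 y (Ioo_subset_Icc_self hy)).hasDerivAt (Icc_mem_nhds hy.1 hy.2)).deriv
  have hdd : deriv (deriv w) x = w2 := by rw [hd.deriv_eq]; exact (h2.hasDerivAt hI).deriv
  by_contra! hpos
  have hmin : IsLocalMin w x := isLocalMin_of_deriv_deriv_pos (by rw [hdd]; exact hpos)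
    hloc.deriv_eq_zero ((h1 x (Ioo_subset_Icc_self hx)).hasDerivAt hI).continuousAt
  have hconst : w =ᶠ[nhds x] fun _ => w x := by
    filter_upwards [hloc, hmin] with y hy1 hy2
    exact le_antisymm hy1 hy2
  have h0 : deriv (deriv w) x = 0 := by
    rw [hconst.deriv.deriv_eq]; simp
  linarith

section Comparison

variable {M : ℕ} {A : ℝ → Matrix (Fin M) (Fin M) ℝ} {βs : ℝ}

/-- In the row of the largest component, replacing the other entries by the maximum can only
decrease the sum, because the off-diagonal coefficients are nonpositive; the row sum bound finishes.
-/
theorem IsCouplingMatrix.le_sum (hA : IsCouplingMatrix A βs) {x : ℝ} (hx : x ∈ 𝕀) {i : Fin M}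
    {d : Fin M → ℝ} (hd : ∀ j, d j ≤ d i) (hi : 0 ≤ d i) : βs * d i ≤ ∑ j, A x i j * d j := by
  calc βs * d i ≤ (∑ j, A x i j) * d i := mul_le_mul_of_nonneg_right (hA.rowSum_ge x hx i) hi
    _ = ∑ j, A x i j * d i := Finset.sum_mul ..
    _ ≤ ∑ j, A x i j * d j := by
        refine Finset.sum_le_sum fun j _ => ?_
        rcases eq_or_ne i j with rfl | hij
        · exact le_rfl
        · exact mul_le_mul_of_nonpos_left (hd j) (hA.offDiag_nonpos x hx i j hij)

/-- If `w i - E` has a positive maximum at `x`, then `L (w - E) ≥ βs (w - E)` there. -/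
theorem IsCouplingMatrix.operator_ge (hA : IsCouplingMatrix A βs) {ε : ℝ} (hε : 0 < ε)
    {w w1 : Fin M → ℝ → ℝ} {w2 : ℝ} {E E1 E2 : ℝ → ℝ} {i : Fin M} {x : ℝ} (hx : x ∈ Ioo (0 : ℝ) 1)
    (h1 : ∀ y ∈ 𝕀, HasDerivWithinAt (w i) (w1 i y) 𝕀 y) (h2 : HasDerivWithinAt (w1 i) w2 𝕀 x)
    (hE1 : ∀ y, HasDerivAt E (E1 y) y) (hE2 : ∀ y, HasDerivAt E1 (E2 y) y) (hE0 : 0 ≤ E x)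
    (hmax : ∀ y ∈ 𝕀, ∀ j, w j y - E y ≤ w i x - E x) (hpos : 0 ≤ w i x - E x) :
    -ε * E2 x + βs * E x + βs * (w i x - E x) ≤ -ε * w2 + ∑ j, A x i j * w j x := by
  have hxI := Ioo_subset_Icc_self hx
  have hsec := second_deriv_nonpos_of_isMaxOn (w := fun y => w i y - E y) hx
    (fun y hy => (h1 y hy).sub (hE1 y).hasDerivWithinAt) (h2.sub (hE2 x).hasDerivWithinAt)
    (fun y hy => hmax y hy i)
  have hsum := hA.le_sum hxI (d := fun j => w j x - E x) (fun j => hmax x hxI j) hpos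
  have hrow : βs * E x ≤ (∑ j, A x i j) * E x :=
    mul_le_mul_of_nonneg_right (hA.rowSum_ge x hxI i) hE0
  have hsplit : ∑ j, A x i j * (w j x - E x) = ∑ j, A x i j * w j x - (∑ j, A x i j) * E x := by
    simp only [mul_sub, Finset.sum_sub_distrib, Finset.sum_mul]
  have := mul_nonneg hε.le (sub_nonneg.2 hsec)
  nlinarith

/-- The coupling is handled by maximising `w j - E` over the points and over the components at once.
At a positive interior maximum, `operator_ge` contradicts the differential inequality, strictly
because `βs > 0`. -/
theorem elliptic_le (hA : IsCouplingMatrix A βs) (hβs : 0 < βs) {ε τ : ℝ} (hε : 0 < ε)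
    (hτ : 0 < τ) {w w1 w2 : Fin M → ℝ → ℝ} {E E1 E2 : ℝ → ℝ}
    (h1 : ∀ i, ∀ y ∈ 𝕀, HasDerivWithinAt (w i) (w1 i y) 𝕀 y)
    (h2 : ∀ i, ∀ y ∈ 𝕀, HasDerivWithinAt (w1 i) (w2 i y) 𝕀 y)
    (hE1 : ∀ y, HasDerivAt E (E1 y) y) (hE2 : ∀ y, HasDerivAt E1 (E2 y) y)
    (hE0 : ∀ x ∈ 𝕀, 0 ≤ E x) (hb : ∀ i, w i 0 ≤ E 0 ∧ w i 1 ≤ E 1)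
    (h : ∀ x ∈ Ioo (0 : ℝ) 1, ∀ i, w i x + τ / 2 * (-ε * w2 i x + ∑ j, A x i j * w j x)
      ≤ E x + τ / 2 * (-ε * E2 x + βs * E x)) (i : Fin M) {x : ℝ} (hx : x ∈ 𝕀) :
    w i x ≤ E x := by
  have hcont : ∀ j, ContinuousOn (fun y => w j y - E y) 𝕀 := fun j y hy =>
    (h1 j y hy).continuousWithinAt.sub (hE1 y).continuousAt.continuousWithinAt
  have hex : ∀ j, ∃ y ∈ 𝕀, IsMaxOn (fun y => w j y - E y) 𝕀 y := fun j =>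
    isCompact_Icc.exists_isMaxOn ⟨x, hx⟩ (hcont j)
  choose p hp hpmax using hex
  obtain ⟨i₀, -, hi₀⟩ := Finset.exists_max_image Finset.univ (fun j => w j (p j) - E (p j))
    ⟨i, Finset.mem_univ i⟩
  have hmax : ∀ y ∈ 𝕀, ∀ j, w j y - E y ≤ w i₀ (p i₀) - E (p i₀) := fun y hy j =>
    (hpmax j hy).trans (hi₀ j (Finset.mem_univ j))
  by_contra! hlt
  have hpos : 0 < w i₀ (p i₀) - E (p i₀) := by linarith [hmax x hx i]
  have hIoo : p i₀ ∈ Ioo (0 : ℝ) 1 := by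
    refine ⟨(hp i₀).1.lt_of_ne fun h0 => ?_, (hp i₀).2.lt_of_ne fun h0 => ?_⟩
    · rw [← h0] at hpos; linarith [(hb i₀).1]
    · rw [h0] at hpos; linarith [(hb i₀).2]
  have := hA.operator_ge hε hIoo (h1 i₀) (h2 i₀ _ (hp i₀)) hE1 hE2 (hE0 _ (hp i₀)) hmax hpos.le
  have h3 := h _ hIoo i₀
  have h4 := mul_le_mul_of_nonneg_left this (half_pos hτ).le
  have h5 := mul_pos (half_pos hτ) (mul_pos hβs hpos)
  linarith

theorem elliptic_abs_le (hA : IsCouplingMatrix A βs) (hβs : 0 < βs) {ε τ : ℝ} (hε : 0 < ε)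
    (hτ : 0 < τ) {w w1 w2 : Fin M → ℝ → ℝ} {E E1 E2 : ℝ → ℝ}
    (h1 : ∀ i, ∀ y ∈ 𝕀, HasDerivWithinAt (w i) (w1 i y) 𝕀 y)
    (h2 : ∀ i, ∀ y ∈ 𝕀, HasDerivWithinAt (w1 i) (w2 i y) 𝕀 y)
    (hE1 : ∀ y, HasDerivAt E (E1 y) y) (hE2 : ∀ y, HasDerivAt E1 (E2 y) y)
    (hE0 : ∀ x ∈ 𝕀, 0 ≤ E x) (hb : ∀ i, |w i 0| ≤ E 0 ∧ |w i 1| ≤ E 1)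
    (h : ∀ x ∈ Ioo (0 : ℝ) 1, ∀ i, |w i x + τ / 2 * (-ε * w2 i x + ∑ j, A x i j * w j x)|
      ≤ E x + τ / 2 * (-ε * E2 x + βs * E x)) (i : Fin M) {x : ℝ} (hx : x ∈ 𝕀) :
    |w i x| ≤ E x := by
  refine abs_le'.2 ⟨?_, ?_⟩
  · exact elliptic_le hA hβs hε hτ h1 h2 hE1 hE2 hE0
      (fun j => ⟨(le_abs_self _).trans (hb j).1, (le_abs_self _).trans (hb j).2⟩)
      (fun y hy j => (le_abs_self _).trans (h y hy j)) i hx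
  · refine elliptic_le (w := fun i y => -w i y) (w1 := fun i y => -w1 i y)
      (w2 := fun i y => -w2 i y) hA hβs hε hτ (fun j y hy => (h1 j y hy).neg)
      (fun j y hy => (h2 j y hy).neg) hE1 hE2 hE0
      (fun j => ⟨(neg_le_abs _).trans (hb j).1, (neg_le_abs _).trans (hb j).2⟩)
      (fun y hy j => le_trans (le_of_eq ?_) ((neg_le_abs _).trans (h y hy j))) i hx
    simp only [mul_neg, Finset.sum_neg_distrib]; ring

/-- Only slopes from the left are used, so the final time `t = T` is covered. -/
theorem deriv_nonneg_of_isMaxOn_Icc {T t d : ℝ} {w : ℝ → ℝ} (ht : t ∈ Ioc 0 T)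
    (h : HasDerivWithinAt w d (Icc 0 T) t) (hmax : IsMaxOn w (Icc 0 T) t) : 0 ≤ d := by
  have h' : HasDerivWithinAt w d (Ioo 0 t) t :=
    h.mono fun s hs => ⟨hs.1.le, hs.2.le.trans ht.2⟩
  rw [hasDerivWithinAt_iff_tendsto_slope' (by simp)] at h'
  have : (nhdsWithin t (Ioo 0 t)).NeBot := by
    rw [nhdsWithin_Ioo_eq_nhdsLT ht.1]; infer_instance
  refine ge_of_tendsto h' ?_
  filter_upwards [self_mem_nhdsWithin] with s hs
  have h1 : w s ≤ w t := hmax ⟨hs.1.le, hs.2.le.trans ht.2⟩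
  rw [slope_def_field]
  exact div_nonneg_of_nonpos (by linarith) (by linarith [hs.2])

/-- The barrier is independent of time, and no growth factor in `t` is needed: the term `βs (w - E)
> 0` already makes the inequality strict at a positive maximum. -/
theorem parabolic_le (hA : IsCouplingMatrix A βs) (hβs : 0 < βs) {ε T : ℝ} (hε : 0 < ε)
    {w wt w1 w2 : Fin M → ℝ → ℝ → ℝ} {E E1 E2 : ℝ → ℝ}
    (hc : ∀ i, ContinuousOn (fun z : ℝ × ℝ => w i z.1 z.2) (𝕀 ×ˢ Icc 0 T))
    (ht : ∀ i, ∀ x ∈ 𝕀, ∀ t ∈ Icc 0 T, HasDerivWithinAt (w i x) (wt i x t) (Icc 0 T) t)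
    (h1 : ∀ i, ∀ y ∈ 𝕀, ∀ t ∈ Icc 0 T, HasDerivWithinAt (fun y => w i y t) (w1 i y t) 𝕀 y)
    (h2 : ∀ i, ∀ y ∈ 𝕀, ∀ t ∈ Icc 0 T, HasDerivWithinAt (fun y => w1 i y t) (w2 i y t) 𝕀 y)
    (hE1 : ∀ y, HasDerivAt E (E1 y) y) (hE2 : ∀ y, HasDerivAt E1 (E2 y) y)
    (hE0 : ∀ x ∈ 𝕀, 0 ≤ E x) (hb : ∀ i, ∀ t ∈ Icc 0 T, w i 0 t ≤ E 0 ∧ w i 1 t ≤ E 1)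
    (hinit : ∀ i, ∀ x ∈ 𝕀, w i x 0 ≤ E x)
    (h : ∀ x ∈ Ioo (0 : ℝ) 1, ∀ t ∈ Ioc 0 T, ∀ i,
      wt i x t + (-ε * w2 i x t + ∑ j, A x i j * w j x t) ≤ -ε * E2 x + βs * E x)
    (i : Fin M) {x t : ℝ} (hx : x ∈ 𝕀) (htT : t ∈ Icc 0 T) : w i x t ≤ E x := by
  have hEc : Continuous E := continuous_iff_continuousAt.2 fun y => (hE1 y).continuousAt
  have hcont : ∀ j, ContinuousOn (fun z : ℝ × ℝ => w j z.1 z.2 - E z.1) (𝕀 ×ˢ Icc 0 T) :=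
    fun j => (hc j).sub (by fun_prop)
  have hex : ∀ j, ∃ z ∈ 𝕀 ×ˢ Icc 0 T,
      IsMaxOn (fun z : ℝ × ℝ => w j z.1 z.2 - E z.1) (𝕀 ×ˢ Icc 0 T) z := fun j =>
    (isCompact_Icc.prod isCompact_Icc).exists_isMaxOn ⟨(x, t), hx, htT⟩ (hcont j)
  choose p hp hpmax using hex
  obtain ⟨i₀, -, hi₀⟩ := Finset.exists_max_image Finset.univ
    (fun j => w j (p j).1 (p j).2 - E (p j).1) ⟨i, Finset.mem_univ i⟩
  obtain ⟨hpx, hpt⟩ := hp i₀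
  generalize hx₀ : (p i₀).1 = x₀ at *
  generalize ht₀ : (p i₀).2 = t₀ at *
  have hmax : ∀ y ∈ 𝕀, ∀ s ∈ Icc 0 T, ∀ j, w j y s - E y ≤ w i₀ x₀ t₀ - E x₀ := by
    intro y hy s hs j
    have ha : w j y s - E y ≤ w j (p j).1 (p j).2 - E (p j).1 :=
      hpmax j (show (y, s) ∈ _ from ⟨hy, hs⟩)
    have hb := hi₀ j (Finset.mem_univ j)
    exact ha.trans hb
  by_contra! hlt
  have hpos : 0 < w i₀ x₀ t₀ - E x₀ := by linarith [hmax x hx t htT i]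
  have hIoo : x₀ ∈ Ioo (0 : ℝ) 1 := by
    refine ⟨hpx.1.lt_of_ne fun h0 => ?_, hpx.2.lt_of_ne fun h0 => ?_⟩
    · rw [← h0] at hpos; linarith [(hb i₀ t₀ hpt).1]
    · rw [h0] at hpos; linarith [(hb i₀ t₀ hpt).2]
  have hIoc : t₀ ∈ Ioc 0 T := by
    refine ⟨hpt.1.lt_of_ne fun h0 => ?_, hpt.2⟩
    rw [← h0] at hpos; linarith [hinit i₀ x₀ hpx]
  have hL := hA.operator_ge hε (w := fun j y => w j y t₀) (w1 := fun j y => w1 j y t₀) hIoo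
    (fun y hy => h1 i₀ y hy t₀ hpt) (h2 i₀ x₀ hpx t₀ hpt) hE1 hE2 (hE0 _ hpx)
    (fun y hy j => hmax y hy t₀ hpt j) hpos.le
  have hT := deriv_nonneg_of_isMaxOn_Icc hIoc (ht i₀ x₀ hpx t₀ hpt)
    (fun s hs => by simpa using hmax x₀ hpx s hs i₀)
  have h3 := h x₀ hIoo t₀ hIoc i₀
  have h5 := mul_pos hβs hpos
  linarith

theorem parabolic_abs_le (hA : IsCouplingMatrix A βs) (hβs : 0 < βs) {ε T : ℝ} (hε : 0 < ε)
    {w wt w1 w2 : Fin M → ℝ → ℝ → ℝ} {E E1 E2 : ℝ → ℝ}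
    (hc : ∀ i, ContinuousOn (fun z : ℝ × ℝ => w i z.1 z.2) (𝕀 ×ˢ Icc 0 T))
    (ht : ∀ i, ∀ x ∈ 𝕀, ∀ t ∈ Icc 0 T, HasDerivWithinAt (w i x) (wt i x t) (Icc 0 T) t)
    (h1 : ∀ i, ∀ y ∈ 𝕀, ∀ t ∈ Icc 0 T, HasDerivWithinAt (fun y => w i y t) (w1 i y t) 𝕀 y)
    (h2 : ∀ i, ∀ y ∈ 𝕀, ∀ t ∈ Icc 0 T, HasDerivWithinAt (fun y => w1 i y t) (w2 i y t) 𝕀 y)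
    (hE1 : ∀ y, HasDerivAt E (E1 y) y) (hE2 : ∀ y, HasDerivAt E1 (E2 y) y)
    (hE0 : ∀ x ∈ 𝕀, 0 ≤ E x) (hb : ∀ i, ∀ t ∈ Icc 0 T, |w i 0 t| ≤ E 0 ∧ |w i 1 t| ≤ E 1)
    (hinit : ∀ i, ∀ x ∈ 𝕀, |w i x 0| ≤ E x)
    (h : ∀ x ∈ Ioo (0 : ℝ) 1, ∀ t ∈ Ioc 0 T, ∀ i,
      |wt i x t + (-ε * w2 i x t + ∑ j, A x i j * w j x t)| ≤ -ε * E2 x + βs * E x)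
    (i : Fin M) {x t : ℝ} (hx : x ∈ 𝕀) (htT : t ∈ Icc 0 T) : |w i x t| ≤ E x := by
  refine abs_le'.2 ⟨?_, ?_⟩
  · exact parabolic_le hA hβs hε hc ht h1 h2 hE1 hE2 hE0
      (fun j s hs => ⟨(le_abs_self _).trans (hb j s hs).1, (le_abs_self _).trans (hb j s hs).2⟩)
      (fun j y hy => (le_abs_self _).trans (hinit j y hy))
      (fun y hy s hs j => (le_abs_self _).trans (h y hy s hs j)) i hx htT
  · refine parabolic_le (w := fun i y s => -w i y s) (w1 := fun i y s => -w1 i y s)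
      (w2 := fun i y s => -w2 i y s) (wt := fun i y s => -wt i y s) hA hβs hε
      (fun j => (hc j).neg) (fun j y hy s hs => (ht j y hy s hs).neg)
      (fun j y hy s hs => (h1 j y hy s hs).neg) (fun j y hy s hs => (h2 j y hy s hs).neg)
      hE1 hE2 hE0
      (fun j s hs => ⟨(neg_le_abs _).trans (hb j s hs).1, (neg_le_abs _).trans (hb j s hs).2⟩)
      (fun j y hy => (neg_le_abs _).trans (hinit j y hy))
      (fun y hy s hs j => le_trans (le_of_eq ?_) ((neg_le_abs _).trans (h y hy s hs j))) i hx htT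
    simp only [mul_neg, Finset.sum_neg_distrib]; ring

end Comparison

/-! ### The layer barrier and the endpoint barrier -/

section Barriers

/-- The sum of the two boundary layer functions. -/
noncomputable def layer (β ε x : ℝ) : ℝ :=
  Real.exp (-x * Real.sqrt (β / ε)) + Real.exp (-(1 - x) * Real.sqrt (β / ε))

theorem layer_pos (β ε x : ℝ) : 0 < layer β ε x := by unfold layer; positivity

theorem one_le_layer_zero (β ε : ℝ) : 1 ≤ layer β ε 0 := by
  unfold layer; simp; positivity

theorem one_le_layer_one (β ε : ℝ) : 1 ≤ layer β ε 1 := by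
  unfold layer; simp; positivity

theorem exists_hasDerivAt_layer {β ε : ℝ} (hβ : 0 < β) (hε : 0 < ε) (K q : ℝ) :
    ∃ E1 : ℝ → ℝ, (∀ x, HasDerivAt (fun x => K * (1 + q * layer β ε x)) (E1 x) x) ∧
      ∀ x, HasDerivAt E1 (K * q * (β / ε) * layer β ε x) x := by
  set c := Real.sqrt (β / ε) with hc
  have hc2 : c * c = β / ε := Real.mul_self_sqrt (div_pos hβ hε).le
  have h1 : ∀ x, HasDerivAt (fun x => Real.exp (-x * c)) (Real.exp (-x * c) * -c) x := fun x => by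
    have := ((hasDerivAt_id x).neg.mul_const c).exp
    simpa using this
  have h2 : ∀ x, HasDerivAt (fun x => Real.exp (-(1 - x) * c)) (Real.exp (-(1 - x) * c) * c) x :=
    fun x => by
      have := ((((hasDerivAt_id x).const_sub 1).neg).mul_const c).exp
      simpa using this
  refine ⟨fun x => K * (q * (Real.exp (-x * c) * -c + Real.exp (-(1 - x) * c) * c)), fun x => ?_,
    fun x => ?_⟩
  · exact ((((h1 x).add (h2 x)).const_mul q).const_add 1).const_mul K
  · refine (((((h1 x).mul_const (-c)).add ((h2 x).mul_const c)).const_mul q).const_mul K).congr_deriv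
      ?_
    rw [← hc2, layer]; ring

/-- `-ε d²/dx² + β` annihilates the layer function, so applying `-ε d²/dx² + βs` leaves `βs - β`
times the layer and `βs` times the constant part. The strict gap `β < βs` is what later absorbs
sources and commutators. -/
theorem layer_operator_ge {β βs ε K q : ℝ} (hε : 0 < ε) (hβ : 0 ≤ β) (hK : 0 ≤ K) (x : ℝ) :
    (βs - β) * (K * (1 + q * layer β ε x)) ≤
      -ε * (K * q * (β / ε) * layer β ε x) + βs * (K * (1 + q * layer β ε x)) := by
  have : ε * (β / ε) = β := by field_simp
  have h2 : -ε * (K * q * (β / ε) * layer β ε x) = -(K * q * layer β ε x * β) := by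
    linear_combination -(K * q * layer β ε x) * this
  rw [h2]
  nlinarith [mul_nonneg hK hβ]

/-- `x₀` is an endpoint of `[0,1]`, and `σ` is the direction that points into the interval. -/
def IsEndpoint (x₀ σ : ℝ) : Prop := (x₀ = 0 ∧ σ = 1) ∨ (x₀ = 1 ∧ σ = -1)

theorem IsEndpoint.mem {x₀ σ : ℝ} (h : IsEndpoint x₀ σ) : x₀ ∈ 𝕀 := by
  rcases h with ⟨rfl, -⟩ | ⟨rfl, -⟩ <;> simp

theorem IsEndpoint.mul_self {x₀ σ : ℝ} (h : IsEndpoint x₀ σ) : σ * σ = 1 := by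
  rcases h with ⟨-, rfl⟩ | ⟨-, rfl⟩ <;> norm_num

theorem IsEndpoint.mul_sub {x₀ σ : ℝ} (h : IsEndpoint x₀ σ) {x : ℝ} (hx : x ∈ 𝕀) :
    σ * (x - x₀) = |x - x₀| := by
  rcases h with ⟨rfl, rfl⟩ | ⟨rfl, rfl⟩
  · rw [abs_of_nonneg (by linarith [hx.1])]; ring
  · rw [abs_of_nonpos (by linarith [hx.2])]; ring

theorem IsEndpoint.abs_sub_le_one {x₀ σ : ℝ} (h : IsEndpoint x₀ σ) {x : ℝ} (hx : x ∈ 𝕀) :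
    |x - x₀| ≤ 1 := by
  rw [abs_le]
  rcases h with ⟨rfl, rfl⟩ | ⟨rfl, rfl⟩ <;> constructor <;> linarith [hx.1, hx.2]

/-- A barrier function that vanishes at the endpoint `x₀` and has slope of order `ε^(-1/2)`
there. -/
noncomputable def endBarrier (β ε x₀ σ x : ℝ) : ℝ :=
  1 - Real.exp (-(σ * (x - x₀) * Real.sqrt (β / ε)))

variable {β ε x₀ σ : ℝ}

theorem exists_hasDerivAt_endBarrier (h : IsEndpoint x₀ σ) (hβ : 0 < β) (hε : 0 < ε) (K : ℝ) :
    ∃ E1 : ℝ → ℝ, (∀ x, HasDerivAt (fun x => K * endBarrier β ε x₀ σ x) (E1 x) x) ∧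
      ∀ x, HasDerivAt E1 (K * (-(β / ε) * (1 - endBarrier β ε x₀ σ x))) x := by
  set c := Real.sqrt (β / ε) with hc
  have hc2 : c * c = β / ε := Real.mul_self_sqrt (div_pos hβ hε).le
  have h1 : ∀ x, HasDerivAt (fun x => Real.exp (-(σ * (x - x₀) * c)))
      (Real.exp (-(σ * (x - x₀) * c)) * -(σ * c)) x := fun x => by
    have := (((((hasDerivAt_id x).sub_const x₀).const_mul σ).mul_const c).neg).exp
    simpa using this
  refine ⟨fun x => K * -(Real.exp (-(σ * (x - x₀) * c)) * -(σ * c)), fun x => ?_, fun x => ?_⟩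
  · exact ((h1 x).const_sub 1).const_mul K
  · refine ((((h1 x).mul_const (-(σ * c))).neg).const_mul K).congr_deriv ?_
    rw [← hc2, endBarrier, ← hc]
    linear_combination (-K * c * c * Real.exp (-(σ * (x - x₀) * c))) * h.mul_self

theorem endBarrier_nonneg (h : IsEndpoint x₀ σ) {x : ℝ} (hx : x ∈ 𝕀) :
    0 ≤ endBarrier β ε x₀ σ x := by
  rw [endBarrier, h.mul_sub hx, sub_nonneg, Real.exp_le_one_iff, neg_nonpos]
  positivity

/-- With `b` the barrier, `-ε b'' + βs b = β (1 - b) + βs b = β + (βs - β) b`. Thus a source of size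
one is absorbed although `b` vanishes at `x₀`. -/
theorem endBarrier_operator_ge (h : IsEndpoint x₀ σ) {βs K : ℝ} (hK : 0 ≤ K) (hε : 0 < ε)
    (hβs : β ≤ βs) {x : ℝ} (hx : x ∈ 𝕀) :
    K * β ≤ -ε * (K * (-(β / ε) * (1 - endBarrier β ε x₀ σ x)))
      + βs * (K * endBarrier β ε x₀ σ x) := by
  have h1 : ε * (β / ε) = β := by field_simp
  have h2 : -ε * (K * (-(β / ε) * (1 - endBarrier β ε x₀ σ x)))
      = K * β * (1 - endBarrier β ε x₀ σ x) := by
    linear_combination K * (1 - endBarrier β ε x₀ σ x) * h1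
  rw [h2]
  nlinarith [mul_nonneg (mul_nonneg hK (endBarrier_nonneg (β := β) (ε := ε) h hx))
    (sub_nonneg.2 hβs)]

theorem endBarrier_le (h : IsEndpoint x₀ σ) {x : ℝ} (hx : x ∈ 𝕀) :
    endBarrier β ε x₀ σ x ≤ Real.sqrt (β / ε) * |x - x₀| := by
  rw [endBarrier, h.mul_sub hx]
  linarith [Real.add_one_le_exp (-(|x - x₀| * Real.sqrt (β / ε)))]

/-- This lets the barrier dominate initial data of size `|x - x₀|` uniformly in `ε`. As `ε ≤ 1`, the
rate is at least `√β`; then `1 - e^(-s) ≥ s e^(-s)` with `s = |x - x₀| √β ≤ √β`. -/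
theorem le_endBarrier (h : IsEndpoint x₀ σ) (hβ : 0 < β) (hε : 0 < ε) (hε1 : ε ≤ 1) {x : ℝ}
    (hx : x ∈ 𝕀) :
    Real.sqrt β * Real.exp (-Real.sqrt β) * |x - x₀| ≤ endBarrier β ε x₀ σ x := by
  rw [endBarrier, h.mul_sub hx]
  set r := |x - x₀| with hr
  have hr0 : 0 ≤ r := abs_nonneg _
  have hr1 : r ≤ 1 := h.abs_sub_le_one hx
  set b := Real.sqrt β
  have hb : 0 ≤ b := Real.sqrt_nonneg _
  have hbe : b ≤ Real.sqrt (β / ε) := Real.sqrt_le_sqrt (le_div_self hβ.le hε hε1)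
  have h1 : Real.exp (-(r * Real.sqrt (β / ε))) ≤ Real.exp (-(r * b)) :=
    Real.exp_le_exp.2 (neg_le_neg (mul_le_mul_of_nonneg_left hbe hr0))
  have h2 : Real.exp (-b) ≤ Real.exp (-(r * b)) :=
    Real.exp_le_exp.2 (neg_le_neg (mul_le_of_le_one_left hb hr1))
  have h3 := Real.add_one_le_exp (r * b)
  have h4 : Real.exp (r * b) * Real.exp (-(r * b)) = 1 := by rw [← Real.exp_add]; simp
  have h5 := mul_le_mul_of_nonneg_right h3 (Real.exp_pos (-(r * b))).le
  have h6 := mul_le_mul_of_nonneg_left h2 (mul_nonneg hr0 hb)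
  nlinarith

theorem abs_deriv_le_of_abs_le {K d : ℝ} {g : ℝ → ℝ} (hx₀ : x₀ ∈ 𝕀)
    (hd : HasDerivWithinAt g d 𝕀 x₀) (h : ∀ x ∈ 𝕀, |g x| ≤ K * |x - x₀|) : |d| ≤ K := by
  have h0 : g x₀ = 0 := by simpa using h x₀ hx₀
  have hne : (nhdsWithin x₀ (𝕀 \ {x₀})).NeBot := by
    have := (uniqueDiffOn_unitInterval x₀ hx₀).accPt
    rwa [accPt_principal_iff_nhdsWithin] at this
  rw [hasDerivWithinAt_iff_tendsto_slope] at hd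
  refine le_of_tendsto hd.abs ?_
  filter_upwards [self_mem_nhdsWithin] with x hx
  have hpos : 0 < |x - x₀| := abs_pos.2 (sub_ne_zero.2 hx.2)
  rw [slope_def_field, h0, sub_zero, abs_div, div_le_iff₀ hpos]
  exact h x hx.1

theorem abs_deriv_le_of_endBarrier (hend : IsEndpoint x₀ σ) (hβ : 0 < β) {K d : ℝ} (hK : 0 ≤ K)
    {g : ℝ → ℝ} (hd : HasDerivWithinAt g d 𝕀 x₀)
    (h : ∀ x ∈ 𝕀, |g x| ≤ K * endBarrier β ε x₀ σ x) :
    |d| ≤ K * Real.sqrt β / Real.sqrt ε := by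
  refine abs_deriv_le_of_abs_le hend.mem hd fun x hx => (h x hx).trans ?_
  rw [mul_div_assoc, ← Real.sqrt_div hβ.le, mul_assoc]
  exact mul_le_mul_of_nonneg_left (endBarrier_le hend hx) hK

end Barriers

/-! ### Uniform bounds on the data -/

section Data

variable {M : ℕ} {A : ℝ → Matrix (Fin M) (Fin M) ℝ} {βs T : ℝ} {f : ℝ → ℝ → Fin M → ℝ}

/-- The derivative `∂_x^a ∂_t^b` of the `i`-th component of `u`. -/
noncomputable def compDeriv (T : ℝ) (u : ℝ → ℝ → Fin M → ℝ) (a b : ℕ) (i : Fin M) (x t : ℝ) : ℝ :=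
  mixedDeriv T a b (fun x t => u x t i) x t

/-- `C` bounds the coefficients and the source term together with their derivatives. -/
structure IsDataBound (T : ℝ) (A : ℝ → Matrix (Fin M) (Fin M) ℝ) (f : ℝ → ℝ → Fin M → ℝ) (C : ℝ) :
    Prop where
  nonneg : 0 ≤ C
  coeff : ∀ l ≤ 6, ∀ i j, ∀ x ∈ 𝕀, |iteratedDerivWithin l (fun y => A y i j) 𝕀 x| ≤ C
  source : ∀ a b : ℕ, a + 2 * b ≤ 6 → ∀ i, ∀ x ∈ 𝕀, ∀ t ∈ Icc 0 T, |compDeriv T f a b i x t| ≤ C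

theorem exists_isDataBound (hA : IsCouplingMatrix A βs) (hf : IsCompatibleSource T f) :
    ∃ C, IsDataBound T A f C := by
  have h1 := fun i j => exists_bound_of_contDiffOn (n := 6) (by exact_mod_cast hA.smooth i j)
  have h2 := fun i => (hf.smooth i).exists_bound
  choose C1 hC1 using h1
  choose C2 hC2 using h2
  have hle1 : ∀ i j, C1 i j ≤ ∑ i, ∑ j, |C1 i j| := fun i j =>
    (le_abs_self _).trans ((Finset.single_le_sum (f := fun j => |C1 i j|)
      (fun _ _ => abs_nonneg _) (Finset.mem_univ j)).trans
      (Finset.single_le_sum (f := fun i => ∑ j, |C1 i j|)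
        (fun _ _ => Finset.sum_nonneg fun _ _ => abs_nonneg _) (Finset.mem_univ i)))
  have hle2 : ∀ i, C2 i ≤ ∑ i, |C2 i| := fun i =>
    (le_abs_self _).trans (Finset.single_le_sum (f := fun i => |C2 i|)
      (fun _ _ => abs_nonneg _) (Finset.mem_univ i))
  have hn1 : 0 ≤ ∑ i, ∑ j, |C1 i j| :=
    Finset.sum_nonneg fun _ _ => Finset.sum_nonneg fun _ _ => abs_nonneg _
  have hn2 : 0 ≤ ∑ i, |C2 i| := Finset.sum_nonneg fun _ _ => abs_nonneg _
  refine ⟨(∑ i, ∑ j, |C1 i j|) + ∑ i, |C2 i|, by positivity, fun l hl i j x hx => ?_,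
    fun a b hab i x hx t ht => ?_⟩
  · linarith [hC1 i j l hl x hx, hle1 i j]
  · have := hC2 i a b (by omega) x hx t ht
    rw [compDeriv]
    linarith [hle2 i]

theorem IsDataBound.coeff_zero {C : ℝ} (hC : IsDataBound T A f C) (i j : Fin M) {x : ℝ}
    (hx : x ∈ 𝕀) : |A x i j| ≤ C := by
  simpa using hC.coeff 0 (by norm_num) i j x hx

theorem abs_sub_le_of_hasDerivWithinAt {a b C : ℝ} {g g1 : ℝ → ℝ}
    (h : ∀ x ∈ Icc a b, HasDerivWithinAt g (g1 x) (Icc a b) x) (hC : ∀ x ∈ Icc a b, |g1 x| ≤ C)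
    {x y : ℝ} (hx : x ∈ Icc a b) (hy : y ∈ Icc a b) : |g x - g y| ≤ C * |x - y| := by
  have := (convex_Icc a b).norm_image_sub_le_of_norm_hasDerivWithin_le h
    (fun z hz => by simpa using hC z hz) hy hx
  simpa using this

/-- The corner conditions make these derivatives vanish at `(x₀, 0)`, and one more space derivative
is still bounded, so the mean value inequality applies. -/
theorem source_initial_le (hf : IsCompatibleSource T f) (hT : 0 < T) {C : ℝ}
    (hC : IsDataBound T A f C) {x₀ σ : ℝ} (hend : IsEndpoint x₀ σ) {a b : ℕ} (hab : a + 2 * b ≤ 4)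
    (i : Fin M) {x : ℝ} (hx : x ∈ 𝕀) : |compDeriv T f a b i x 0| ≤ C * |x - x₀| := by
  have h0 : (0 : ℝ) ∈ Icc 0 T := ⟨le_rfl, hT.le⟩
  have := abs_sub_le_of_hasDerivWithinAt (g := fun y => compDeriv T f a b i y 0)
    (fun y hy => (hf.smooth i).hasDerivWithinAt_left (i := a) (j := b) (by omega) hy h0)
    (fun y hy => hC.source (a + 1) b (by omega) i y hy 0 h0) hx hend.mem
  have hz : compDeriv T f a b i x₀ 0 = 0 := by
    rcases hend with ⟨rfl, -⟩ | ⟨rfl, -⟩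
    · exact (hf.compat i a b hab).1
    · exact (hf.compat i a b hab).2
  simpa [hz] using this

end Data

/-! ### Time derivatives of the parabolic solution -/

section Parabolic

variable {M : ℕ} {A : ℝ → Matrix (Fin M) (Fin M) ℝ} {βs T ε : ℝ} {f u : ℝ → ℝ → Fin M → ℝ}

theorem compDeriv_zero_zero (u : ℝ → ℝ → Fin M → ℝ) (i : Fin M) (x t : ℝ) :
    compDeriv T u 0 0 i x t = u x t i := by simp [compDeriv, mixedDeriv]

theorem iteratedDerivWithin_compDeriv_zero (u : ℝ → ℝ → Fin M → ℝ) (a b : ℕ) (i : Fin M)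
    (x t : ℝ) :
    iteratedDerivWithin a (fun y => compDeriv T u 0 b i y t) 𝕀 x = compDeriv T u a b i x t :=
  iteratedDerivWithin_mixedDeriv_zero a b x t

theorem continuousOn_compDeriv (hu : ∀ i, ParabolicC 3 T (fun x t => u x t i)) {a b : ℕ}
    (hab : a + 2 * b ≤ 6) (i : Fin M) :
    ContinuousOn (fun z : ℝ × ℝ => compDeriv T u a b i z.1 z.2) (𝕀 ×ˢ Icc 0 T) :=
  (hu i a b hab).2.2

theorem hasDerivWithinAt_compDeriv_left (hu : ∀ i, ParabolicC 3 T (fun x t => u x t i)) {a b : ℕ}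
    (hab : a + 1 + 2 * b ≤ 6) (i : Fin M) {x t : ℝ} (hx : x ∈ 𝕀) (ht : t ∈ Icc 0 T) :
    HasDerivWithinAt (fun y => compDeriv T u a b i y t) (compDeriv T u (a + 1) b i x t) 𝕀 x :=
  (hu i).hasDerivWithinAt_left hab hx ht

theorem hasDerivWithinAt_compDeriv_right (hT : 0 < T)
    (hu : ∀ i, ParabolicC 3 T (fun x t => u x t i)) {a b : ℕ}
    (hab : a + 2 * (b + 1) ≤ 6) (i : Fin M) {x t : ℝ} (hx : x ∈ 𝕀) (ht : t ∈ Icc 0 T) :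
    HasDerivWithinAt (fun s => compDeriv T u a b i x s) (compDeriv T u a (b + 1) i x t)
      (Icc 0 T) t :=
  (hu i).hasDerivWithinAt_right hT hab hx ht

theorem contDiffOn_compDeriv (hu : ∀ i, ParabolicC 3 T (fun x t => u x t i)) {a b : ℕ}
    (hab : a + 2 * b ≤ 6) (i : Fin M) {t : ℝ} (ht : t ∈ Icc 0 T) :
    ContDiffOn ℝ a (fun y => compDeriv T u 0 b i y t) 𝕀 :=
  (hu i).contDiffOn hab ht

/-- For `j = 0` both sides are continuous on the closed rectangle and agree on a dense subset. Each
further `j` differentiates the identity in time, `A` being independent of `t`. -/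
theorem IsParabolicSolution.eqn_closed (hT : 0 < T) (hA : IsCouplingMatrix A βs)
    (hf : IsCompatibleSource T f) (hu : IsParabolicSolution ε T A f u) {j : ℕ} (hj : j ≤ 2) {x t : ℝ}
    (hx : x ∈ 𝕀) (ht : t ∈ Icc 0 T) (i : Fin M) :
    compDeriv T u 0 (j + 1) i x t + (-ε * compDeriv T u 2 j i x t
      + ∑ k, A x i k * compDeriv T u 0 j k x t) = compDeriv T f 0 j i x t := by
  induction j generalizing x t with
  | zero =>
    have heq : EqOn (fun z : ℝ × ℝ => compDeriv T u 0 1 i z.1 z.2 + (-ε * compDeriv T u 2 0 i z.1 z.2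
      + ∑ k, A z.1 i k * compDeriv T u 0 0 k z.1 z.2)) (fun z => compDeriv T f 0 0 i z.1 z.2)
        (Ioo (0 : ℝ) 1 ×ˢ Ioc 0 T) := by
      rintro ⟨y, s⟩ ⟨hy, hs⟩
      have := hu.eqn y hy s hs i
      simp only [spatialOp, compDeriv, mixedDeriv, iteratedDerivWithin_zero,
        iteratedDerivWithin_one] at this ⊢
      exact this
    have hcl : 𝕀 ×ˢ Icc 0 T ⊆ closure (Ioo (0 : ℝ) 1 ×ˢ Ioc 0 T) := by
      rw [closure_prod_eq, closure_Ioo zero_ne_one, closure_Ioc hT.ne]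
    have hAc : ∀ k, ContinuousOn (fun z : ℝ × ℝ => A z.1 i k) (𝕀 ×ˢ Icc 0 T) := fun k =>
      (hA.smooth i k).continuousOn.comp continuousOn_fst fun z hz => hz.1
    have hLc : ContinuousOn (fun z : ℝ × ℝ => compDeriv T u 0 1 i z.1 z.2
        + (-ε * compDeriv T u 2 0 i z.1 z.2 + ∑ k, A z.1 i k * compDeriv T u 0 0 k z.1 z.2))
        (𝕀 ×ˢ Icc 0 T) := (continuousOn_compDeriv hu.smooth (a := 0) (b := 1) (by norm_num) i).add
      ((continuousOn_const.mul (continuousOn_compDeriv hu.smooth (a := 2) (b := 0) (by norm_num) i)).add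
      (continuousOn_finsetSum Finset.univ fun k _ =>
        (hAc k).mul (continuousOn_compDeriv hu.smooth (a := 0) (b := 0) (by norm_num) k)))
    have hxt : (x, t) ∈ 𝕀 ×ˢ Icc 0 T := ⟨hx, ht⟩
    have hRc := continuousOn_compDeriv hf.smooth (a := 0) (b := 0) (by norm_num) i
    have hfin := heq.of_subset_closure hLc hRc
      (prod_mono Ioo_subset_Icc_self Ioc_subset_Icc_self) hcl hxt
    exact hfin
  | succ j ih =>
    have hL := (hasDerivWithinAt_compDeriv_right hT hu.smooth (a := 0) (b := j + 1) (by omega) i hx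
      ht).add (((hasDerivWithinAt_compDeriv_right hT hu.smooth (a := 2) (b := j) (by omega) i hx
      ht).const_mul (-ε)).add (HasDerivWithinAt.fun_sum (u := Finset.univ) fun k _ =>
        (hasDerivWithinAt_compDeriv_right hT hu.smooth (a := 0) (b := j) (by omega) k hx
          ht).const_mul (A x i k)))
    have hR := hasDerivWithinAt_compDeriv_right hT hf.smooth (a := 0) (b := j) (by omega) i hx ht
    have hR' := hR.congr (fun s hs => ih (by omega) hx hs) (ih (by omega) hx ht)
    exact (uniqueDiffOn_Icc hT t ht).eq_deriv _ hL hR'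

theorem IsParabolicSolution.boundary_eq_zero (hu : IsParabolicSolution ε T A f u)
    {x₀ σ : ℝ} (hend : IsEndpoint x₀ σ) (j : ℕ) (i : Fin M) {t : ℝ} (ht : t ∈ Icc 0 T) :
    compDeriv T u 0 j i x₀ t = 0 := by
  have h0 : EqOn (fun s => u x₀ s i) (fun _ => 0) (Icc 0 T) := by
    intro s hs
    rcases hend with ⟨rfl, -⟩ | ⟨rfl, -⟩
    · simp [(hu.boundary s hs).1]
    · simp [(hu.boundary s hs).2]
  rw [compDeriv, mixedDeriv_zero, iteratedDerivWithin_congr h0 ht]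
  simp

theorem IsParabolicSolution.initial_eq_zero (hu : IsParabolicSolution ε T A f u)
    (a : ℕ) (i : Fin M) {x : ℝ} (hx : x ∈ 𝕀) : compDeriv T u a 0 i x 0 = 0 := by
  have h0 : EqOn (fun y => u y 0 i) (fun _ => 0) 𝕀 := by
    intro y hy
    simp [hu.initial y hy]
  have := iteratedDerivWithin_congr (n := a) h0 hx
  simpa [compDeriv, mixedDeriv] using this

theorem IsParabolicSolution.initial_deriv (hT : 0 < T) (hA : IsCouplingMatrix A βs)
    (hf : IsCompatibleSource T f) (hu : IsParabolicSolution ε T A f u) (a : ℕ) (i : Fin M) {x : ℝ}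
    (hx : x ∈ 𝕀) : compDeriv T u a 1 i x 0 = compDeriv T f a 0 i x 0 := by
  have h0 : (0 : ℝ) ∈ Icc 0 T := ⟨le_rfl, hT.le⟩
  rw [← iteratedDerivWithin_compDeriv_zero u a, ← iteratedDerivWithin_compDeriv_zero f a]
  refine iteratedDerivWithin_congr (fun y hy => ?_) hx
  have := hu.eqn_closed hT hA hf (j := 0) (by norm_num) hy h0 i
  simpa [hu.initial_eq_zero _ _ hy] using this

/-- The derivative `∂ₜ^j u` solves the same system with source `∂ₜ^j f` and zero lateral values, so
comparison with the end barrier applies once the initial values are `O(|x - x₀|)`. The bound is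
linear near `x₀` and gives the normal derivative there. -/
theorem exists_abs_le_endBarrier {β : ℝ} (hT : 0 < T) (hβ : 0 < β) (hββs : β < βs)
    (hA : IsCouplingMatrix A βs) (hf : IsCompatibleSource T f) :
    ∃ K : ℝ, 0 ≤ K ∧ ∀ (ε : ℝ), 0 < ε → ε ≤ 1 → ∀ u, IsParabolicSolution ε T A f u →
      ∀ j ≤ 2, ∀ x₀ σ, IsEndpoint x₀ σ → ∀ i, ∀ x ∈ 𝕀, ∀ t ∈ Icc 0 T,
        |compDeriv T u 0 j i x t| ≤ K * endBarrier β ε x₀ σ x := by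
  obtain ⟨C, hC⟩ := exists_isDataBound hA hf
  have hC0 := hC.nonneg
  set κ := Real.sqrt β * Real.exp (-Real.sqrt β) with hκ
  have hκ0 : 0 < κ := mul_pos (Real.sqrt_pos.2 hβ) (Real.exp_pos _)
  -- The first summand absorbs the source, via `C ≤ K β`; the second absorbs the initial data, via
  -- `(2 + M C) C ≤ K κ`, where `κ |x - x₀|` is a lower bound for the barrier.
  refine ⟨C / β + (2 + M * C) * C / κ, by positivity, ?_⟩
  intro ε hε hε1 u hu j hj x₀ σ hend i x hx t ht
  set K := C / β + (2 + M * C) * C / κ with hK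
  have hK0 : 0 ≤ K := by positivity
  have hKβ : C ≤ K * β := by
    have : K * β = C + (2 + M * C) * C / κ * β := by rw [hK]; field_simp
    rw [this]; exact le_add_of_nonneg_right (by positivity)
  have hKκ : (2 + M * C) * C ≤ K * κ := by
    have : K * κ = C / β * κ + (2 + M * C) * C := by rw [hK]; field_simp
    rw [this]; exact le_add_of_nonneg_left (by positivity)
  have h0 : (0 : ℝ) ∈ Icc 0 T := ⟨le_rfl, hT.le⟩
  have hE0 : ∀ y ∈ 𝕀, 0 ≤ K * endBarrier β ε x₀ σ y := fun y hy =>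
    mul_nonneg hK0 (endBarrier_nonneg hend hy)
  have hinit : ∀ k, ∀ y ∈ 𝕀, |compDeriv T u 0 j k y 0| ≤ K * endBarrier β ε x₀ σ y := by
    intro k y hy
    have hb := mul_le_mul_of_nonneg_left (le_endBarrier hend hβ hε hε1 hy) hK0
    have hlin : (2 + M * C) * C * |y - x₀| ≤ K * endBarrier β ε x₀ σ y := by
      refine le_trans ?_ hb
      rw [← mul_assoc]
      exact mul_le_mul_of_nonneg_right hKκ (abs_nonneg _)
    have hr := abs_nonneg (y - x₀)
    interval_cases j
    · simpa [hu.initial_eq_zero _ _ hy] using hE0 y hy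
    · rw [hu.initial_deriv hT hA hf 0 k hy]
      refine (source_initial_le hf hT hC hend (by norm_num) k hy).trans (le_trans ?_ hlin)
      have : 0 ≤ (1 + M * C) * C * |y - x₀| := by positivity
      nlinarith
    · have heq := hu.eqn_closed hT hA hf (j := 1) (by norm_num) hy h0 k
      simp only [hu.initial_deriv hT hA hf _ _ hy] at heq
      have h1 := source_initial_le hf hT hC hend (a := 0) (b := 1) (by norm_num) k hy
      have h2 := source_initial_le hf hT hC hend (a := 2) (b := 0) (by norm_num) k hy
      have h3 : |∑ l, A y k l * compDeriv T f 0 0 l y 0| ≤ M * C * (C * |y - x₀|) :=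
        abs_matVec_le (fun l => hC.coeff_zero k l hy)
          (fun l => source_initial_le hf hT hC hend (by norm_num) l hy)
      have h4 : |ε * compDeriv T f 2 0 k y 0| ≤ C * |y - x₀| := by
        rw [abs_mul, abs_of_pos hε]
        exact (mul_le_of_le_one_left (abs_nonneg _) hε1).trans h2
      -- At `t = 0` the once differentiated equation, with `∂ₜu = f`, gives `∂ₜ²u = ∂ₜf + ε f'' - A
      -- f`; the three terms account for the factor `2 + M C`.
      have h5 : compDeriv T u 0 2 k y 0 = compDeriv T f 0 1 k y 0
          + ε * compDeriv T f 2 0 k y 0 - ∑ l, A y k l * compDeriv T f 0 0 l y 0 := by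
        linarith
      rw [h5]
      refine (abs_sub _ _).trans (le_trans (add_le_add_left (abs_add_le _ _) _) (le_trans ?_ hlin))
      linarith
  obtain ⟨E1, hE1, hE2⟩ := exists_hasDerivAt_endBarrier hend hβ hε K
  refine parabolic_abs_le hA (hβ.trans hββs) hε (w := fun k => compDeriv T u 0 j k)
    (wt := fun k => compDeriv T u 0 (j + 1) k) (w1 := fun k => compDeriv T u 1 j k)
    (w2 := fun k => compDeriv T u 2 j k) (fun k => continuousOn_compDeriv hu.smooth (by omega) k)
    (fun k y hy s hs => hasDerivWithinAt_compDeriv_right hT hu.smooth (by omega) k hy hs)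
    (fun k y hy s hs => hasDerivWithinAt_compDeriv_left hu.smooth (by omega) k hy hs)
    (fun k y hy s hs => hasDerivWithinAt_compDeriv_left hu.smooth (by omega) k hy hs)
    hE1 hE2 hE0 (fun k s hs => ?_) hinit (fun y hy s hs k => ?_) i hx ht
  · rw [hu.boundary_eq_zero (Or.inl ⟨rfl, rfl⟩) j k hs,
      hu.boundary_eq_zero (Or.inr ⟨rfl, rfl⟩) j k hs, abs_zero]
    exact ⟨hE0 0 (by simp), hE0 1 (by simp)⟩
  · have hyI := Ioo_subset_Icc_self hy
    have hsI := Ioc_subset_Icc_self hs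
    rw [hu.eqn_closed hT hA hf hj hyI hsI k]
    exact ((hC.source 0 j (by omega) k y hyI s hsI).trans hKβ).trans
      (endBarrier_operator_ge hend hK0 hε hββs.le hyI)

end Parabolic

/-! ### Derivatives of the parabolic solution at the endpoints -/

section Endpoint

variable {M : ℕ} {A : ℝ → Matrix (Fin M) (Fin M) ℝ} {βs T : ℝ} {f : ℝ → ℝ → Fin M → ℝ}

/-- Bounds on a solution of `-ε z'' + A z = g` and its first derivative at a point, together with
bounds on the derivatives of `g`, yield bounds on the higher derivatives of `z` at this point. -/
theorem abs_iteratedDerivWithin_le_of_eqn (hA : IsCouplingMatrix A βs) {C : ℝ}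
    (hC : IsDataBound T A f C) {ε K : ℝ} (hε : 0 < ε) (hε1 : ε ≤ 1) (hK : 0 ≤ K) {z g : Fin M → ℝ → ℝ} {m : ℕ}
    (hm : m ≤ 4) (hz : ∀ j, ContDiffOn ℝ (m + 2 : ℕ) (z j) 𝕀)
    (hg : ∀ x ∈ 𝕀, ∀ i, -ε * iteratedDerivWithin 2 (z i) 𝕀 x + ∑ j, A x i j * z j x = g i x)
    {x : ℝ} (hx : x ∈ 𝕀) (h0 : ∀ i, |z i x| ≤ K)
    (h1 : ∀ i, |iteratedDerivWithin 1 (z i) 𝕀 x| ≤ K / Real.sqrt ε)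
    (hgk : ∀ k ≤ m, ∀ i, |iteratedDerivWithin k (g i) 𝕀 x| ≤ K / Real.sqrt ε ^ k)
    {k : ℕ} (hk : k ≤ m + 2) (i : Fin M) :
    |iteratedDerivWithin k (z i) 𝕀 x| ≤ K * (1 + 65 * (M * C)) ^ (6 : ℕ) / Real.sqrt ε ^ k := by
  have hC0 := hC.nonneg
  set e := Real.sqrt ε with he
  have he0 : 0 < e := Real.sqrt_pos.2 hε
  have he1 : e ≤ 1 := Real.sqrt_le_one.2 hε1
  have hee : e ^ 2 = ε := Real.sq_sqrt hε.le
  -- One gain in order costs a factor `Q`: `1` for `g`, `M C` for the product with `A`, and `64 M C`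
  -- for the commutator.
  set Q := 1 + 65 * (M * C) with hQ
  have hMC : 0 ≤ M * C := by positivity
  have hQ1 : 1 ≤ Q := by linarith
  have key : ∀ n, n + 1 ≤ m + 2 → ∀ k ≤ n + 1, ∀ i,
      |iteratedDerivWithin k (z i) 𝕀 x| ≤ K * Q ^ n / e ^ k := by
    intro n
    induction n with
    | zero =>
      intro _ k hk i
      interval_cases k
      · simpa using h0 i
      · simpa using h1 i
    | succ n ih =>
      intro hn k hk i
      rcases hk.lt_or_eq with hlt | rfl
      · refine (ih (by omega) k (by omega) i).trans ?_
        gcongr ?_ / _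
        exact mul_le_mul_of_nonneg_left (pow_le_pow_right₀ hQ1 n.le_succ) hK
      · have heq := iteratedDerivWithin_of_eqn (k := n) (ε := ε) (g := g)
          (fun a b => (hA.smooth a b).of_le (by exact_mod_cast (by omega : n ≤ 6)))
          (fun j => (hz j).of_le (by exact_mod_cast (by omega : n + 2 ≤ m + 2))) hg i hx
        have hR : ∀ l ≤ n, ∀ j, |iteratedDerivWithin l (z j) 𝕀 x| ≤ K * Q ^ n / e ^ n := by
          intro l hl j
          refine (ih (by omega) l (by omega) j).trans ?_
          exact div_le_div_of_nonneg_left (by positivity) (by positivity)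
            (pow_le_pow_of_le_one he0.le he1 hl)
        have b1 := abs_matVec_le (fun j => hC.coeff_zero i j hx) (hR n le_rfl)
        have b2 := abs_leibnizRemainder_le (k := n) (i := i) (by omega)
          (fun l hl j => hC.coeff l hl i j x hx) (fun l hl j => hR l hl.le j) (by positivity)
        have b3 := hgk n (by omega) i
        have hS : K / e ^ n ≤ K * Q ^ n / e ^ n := by
          gcongr
          exact le_mul_of_one_le_right hK (one_le_pow₀ hQ1)
        set S := K * Q ^ n / e ^ n with hSdef
        have htot : ε * |iteratedDerivWithin (n + 2) (z i) 𝕀 x| ≤ Q * S := by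
          have : ε * iteratedDerivWithin (n + 2) (z i) 𝕀 x
              = ∑ j, A x i j * iteratedDerivWithin n (z j) 𝕀 x + leibnizRemainder A z n i x
                - iteratedDerivWithin n (g i) 𝕀 x := by linarith
          have habs : ε * |iteratedDerivWithin (n + 2) (z i) 𝕀 x|
              = |ε * iteratedDerivWithin (n + 2) (z i) 𝕀 x| := by rw [abs_mul, abs_of_pos hε]
          rw [habs, this]
          refine (abs_sub _ _).trans ((add_le_add_left (abs_add_le _ _) _).trans ?_)
          rw [hQ]
          nlinarith
        rw [← hee] at htot
        rw [le_div_iff₀ (by positivity)]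
        calc |iteratedDerivWithin (n + 2) (z i) 𝕀 x| * e ^ (n + 2)
            = (e ^ 2 * |iteratedDerivWithin (n + 2) (z i) 𝕀 x|) * e ^ n := by ring
          _ ≤ Q * S * e ^ n := by gcongr
          _ = K * Q ^ (n + 1) := by rw [hSdef]; field_simp; ring
  refine (key (m + 1) (by omega) k hk i).trans ?_
  gcongr ?_ / _
  exact mul_le_mul_of_nonneg_left (pow_le_pow_right₀ hQ1 (by omega)) hK

/-- Descending induction on the number `j` of time derivatives, `d` counting down from `j = 3`,
where only the zero boundary value remains. At level `j` the equation `L ∂ₜ^j u = ∂ₜ^j f - ∂ₜ^(j+1)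
u` has a right-hand side bounded by the previous level, and the end barrier supplies the first
derivative. -/
theorem exists_endpoint_bound {β : ℝ} (hT : 0 < T) (hβ : 0 < β) (hββs : β < βs)
    (hA : IsCouplingMatrix A βs) (hf : IsCompatibleSource T f) :
    ∃ K : ℝ, 0 ≤ K ∧ ∀ (ε : ℝ), 0 < ε → ε ≤ 1 → ∀ u, IsParabolicSolution ε T A f u →
      ∀ j ≤ 3, ∀ k, k + 2 * j ≤ 6 → ∀ x₀ σ, IsEndpoint x₀ σ → ∀ i, ∀ t ∈ Icc 0 T,
        |compDeriv T u k j i x₀ t| ≤ K / Real.sqrt ε ^ k := by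
  obtain ⟨C, hC⟩ := exists_isDataBound hA hf
  obtain ⟨B, hB0, hB⟩ := exists_abs_le_endBarrier hT hβ hββs hA hf
  have hC0 := hC.nonneg
  have key : ∀ d ≤ 3, ∃ K : ℝ, 0 ≤ K ∧ ∀ (ε : ℝ), 0 < ε → ε ≤ 1 → ∀ u,
      IsParabolicSolution ε T A f u →
      ∀ j ≤ 3, 3 ≤ j + d → ∀ k, k + 2 * j ≤ 6 → ∀ x₀ σ, IsEndpoint x₀ σ → ∀ i, ∀ t ∈ Icc 0 T,
        |compDeriv T u k j i x₀ t| ≤ K / Real.sqrt ε ^ k := by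
    intro d
    induction d with
    | zero =>
      intro _
      refine ⟨0, le_rfl, fun ε _ _ u hu j hj hj3 k hk x₀ σ hend i t ht => ?_⟩
      obtain rfl : j = 3 := by omega
      obtain rfl : k = 0 := by omega
      simp [hu.boundary_eq_zero hend 3 i ht]
    | succ d ih =>
      intro hd
      obtain ⟨K, hK0, hK⟩ := ih (by omega)
      refine ⟨K + (B * Real.sqrt β + C + K) * (1 + 65 * (M * C)) ^ 6, by positivity, ?_⟩
      intro ε hε hε1 u hu j hj hjd k hk x₀ σ hend i t ht
      have he0 : 0 < Real.sqrt ε := Real.sqrt_pos.2 hε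
      by_cases hjd' : 3 ≤ j + d
      · refine (hK ε hε hε1 u hu j hj hjd' k hk x₀ σ hend i t ht).trans ?_
        gcongr
        exact le_add_of_nonneg_right (by positivity)
      have hj2 : j ≤ 2 := by omega
      set L := B * Real.sqrt β + C + K with hL
      have hL0 : 0 ≤ L := by positivity
      have hzc : ∀ l, ContDiffOn ℝ (4 - 2 * j + 2 : ℕ) (fun y => compDeriv T u 0 j l y t) 𝕀 :=
        fun l => contDiffOn_compDeriv hu.smooth (by omega) l ht
      have hone : ∀ n : ℕ, 1 ≤ 1 / Real.sqrt ε ^ n := fun n => by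
        rw [one_le_div (by positivity)]
        exact pow_le_one₀ he0.le (Real.sqrt_le_one.2 hε1)
      have := abs_iteratedDerivWithin_le_of_eqn hA hC hε hε1 hL0 (m := 4 - 2 * j) (by omega)
        (z := fun l y => compDeriv T u 0 j l y t)
        (g := fun l y => compDeriv T f 0 j l y t - compDeriv T u 0 (j + 1) l y t) hzc
        (fun y hy l => by
          rw [iteratedDerivWithin_compDeriv_zero, ← hu.eqn_closed hT hA hf hj2 hy ht l]; ring)
        hend.mem
        (fun l => by simpa [hu.boundary_eq_zero hend j l ht] using hL0)
        (fun l => by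
          rw [iteratedDerivWithin_compDeriv_zero]
          refine (abs_deriv_le_of_endBarrier hend hβ hB0
            (hasDerivWithinAt_compDeriv_left hu.smooth (by omega) l hend.mem ht)
            (fun y hy => hB ε hε hε1 u hu j hj2 x₀ σ hend l y hy t ht)).trans ?_
          gcongr
          rw [hL]; linarith)
        (fun n hn l => by
          rw [iteratedDerivWithin_sub_apply uniqueDiffOn_unitInterval hend.mem
            (contDiffOn_compDeriv hf.smooth (by omega) l ht)
            (contDiffOn_compDeriv hu.smooth (by omega) l ht),
            iteratedDerivWithin_compDeriv_zero, iteratedDerivWithin_compDeriv_zero]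
          have b1 := hC.source n j (by omega) l x₀ hend.mem t ht
          have b2 := hK ε hε hε1 u hu (j + 1) (by omega) (by omega) n (by omega) x₀ σ hend l t ht
          refine (abs_sub _ _).trans ((add_le_add b1 b2).trans ?_)
          have b3 : C ≤ C / Real.sqrt ε ^ n := by
            rw [div_eq_mul_one_div]; exact le_mul_of_one_le_right hC0 (hone n)
          have b4 : 0 ≤ B * Real.sqrt β / Real.sqrt ε ^ n := by positivity
          rw [hL, add_div, add_div]
          linarith)
        (k := k) (by omega) i
      rw [iteratedDerivWithin_compDeriv_zero] at this
      refine this.trans ?_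
      gcongr
      exact le_add_of_nonneg_left hK0
  obtain ⟨K, hK0, hK⟩ := key 3 le_rfl
  exact ⟨K, hK0, fun ε hε hε1 u hu j hj k hk => hK ε hε hε1 u hu j hj (by omega) k hk⟩

end Endpoint

/-! ### Integrals over short time intervals and the gain of two space derivatives -/

section Steklov

variable {M : ℕ} {A : ℝ → Matrix (Fin M) (Fin M) ℝ} {βs β T ε : ℝ} {f u : ℝ → ℝ → Fin M → ℝ}

/-- The integral of `∂_x^k u` over the time interval `[t, t + h]`. -/
noncomputable def timeIntegral (T h : ℝ) (u : ℝ → ℝ → Fin M → ℝ) (k : ℕ) (i : Fin M) (x t : ℝ) : ℝ :=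
  ∫ s in t..t + h, extendRect T (compDeriv T u k 0 i) x s

theorem continuous_extendRect_compDeriv (hT : 0 < T) (hu : ∀ i, ParabolicC 3 T (fun x t => u x t i))
    {a b : ℕ} (hab : a + 2 * b ≤ 6) (i : Fin M) :
    Continuous (Function.uncurry (extendRect T (compDeriv T u a b i))) :=
  continuous_extendRect hT.le (continuousOn_compDeriv hu hab i)

theorem uIcc_subset_of_mem {h t : ℝ} (hh : 0 ≤ h) (ht : t ∈ Icc 0 (T - h)) :
    uIcc t (t + h) ⊆ Icc 0 T := by
  rw [uIcc_of_le (by linarith)]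
  exact Icc_subset_Icc ht.1 (by linarith [ht.2])

theorem continuous_timeIntegral (hT : 0 < T) (hu : ∀ i, ParabolicC 3 T (fun x t => u x t i)) {k : ℕ}
    (hk : k ≤ 6) (h : ℝ) (i : Fin M) :
    Continuous (fun z : ℝ × ℝ => timeIntegral T h u k i z.1 z.2) := by
  have hc := continuous_extendRect_compDeriv hT hu (a := k) (b := 0) (by omega) i
  have hprim : Continuous (fun q : ℝ × ℝ =>
      ∫ s in (0 : ℝ)..q.2, extendRect T (compDeriv T u k 0 i) q.1 s) :=
    intervalIntegral.continuous_parametric_primitive_of_continuous hc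
  have heq : (fun z : ℝ × ℝ => timeIntegral T h u k i z.1 z.2) = fun z =>
      (∫ s in (0 : ℝ)..z.2 + h, extendRect T (compDeriv T u k 0 i) z.1 s)
        - ∫ s in (0 : ℝ)..z.2, extendRect T (compDeriv T u k 0 i) z.1 s := by
    funext z
    have hcz : Continuous fun s => extendRect T (compDeriv T u k 0 i) z.1 s := by fun_prop
    rw [timeIntegral, intervalIntegral.integral_interval_sub_left (hcz.intervalIntegrable _ _)
      (hcz.intervalIntegrable _ _)]
  rw [heq]
  exact (hprim.comp (by fun_prop : Continuous fun z : ℝ × ℝ => (z.1, z.2 + h))).sub hprim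

theorem hasDerivAt_timeIntegral_right (hT : 0 < T) (hu : ∀ i, ParabolicC 3 T (fun x t => u x t i))
    {k : ℕ} (hk : k ≤ 6) {h : ℝ} (hh : 0 ≤ h) (i : Fin M) {x t : ℝ} (hx : x ∈ 𝕀)
    (ht : t ∈ Icc 0 (T - h)) :
    HasDerivAt (timeIntegral T h u k i x)
      (compDeriv T u k 0 i x (t + h) - compDeriv T u k 0 i x t) t := by
  have hc := continuous_extendRect_compDeriv hT hu (a := k) (b := 0) (by omega) i
  have hcz : Continuous fun s => extendRect T (compDeriv T u k 0 i) x s := by fun_prop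
  have heq : timeIntegral T h u k i x = fun t =>
      (∫ s in (0 : ℝ)..t + h, extendRect T (compDeriv T u k 0 i) x s)
        - ∫ s in (0 : ℝ)..t, extendRect T (compDeriv T u k 0 i) x s := by
    funext t
    rw [timeIntegral, intervalIntegral.integral_interval_sub_left (hcz.intervalIntegrable _ _)
      (hcz.intervalIntegrable _ _)]
  have h1 : HasDerivAt (fun t => ∫ s in (0 : ℝ)..t + h, extendRect T (compDeriv T u k 0 i) x s)
      (extendRect T (compDeriv T u k 0 i) x (t + h)) t := by
    have := (hcz.integral_hasStrictDerivAt 0 (t + h)).hasDerivAt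
    exact this.comp_add_const t h
  have h2 := (hcz.integral_hasStrictDerivAt 0 t).hasDerivAt
  rw [heq, ← extendRect_eq (F := compDeriv T u k 0 i) hx (uIcc_subset_of_mem hh ht left_mem_uIcc),
    ← extendRect_eq (F := compDeriv T u k 0 i) hx (uIcc_subset_of_mem hh ht right_mem_uIcc)]
  exact h1.sub h2

theorem hasDerivWithinAt_timeIntegral_left (hT : 0 < T)
    (hu : ∀ i, ParabolicC 3 T (fun x t => u x t i)) {k : ℕ} (hk : k + 1 ≤ 6) {h : ℝ} (hh : 0 ≤ h)
    (i : Fin M) {x t : ℝ} (hx : x ∈ 𝕀) (ht : t ∈ Icc 0 (T - h)) :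
    HasDerivWithinAt (fun y => timeIntegral T h u k i y t) (timeIntegral T h u (k + 1) i x t) 𝕀 x := by
  refine hasDerivWithinAt_integral_param
    (continuous_extendRect_compDeriv hT hu (a := k) (b := 0) (by omega) i)
    (continuous_extendRect_compDeriv hT hu (a := k + 1) (b := 0) (by omega) i)
    (fun r hr y hy => ?_) hx
  have hr' := uIcc_subset_of_mem hh ht hr
  rw [extendRect_eq hy hr']
  exact (hasDerivWithinAt_compDeriv_left hu (a := k) (b := 0) (by omega) i hy hr').congr
    (fun z hz => extendRect_eq hz hr') (extendRect_eq hy hr')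

theorem abs_timeIntegral_le {h : ℝ} (hh : 0 ≤ h) {k : ℕ} {i : Fin M} {x t R : ℝ} (hx : x ∈ 𝕀)
    (ht : t ∈ Icc 0 (T - h)) (hR : ∀ s ∈ Icc t (t + h), |compDeriv T u k 0 i x s| ≤ R) :
    |timeIntegral T h u k i x t| ≤ h * R := by
  have := intervalIntegral.norm_integral_le_of_norm_le_const (a := t) (b := t + h) (C := R)
    (f := fun s => extendRect T (compDeriv T u k 0 i) x s) (fun s hs => by
      have hs' : s ∈ uIcc t (t + h) := uIoc_subset_uIcc hs
      rw [extendRect_eq hx (uIcc_subset_of_mem hh ht hs'), Real.norm_eq_abs]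
      rw [uIcc_of_le (by linarith)] at hs'
      exact hR s hs')
  rw [timeIntegral, ← Real.norm_eq_abs]
  refine this.trans_eq ?_
  rw [add_sub_cancel_left, abs_of_nonneg hh, mul_comm]

theorem IsParabolicSolution.timeIntegral_eqn (hT : 0 < T) (hA : IsCouplingMatrix A βs)
    (hf : IsCompatibleSource T f) (hu : IsParabolicSolution ε T A f u) {h : ℝ} (hh : 0 ≤ h) {x t : ℝ}
    (hx : x ∈ 𝕀) (ht : t ∈ Icc 0 (T - h)) (i : Fin M) :
    -ε * timeIntegral T h u 2 i x t + ∑ k, A x i k * timeIntegral T h u 0 k x t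
      = timeIntegral T h f 0 i x t
        - (compDeriv T u 0 0 i x (t + h) - compDeriv T u 0 0 i x t) := by
  have hsub := uIcc_subset_of_mem hh ht
  have hc : ∀ {w : ℝ → ℝ → Fin M → ℝ}, (∀ i, ParabolicC 3 T (fun x t => w x t i)) → ∀ {a b : ℕ},
      a + 2 * b ≤ 6 → ∀ i,
      Continuous fun s => extendRect T (compDeriv T w a b i) x s := fun hw a b hab i => by
    have := continuous_extendRect_compDeriv hT hw hab i
    fun_prop
  have h1 : compDeriv T u 0 0 i x (t + h) - compDeriv T u 0 0 i x t
      = ∫ s in t..t + h, extendRect T (compDeriv T u 0 1 i) x s :=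
    (hu.smooth i).sub_eq_integral hT (i := 0) (j := 0) (by norm_num) hx (hsub left_mem_uIcc)
      (hsub right_mem_uIcc)
  rw [h1]
  simp only [timeIntegral]
  rw [← intervalIntegral.integral_sub
      ((hc hf.smooth (by norm_num) i).intervalIntegrable _ _)
      ((hc hu.smooth (by norm_num) i).intervalIntegrable _ _),
    ← intervalIntegral.integral_const_mul]
  simp only [← intervalIntegral.integral_const_mul]
  rw [← intervalIntegral.integral_finsetSum fun k _ =>
      ((hc hu.smooth (by norm_num) k).const_mul (A x i k)).intervalIntegrable _ _,
    ← intervalIntegral.integral_add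
      (((hc hu.smooth (by norm_num) i).const_mul (-ε)).intervalIntegrable _ _)
      ((continuous_finsetSum _ fun k _ =>
        (hc hu.smooth (by norm_num) k).const_mul (A x i k)).intervalIntegrable _ _)]
  refine intervalIntegral.integral_congr fun s hs => ?_
  have hs' := hsub hs
  have := hu.eqn_closed hT hA hf (j := 0) (by norm_num) hx hs' i
  simp only [extendRect_eq hx hs']
  rw [← this]
  ring

/-- Integrating the equation over `[t, t + h]` turns `∂ₜu` into a difference of values of `u`, which
has six space derivatives, whereas `∂ₜu` is only known to have four. So `ε` times the second
derivative of the integral is of class `C^6`. -/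
theorem IsParabolicSolution.contDiffOn_timeIntegral (hT : 0 < T) (hA : IsCouplingMatrix A βs)
    (hf : IsCompatibleSource T f) (hε : 0 < ε) (hu : IsParabolicSolution ε T A f u) {h : ℝ}
    (hh : 0 ≤ h) {t : ℝ} (ht : t ∈ Icc 0 (T - h)) (i : Fin M) :
    ContDiffOn ℝ (8 : ℕ) (fun y => timeIntegral T h u 0 i y t) 𝕀 := by
  have hsub := uIcc_subset_of_mem hh ht
  have hP : ∀ {w : ℝ → ℝ → Fin M → ℝ}, (∀ i, ParabolicC 3 T (fun x t => w x t i)) → ∀ i,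
      ContDiffOn ℝ (6 : ℕ) (fun y => timeIntegral T h w 0 i y t) 𝕀 := fun hw i =>
    contDiffOn_of_chain (G := fun k y => timeIntegral T h _ k i y t) uniqueDiffOn_unitInterval
      (fun k hk y hy => hasDerivWithinAt_timeIntegral_left hT hw hk hh i hy ht)
      ((continuous_timeIntegral hT hw le_rfl h i).comp
        (by fun_prop : Continuous fun y : ℝ => (y, t))).continuousOn
  refine contDiffOn_add_two (n := 6) (y1 := fun y => timeIntegral T h u 1 i y t)
    (y2 := fun y => timeIntegral T h u 2 i y t) uniqueDiffOn_unitInterval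
    (fun y hy => hasDerivWithinAt_timeIntegral_left hT hu.smooth (by norm_num) hh i hy ht)
    (fun y hy => hasDerivWithinAt_timeIntegral_left hT hu.smooth (by norm_num) hh i hy ht) ?_
  have hR : ContDiffOn ℝ (6 : ℕ) (fun y => ε⁻¹ * (∑ k, A y i k * timeIntegral T h u 0 k y t
      - (timeIntegral T h f 0 i y t
        - (compDeriv T u 0 0 i y (t + h) - compDeriv T u 0 0 i y t)))) 𝕀 := by
    refine contDiffOn_const.mul ((contDiffOn_matVec (fun a b => by exact_mod_cast hA.smooth a b)
      (fun k => hP hu.smooth k) i).sub ((hP hf.smooth i).sub (ContDiffOn.sub ?_ ?_)))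
    · exact contDiffOn_compDeriv hu.smooth (by norm_num) i (hsub right_mem_uIcc)
    · exact contDiffOn_compDeriv hu.smooth (by norm_num) i (hsub left_mem_uIcc)
  refine hR.congr fun y hy => ?_
  have := hu.timeIntegral_eqn hT hA hf hh hy ht i
  rw [← this]
  field_simp
  ring

theorem iteratedDerivWithin_timeIntegral (hT : 0 < T)
    (hu : ∀ i, ParabolicC 3 T (fun x t => u x t i)) {k : ℕ} (hk : k ≤ 6) {h : ℝ} (hh : 0 ≤ h)
    (i : Fin M) {x t : ℝ} (hx : x ∈ 𝕀) (ht : t ∈ Icc 0 (T - h)) :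
    iteratedDerivWithin k (fun y => timeIntegral T h u 0 i y t) 𝕀 x = timeIntegral T h u k i x t :=
  iteratedDerivWithin_eq_of_chain (G := fun k y => timeIntegral T h u k i y t)
    uniqueDiffOn_unitInterval (m := 6)
    (fun _ hk _ hy => hasDerivWithinAt_timeIntegral_left hT hu hk hh i hy ht) k hk hx

/-- The difference on the left is the time derivative of the integral of `∂ₓ^k u`. This is therefore
the parabolic equation for that integral, valid up to `k = 6`. -/
theorem IsParabolicSolution.timeIntegral_deriv_eqn (hT : 0 < T) (hA : IsCouplingMatrix A βs)
    (hf : IsCompatibleSource T f) (hε : 0 < ε) (hu : IsParabolicSolution ε T A f u) {h : ℝ}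
    (hh : 0 ≤ h) {k : ℕ} (hk : k ≤ 6) {x t : ℝ} (hx : x ∈ 𝕀) (ht : t ∈ Icc 0 (T - h)) (i : Fin M) :
    compDeriv T u k 0 i x (t + h) - compDeriv T u k 0 i x t
      + (-ε * iteratedDerivWithin (k + 2) (fun y => timeIntegral T h u 0 i y t) 𝕀 x
      + ∑ j, A x i j * timeIntegral T h u k j x t)
      = timeIntegral T h f k i x t
        - leibnizRemainder A (fun j y => timeIntegral T h u 0 j y t) k i x := by
  have hsub := uIcc_subset_of_mem hh ht
  have h8 := fun j => hu.contDiffOn_timeIntegral hT hA hf hε hh ht j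
  have h6 : ContDiffOn ℝ k (fun y => timeIntegral T h f 0 i y t) 𝕀 := by
    have : ContDiffOn ℝ (6 : ℕ) (fun y => timeIntegral T h f 0 i y t) 𝕀 :=
      contDiffOn_of_chain (G := fun k y => timeIntegral T h f k i y t) uniqueDiffOn_unitInterval
        (fun k hk y hy => hasDerivWithinAt_timeIntegral_left hT hf.smooth hk hh i hy ht)
        ((continuous_timeIntegral hT hf.smooth le_rfl h i).comp
          (by fun_prop : Continuous fun y : ℝ => (y, t))).continuousOn
    exact this.of_le (by exact_mod_cast hk)
  have hc1 := contDiffOn_compDeriv hu.smooth (a := k) (b := 0) (by omega) i (hsub right_mem_uIcc)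
  have hc2 := contDiffOn_compDeriv hu.smooth (a := k) (b := 0) (by omega) i (hsub left_mem_uIcc)
  have heq := iteratedDerivWithin_of_eqn (k := k) (ε := ε)
    (z := fun j y => timeIntegral T h u 0 j y t)
    (g := fun i x => timeIntegral T h f 0 i x t
        - (compDeriv T u 0 0 i x (t + h) - compDeriv T u 0 0 i x t))
    (fun a b => (hA.smooth a b).of_le (by exact_mod_cast hk))
    (fun j => (h8 j).of_le (by exact_mod_cast (by omega : k + 2 ≤ 8)))
    (fun y hy j => by
      rw [iteratedDerivWithin_timeIntegral hT hu.smooth (by norm_num) hh j hy ht]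
      exact hu.timeIntegral_eqn hT hA hf hh hy ht j) i hx
  rw [iteratedDerivWithin_sub_apply uniqueDiffOn_unitInterval hx h6 (hc1.sub hc2),
    iteratedDerivWithin_sub_apply uniqueDiffOn_unitInterval hx hc1 hc2,
    iteratedDerivWithin_timeIntegral hT hf.smooth hk hh i hx ht,
    iteratedDerivWithin_compDeriv_zero, iteratedDerivWithin_compDeriv_zero] at heq
  simp only [iteratedDerivWithin_timeIntegral hT hu.smooth hk hh _ hx ht] at heq
  linarith

end Steklov

/-! ### Layer bounds for the parabolic solution -/

section LayerBound

variable {M : ℕ} {A : ℝ → Matrix (Fin M) (Fin M) ℝ} {βs β T ε : ℝ} {f u : ℝ → ℝ → Fin M → ℝ}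

/-- Here `δ` may depend on `u` and `ε`: it only restricts the window length `h`, which tends to
zero, and does not enter the final constant. -/
theorem IsParabolicSolution.exists_small_near_initial (hT : 0 < T)
    (hu : IsParabolicSolution ε T A f u) {k : ℕ} (hk : k ≤ 6) :
    ∃ δ > 0, ∀ i, ∀ x ∈ 𝕀, ∀ s ∈ Icc 0 T, s < δ → |compDeriv T u k 0 i x s| ≤ 1 := by
  have hex : ∀ i, ∃ δ > 0, ∀ x ∈ 𝕀, ∀ s ∈ Icc 0 T, s < δ → |compDeriv T u k 0 i x s| ≤ 1 := by
    intro i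
    have huc := (isCompact_Icc.prod isCompact_Icc).uniformContinuousOn_of_continuous
      (continuousOn_compDeriv hu.smooth (a := k) (b := 0) (by omega) i)
    rw [Metric.uniformContinuousOn_iff] at huc
    obtain ⟨δ, hδ, h⟩ := huc 1 one_pos
    refine ⟨δ, hδ, fun x hx s hs hsδ => ?_⟩
    have h0 : (0 : ℝ) ∈ Icc 0 T := ⟨le_rfl, hT.le⟩
    have := h (x, s) ⟨hx, hs⟩ (x, 0) ⟨hx, h0⟩ (by
      simp [Prod.dist_eq, abs_of_nonneg hs.1, hsδ, hδ])
    rw [Real.dist_eq, hu.initial_eq_zero k i hx, sub_zero] at this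
    exact this.le
  choose δ hδ h using hex
  rcases isEmpty_or_nonempty (Fin M) with hM | hM
  · exact ⟨1, one_pos, fun i => isEmptyElim i⟩
  · refine ⟨Finset.univ.inf' Finset.univ_nonempty δ, ?_, fun i x hx s hs hlt => ?_⟩
    · exact (Finset.lt_inf'_iff _).2 fun i _ => hδ i
    · exact h i x hx s hs (hlt.trans_le (Finset.inf'_le _ (Finset.mem_univ i)))

/-- Bounds on the derivatives of order less than `k` and on the boundary values of the `k`-th
derivative yield a bound on the `k`-th derivative. -/
theorem IsParabolicSolution.abs_compDeriv_le (hT : 0 < T) (hβ : 0 < β) (hββs : β < βs)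
    (hA : IsCouplingMatrix A βs) (hf : IsCompatibleSource T f) {C : ℝ} (hC : IsDataBound T A f C)
    (hε : 0 < ε) (hu : IsParabolicSolution ε T A f u) {k : ℕ} (hk : k ≤ 6) {q K' Ke : ℝ}
    (hq : 0 ≤ q) (hK' : 0 ≤ K') (hKe : 0 ≤ Ke)
    (hlow : ∀ m < k, ∀ i, ∀ x ∈ 𝕀, ∀ t ∈ Icc 0 T,
      |compDeriv T u m 0 i x t| ≤ K' * (1 + q * layer β ε x))
    (hend : ∀ i, ∀ t ∈ Icc 0 T, |compDeriv T u k 0 i 0 t| ≤ Ke * (1 + q * layer β ε 0) ∧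
      |compDeriv T u k 0 i 1 t| ≤ Ke * (1 + q * layer β ε 1))
    (i : Fin M) {x t : ℝ} (hx : x ∈ 𝕀) (ht : t ∈ Icc 0 T) :
    |compDeriv T u k 0 i x t|
      ≤ (Ke + 1 + (C + M * (64 * C) * K') / (βs - β)) * (1 + q * layer β ε x) := by
  have hC0 := hC.nonneg
  have hσ : 0 < βs - β := sub_pos.2 hββs
  set K := Ke + 1 + (C + M * (64 * C) * K') / (βs - β) with hK
  have hfrac : 0 ≤ (C + M * (64 * C) * K') / (βs - β) := by positivity
  have hK0 : 0 ≤ K := by positivity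
  have hKσ : C + M * (64 * C) * K' ≤ (βs - β) * K := by
    have : (βs - β) * K = (βs - β) * (Ke + 1) + (C + M * (64 * C) * K') := by
      rw [hK]; field_simp
    rw [this]; exact le_add_of_nonneg_left (by positivity)
  have hE1 : ∀ y, 1 ≤ 1 + q * layer β ε y := fun y =>
    le_add_of_nonneg_right (mul_nonneg hq (layer_pos β ε y).le)
  have hE0 : ∀ y, 0 ≤ 1 + q * layer β ε y := fun y => zero_le_one.trans (hE1 y)
  obtain ⟨δ, hδ, hsmall⟩ := hu.exists_small_near_initial hT hk
  -- The comparison is made on `[0, T - h]` with a barrier scaled by `h`. In `K`, the summand `Ke`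
  -- covers the lateral values, `1` the integral starting at time zero, and the fraction the source
  -- and the commutator.
  have hint : ∀ h, 0 < h → h < δ → ∀ s ∈ Icc 0 (T - h), ∀ y ∈ 𝕀, ∀ j,
      |timeIntegral T h u k j y s| ≤ h * K * (1 + q * layer β ε y) := by
    intro h hh hhδ s hs y hy j
    have hwin : ∀ {r}, r ∈ Icc 0 (T - h) → Icc r (r + h) ⊆ Icc 0 T := fun {r} hr =>
      Icc_subset_Icc hr.1 (by linarith [hr.2])
    obtain ⟨E1, hEd1, hEd2⟩ := exists_hasDerivAt_layer hβ hε (h * K) q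
    have hhK : 0 ≤ h * K := mul_nonneg hh.le hK0
    have h8 := fun j r hr => hu.contDiffOn_timeIntegral hT hA hf hε hh.le (t := r) hr j
    have hw1 : ∀ j, ∀ y ∈ 𝕀, ∀ r ∈ Icc 0 (T - h), HasDerivWithinAt
        (fun y => timeIntegral T h u k j y r)
        (iteratedDerivWithin (k + 1) (fun y => timeIntegral T h u 0 j y r) 𝕀 y) 𝕀 y := by
      intro j y hy r hr
      refine (hasDerivWithinAt_iteratedDerivWithin uniqueDiffOn_unitInterval (h8 j r hr)
        (k := k) (by omega) hy).congr (fun z hz => ?_) ?_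
      · exact (iteratedDerivWithin_timeIntegral hT hu.smooth hk hh.le j hz hr).symm
      · exact (iteratedDerivWithin_timeIntegral hT hu.smooth hk hh.le j hy hr).symm
    refine parabolic_abs_le hA (hβ.trans hββs) hε (T := T - h)
      (w := fun j => timeIntegral T h u k j)
      (wt := fun j y r => compDeriv T u k 0 j y (r + h) - compDeriv T u k 0 j y r)
      -- Orders `k + 1` and `k + 2` may reach 8, beyond the derivatives of `u` itself, so they are
      -- taken of the integral.
      (w1 := fun j y r => iteratedDerivWithin (k + 1) (fun y => timeIntegral T h u 0 j y r) 𝕀 y)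
      (w2 := fun j y r => iteratedDerivWithin (k + 2) (fun y => timeIntegral T h u 0 j y r) 𝕀 y)
      (fun j => (continuous_timeIntegral hT hu.smooth hk h j).continuousOn)
      (fun j y hy r hr =>
        (hasDerivAt_timeIntegral_right hT hu.smooth hk hh.le j hy hr).hasDerivWithinAt)
      hw1
      (fun j y hy r hr => hasDerivWithinAt_iteratedDerivWithin uniqueDiffOn_unitInterval
        (h8 j r hr) (k := k + 1) (by omega) hy)
      hEd1 hEd2 (fun y _ => mul_nonneg hhK (hE0 y)) (fun j r hr => ?_) (fun j y hy => ?_)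
      (fun y hy r hr j => ?_) j hy hs
    · have hKeK : Ke ≤ K := by rw [hK]; linarith
      constructor
      · refine (abs_timeIntegral_le hh.le (by simp) hr fun s hs =>
          (hend j s (hwin hr hs)).1).trans ?_
        rw [mul_assoc]
        exact mul_le_mul_of_nonneg_left (mul_le_mul_of_nonneg_right hKeK (hE0 0)) hh.le
      · refine (abs_timeIntegral_le hh.le (by simp) hr fun s hs =>
          (hend j s (hwin hr hs)).2).trans ?_
        rw [mul_assoc]
        exact mul_le_mul_of_nonneg_left (mul_le_mul_of_nonneg_right hKeK (hE0 1)) hh.le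
    · have hr : (0 : ℝ) ∈ Icc 0 (T - h) := ⟨le_rfl, hs.1.trans hs.2⟩
      refine (abs_timeIntegral_le hh.le hy hr fun s hs =>
        hsmall j y hy s (hwin hr hs) (by linarith [hs.2])).trans ?_
      rw [mul_assoc]
      refine mul_le_mul_of_nonneg_left ?_ hh.le
      have h1K : 1 ≤ K := by rw [hK]; linarith
      exact one_le_mul_of_one_le_of_one_le h1K (hE1 y)
    · have hyI := Ioo_subset_Icc_self hy
      have hrI := Ioc_subset_Icc_self hr
      rw [hu.timeIntegral_deriv_eqn hT hA hf hε hh.le hk hyI hrI j]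
      have b1 : |timeIntegral T h f k j y r| ≤ h * C :=
        abs_timeIntegral_le hh.le hyI hrI fun s hs =>
          hC.source k 0 (by omega) j y hyI s (hwin hrI hs)
      have b2 := abs_leibnizRemainder_le (A := A) (z := fun j y => timeIntegral T h u 0 j y r)
        (i := j) (x := y) (R := h * (K' * (1 + q * layer β ε y))) hk
        (fun l hl j' => hC.coeff l hl j j' y hyI)
        (fun m hm j' => by
          rw [iteratedDerivWithin_timeIntegral hT hu.smooth (by omega) hh.le j' hyI hrI]
          exact abs_timeIntegral_le hh.le hyI hrI fun s hs =>
            hlow m hm j' y hyI s (hwin hrI hs))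
        (mul_nonneg hh.le (mul_nonneg hK' (hE0 y)))
      refine (abs_sub _ _).trans ((add_le_add b1 b2).trans (le_trans ?_
        (layer_operator_ge hε hβ.le hhK y)))
      have e1 : h * C ≤ h * C * (1 + q * layer β ε y) :=
        le_mul_of_one_le_right (by positivity) (hE1 y)
      have e2 := mul_le_mul_of_nonneg_right (mul_le_mul_of_nonneg_left hKσ hh.le) (hE0 y)
      nlinarith
  -- Dividing by `h` and letting `h → 0` recovers the integrand as a right derivative. This needs `s
  -- < T`; the final time follows by closedness.
  have hlt : ∀ s ∈ Ico 0 T, |compDeriv T u k 0 i x s| ≤ K * (1 + q * layer β ε x) := by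
    intro s hs
    have hsT : s ∈ Icc 0 T := Ico_subset_Icc_self hs
    have hc := continuous_extendRect_compDeriv hT hu.smooth (a := k) (b := 0) (by omega) i
    have hcz : Continuous fun s => extendRect T (compDeriv T u k 0 i) x s := by fun_prop
    have hd := (hcz.integral_hasStrictDerivAt s s).hasDerivAt
    rw [extendRect_eq hx hsT] at hd
    have hd' := (hasDerivWithinAt_iff_tendsto_slope' (s := Ioi s) (by simp)).1
      (hd.hasDerivWithinAt (s := Ioi s))
    refine le_of_tendsto hd'.abs ?_
    have hmem : Ioo s (min (s + δ) T) ∈ nhdsWithin s (Ioi s) :=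
      Ioo_mem_nhdsGT (lt_min (by linarith) hs.2)
    filter_upwards [hmem] with r hr
    have hr1 : r < s + δ := hr.2.trans_le (min_le_left _ _)
    have hr2 : r < T := hr.2.trans_le (min_le_right _ _)
    have hpos : 0 < r - s := sub_pos.2 hr.1
    have := hint (r - s) hpos (by linarith) s ⟨hs.1, by linarith⟩ x hx i
    rw [timeIntegral, add_sub_cancel] at this
    rw [slope_def_field, intervalIntegral.integral_same, sub_zero, abs_div, abs_of_pos hpos,
      div_le_iff₀ hpos]
    linarith
  have hcl : IsClosed {s : ℝ | |extendRect T (compDeriv T u k 0 i) x s|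
      ≤ K * (1 + q * layer β ε x)} := by
    have hc := continuous_extendRect_compDeriv hT hu.smooth (a := k) (b := 0) (by omega) i
    have hcz : Continuous fun s => extendRect T (compDeriv T u k 0 i) x s := by fun_prop
    exact isClosed_le hcz.abs continuous_const
  have hsub : Ico 0 T ⊆ {s : ℝ | |extendRect T (compDeriv T u k 0 i) x s|
      ≤ K * (1 + q * layer β ε x)} := by
    intro s hs
    rw [mem_ofPred_eq, extendRect_eq hx (Ico_subset_Icc_self hs)]
    exact hlt s hs
  have hmem := closure_minimal hsub hcl (by rw [closure_Ico hT.ne]; exact ht)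
  rwa [mem_ofPred_eq, extendRect_eq hx ht] at hmem

theorem layer_weight_mono {β ε : ℝ} (hε : 0 < ε) (hε1 : ε ≤ 1) {m k : ℕ} (hmk : m ≤ k) (x : ℝ) :
    1 + (Real.sqrt ε ^ m)⁻¹ * layer β ε x ≤ 1 + (Real.sqrt ε ^ k)⁻¹ * layer β ε x := by
  have he0 : 0 < Real.sqrt ε := Real.sqrt_pos.2 hε
  have h1 : Real.sqrt ε ^ k ≤ Real.sqrt ε ^ m :=
    pow_le_pow_of_le_one he0.le (Real.sqrt_le_one.2 hε1) hmk
  have h2 := inv_anti₀ (by positivity) h1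
  have := mul_le_mul_of_nonneg_right h2 (layer_pos β ε x).le
  linarith

theorem div_le_layer_weight {β ε K : ℝ} (hK : 0 ≤ K) {k : ℕ} {x : ℝ}
    (hx : 1 ≤ layer β ε x) :
    K / Real.sqrt ε ^ k ≤ K * (1 + (Real.sqrt ε ^ k)⁻¹ * layer β ε x) := by
  rw [div_eq_mul_inv]
  refine mul_le_mul_of_nonneg_left ?_ hK
  have h0 : 0 ≤ (Real.sqrt ε ^ k)⁻¹ := by positivity
  have := le_mul_of_one_le_right h0 hx
  linarith

/-- Induction on the order `k` with weight `q = ε^(-k/2)`. The commutator involves orders below `k`,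
whose weights are smaller because `ε ≤ 1`; the boundary values come from `exists_endpoint_bound`,
the layer function being at least 1 there. -/
theorem exists_layer_bound (hT : 0 < T) (hβ : 0 < β) (hββs : β < βs)
    (hA : IsCouplingMatrix A βs) (hf : IsCompatibleSource T f) :
    ∃ K : ℝ, 0 ≤ K ∧ ∀ (ε : ℝ), 0 < ε → ε ≤ 1 → ∀ u, IsParabolicSolution ε T A f u →
      ∀ k ≤ 6, ∀ i, ∀ x ∈ 𝕀, ∀ t ∈ Icc 0 T,
        |compDeriv T u k 0 i x t| ≤ K * (1 + (Real.sqrt ε ^ k)⁻¹ * layer β ε x) := by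
  obtain ⟨C, hC⟩ := exists_isDataBound hA hf
  obtain ⟨Ke, hKe0, hKe⟩ := exists_endpoint_bound hT hβ hββs hA hf
  have hC0 := hC.nonneg
  have hσ : 0 < βs - β := sub_pos.2 hββs
  have key : ∀ n ≤ 7, ∃ K : ℝ, 0 ≤ K ∧ ∀ (ε : ℝ), 0 < ε → ε ≤ 1 →
      ∀ u, IsParabolicSolution ε T A f u → ∀ k < n, ∀ i, ∀ x ∈ 𝕀, ∀ t ∈ Icc 0 T,
        |compDeriv T u k 0 i x t| ≤ K * (1 + (Real.sqrt ε ^ k)⁻¹ * layer β ε x) := by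
    intro n
    induction n with
    | zero => exact fun _ => ⟨0, le_rfl, fun _ _ _ _ _ k hk => absurd hk (by omega)⟩
    | succ n ih =>
      intro hn
      obtain ⟨K, hK0, hK⟩ := ih (by omega)
      refine ⟨K + (Ke + 1 + (C + M * (64 * C) * K) / (βs - β)), by positivity, ?_⟩
      intro ε hε hε1 u hu k hk i x hx t ht
      have hE0 : 0 ≤ 1 + (Real.sqrt ε ^ k)⁻¹ * layer β ε x := by
        have := (layer_pos β ε x).le
        positivity
      rw [add_mul]
      rcases (Nat.lt_succ_iff.1 hk).lt_or_eq with hlt | rfl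
      · exact (hK ε hε hε1 u hu k hlt i x hx t ht).trans
          (le_add_of_nonneg_right (mul_nonneg (by positivity) hE0))
      · refine (hu.abs_compDeriv_le hT hβ hββs hA hf hC hε (k := k) (by omega)
          (q := (Real.sqrt ε ^ k)⁻¹) (by positivity) hK0 hKe0 ?_ ?_ i hx ht).trans
          (le_add_of_nonneg_left (mul_nonneg hK0 hE0))
        · intro m hm j y hy s hs
          exact (hK ε hε hε1 u hu m hm j y hy s hs).trans
            (mul_le_mul_of_nonneg_left (layer_weight_mono hε hε1 hm.le y) hK0)
        · intro j s hs
          constructor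
          · exact (hKe ε hε hε1 u hu 0 (by norm_num) k (by omega) 0 1 (Or.inl ⟨rfl, rfl⟩) j s
              hs).trans (div_le_layer_weight hKe0 (one_le_layer_zero β ε))
          · exact (hKe ε hε hε1 u hu 0 (by norm_num) k (by omega) 1 (-1) (Or.inr ⟨rfl, rfl⟩) j s
              hs).trans (div_le_layer_weight hKe0 (one_le_layer_one β ε))
  obtain ⟨K, hK0, hK⟩ := key 7 le_rfl
  exact ⟨K, hK0, fun ε hε hε1 u hu k hk => hK ε hε hε1 u hu k (by omega)⟩

end LayerBound

/-! ### The Crank–Nicolson step, its difference quotient and its residual -/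

section CrankNicolson

variable {M : ℕ} {A : ℝ → Matrix (Fin M) (Fin M) ℝ} {βs β T ε τ t : ℝ}
  {f u : ℝ → ℝ → Fin M → ℝ} {v : Fin M → ℝ → ℝ}

theorem operator_const_mul_sub {a b : Fin M → ℝ → ℝ} (c : ℝ) (i : Fin M) {x : ℝ} (hx : x ∈ 𝕀)
    (ha : ContDiffOn ℝ (2 : ℕ) (a i) 𝕀) (hb : ContDiffOn ℝ (2 : ℕ) (b i) 𝕀) :
    -ε * iteratedDerivWithin 2 (fun y => c * (a i y - b i y)) 𝕀 x
      + ∑ j, A x i j * (c * (a j x - b j x))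
      = c * ((-ε * iteratedDerivWithin 2 (a i) 𝕀 x + ∑ j, A x i j * a j x)
        - (-ε * iteratedDerivWithin 2 (b i) 𝕀 x + ∑ j, A x i j * b j x)) := by
  have h1 : ∑ j, A x i j * (c * (a j x - b j x))
      = c * (∑ j, A x i j * a j x - ∑ j, A x i j * b j x) := by
    rw [← Finset.sum_sub_distrib, Finset.mul_sum]
    exact Finset.sum_congr rfl fun j _ => by ring
  rw [iteratedDerivWithin_const_mul_field, iteratedDerivWithin_sub_apply uniqueDiffOn_unitInterval
    hx ha hb, h1]
  ring

/-- `v` is a classical solution of the auxiliary Crank–Nicolson problem on the time interval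
`[t, t + τ]`; the equation is rewritten by means of the parabolic system at time `t`. -/
structure IsCrankNicolsonStep (ε T τ t : ℝ) (A : ℝ → Matrix (Fin M) (Fin M) ℝ)
    (f u : ℝ → ℝ → Fin M → ℝ) (v : Fin M → ℝ → ℝ) : Prop where
  pos : 0 < τ
  mem : t ∈ Icc 0 T
  mem_add : t + τ ∈ Icc 0 T
  smooth : ∀ i, ContDiffOn ℝ (6 : ℕ) (v i) 𝕀
  eqn : ∀ x ∈ 𝕀, ∀ i, -ε * iteratedDerivWithin 2 (v i) 𝕀 x + ∑ j, A x i j * v j x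
    = 2 / τ * (compDeriv T u 0 0 i x t - v i x) + compDeriv T u 0 1 i x t
      + compDeriv T f 0 0 i x (t + τ)
  boundary : ∀ x₀ σ, IsEndpoint x₀ σ → ∀ i, v i x₀ = 0

theorem IsAuxCrankNicolsonSolution.isCrankNicolsonStep (hT : 0 < T) (hA : IsCouplingMatrix A βs)
    (hf : IsCompatibleSource T f) (hε : 0 < ε) (hu : IsParabolicSolution ε T A f u) {n : ℕ}
    (hτ : 0 < τ) (hn : ((n : ℝ) + 1) * τ ≤ T) {v : ℝ → Fin M → ℝ}
    (hv : IsAuxCrankNicolsonSolution ε τ n A f u v) :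
    IsCrankNicolsonStep ε T τ (n * τ) A f u (fun i x => v x i) := by
  have hnτ : 0 ≤ (n : ℝ) * τ := by positivity
  have hmem : (n : ℝ) * τ ∈ Icc 0 T := ⟨hnτ, by linarith⟩
  have hmem' : (n : ℝ) * τ + τ ∈ Icc 0 T := ⟨by linarith, by linarith⟩
  set t := (n : ℝ) * τ with ht
  have ht1 : ((n : ℝ) + 1) * τ = t + τ := by rw [ht]; ring
  -- `H` is the value of `v''` forced by the equation, with `L u` at time `t` eliminated by the
  -- parabolic system. It has as many derivatives as `v`, up to the four of `∂ₜu`; hence the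
  -- bootstrap `C^0 → C^2 → C^4 → C^6`.
  set H : Fin M → ℝ → ℝ := fun i x => ε⁻¹ * (∑ j, A x i j * v x j
    - (2 / τ * (compDeriv T u 0 0 i x t - v x i) + compDeriv T u 0 1 i x t
      + compDeriv T f 0 0 i x (t + τ))) with hH
  have hHc : ∀ m : ℕ, m ≤ 4 → (∀ i, ContDiffOn ℝ m (fun x => v x i) 𝕀) → ∀ i, ContDiffOn ℝ m (H i) 𝕀 := by
    intro m hm hvm i
    have hw : (m : WithTop ℕ∞) ≤ (4 : ℕ) := by exact_mod_cast hm
    refine contDiffOn_const.mul ((contDiffOn_matVec (z := fun j x => v x j)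
      (fun a b => (hA.smooth a b).of_le (by exact_mod_cast (by omega : m ≤ 6))) hvm i).sub
      (((contDiffOn_const.mul (ContDiffOn.sub ?_ (hvm i))).add ?_).add ?_))
    · exact (contDiffOn_compDeriv hu.smooth (a := 4) (by norm_num) i hmem).of_le hw
    · exact (contDiffOn_compDeriv hu.smooth (a := 4) (by norm_num) i hmem).of_le hw
    · exact (contDiffOn_compDeriv hf.smooth (a := 4) (by norm_num) i hmem').of_le hw
  have hv0 : ∀ i, ContDiffOn ℝ (0 : ℕ) (fun x => v x i) 𝕀 := fun i => by
    simpa using hv.continuousOn i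
  have hv2 : ∀ i, ∀ x ∈ Ioo (0 : ℝ) 1, iteratedDerivWithin 2 (fun y => v y i) 𝕀 x = H i x := by
    intro i x hx
    have h1 := hv.eqn x hx i
    have h2 := hu.eqn_closed hT hA hf (j := 0) (by norm_num) (Ioo_subset_Icc_self hx) hmem i
    simp only [zero_add] at h2
    rw [ht1, ← ht] at h1
    have h3 : spatialOp ε A (fun y => u y t) x i = -ε * compDeriv T u 2 0 i x t
        + ∑ k, A x i k * compDeriv T u 0 0 k x t := by
      simp [spatialOp, compDeriv, mixedDeriv]
    rw [h3] at h1
    simp only [spatialOp] at h1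
    rw [← compDeriv_zero_zero (T := T) u, ← compDeriv_zero_zero (T := T) f,
      ← compDeriv_zero_zero (T := T) f] at h1
    simp only [hH]
    field_simp
    field_simp at h1
    linear_combination -h1 + τ * h2
  have hex := fun i => exists_hasDerivWithinAt_of_continuousOn (hv.continuousOn i) (hv.smooth i)
    (hHc 0 (by norm_num) hv0 i).continuousOn (hv2 i)
  choose y1 hy1 hy2 using hex
  have hstep : ∀ m : ℕ, m ≤ 4 → (∀ i, ContDiffOn ℝ m (fun x => v x i) 𝕀) →
      ∀ i, ContDiffOn ℝ (m + 2 : ℕ) (fun x => v x i) 𝕀 := fun m hm hvm i =>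
    contDiffOn_add_two uniqueDiffOn_unitInterval (hy1 i) (hy2 i) (hHc m hm hvm i)
  have h6 := hstep 4 le_rfl (hstep 2 (by norm_num) (hstep 0 (by norm_num) hv0))
  refine ⟨hτ, hmem, hmem', h6, fun x hx i => ?_, ?_⟩
  · have hd2 : iteratedDerivWithin 2 (fun y => v y i) 𝕀 x = H i x :=
      iteratedDerivWithin_eq_of_chain (m := 2)
        (G := fun k => match k with | 0 => fun y => v y i | 1 => y1 i | _ => H i)
        uniqueDiffOn_unitInterval (fun k hk y hy => by
          interval_cases k
          · exact hy1 i y hy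
          · exact hy2 i y hy) 2 le_rfl hx
    rw [hd2]
    simp only [hH]
    field_simp
    ring
  · rintro x₀ σ (⟨rfl, -⟩ | ⟨rfl, -⟩) i
    · simp [hv.boundary.1]
    · simp [hv.boundary.2]

/-- The difference quotient `(v - u(·,t)) / τ`. -/
noncomputable def stepQuotient (T τ t : ℝ) (u : ℝ → ℝ → Fin M → ℝ) (v : Fin M → ℝ → ℝ) (i : Fin M)
    (x : ℝ) : ℝ :=
  τ⁻¹ * (v i x - compDeriv T u 0 0 i x t)

/-- The scaled deviation of the difference quotient from `∂_t u(·,t)`. -/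
noncomputable def stepResidual (T τ t : ℝ) (u : ℝ → ℝ → Fin M → ℝ) (v : Fin M → ℝ → ℝ) (i : Fin M)
    (x : ℝ) : ℝ :=
  2 / τ * (compDeriv T u 0 1 i x t - stepQuotient T τ t u v i x)

/-- The difference quotient of the source term in time. -/
noncomputable def sourceQuotient (T τ t : ℝ) (f : ℝ → ℝ → Fin M → ℝ) (i : Fin M) (x : ℝ) : ℝ :=
  τ⁻¹ * (compDeriv T f 0 0 i x (t + τ) - compDeriv T f 0 0 i x t)

theorem contDiffOn_stepQuotient (hu : IsParabolicSolution ε T A f u)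
    (hv : IsCrankNicolsonStep ε T τ t A f u v) (i : Fin M) :
    ContDiffOn ℝ (6 : ℕ) (stepQuotient T τ t u v i) 𝕀 :=
  contDiffOn_const.mul ((hv.smooth i).sub (contDiffOn_compDeriv hu.smooth (by norm_num) i hv.mem))

theorem contDiffOn_stepResidual (hu : IsParabolicSolution ε T A f u)
    (hv : IsCrankNicolsonStep ε T τ t A f u v) (i : Fin M) :
    ContDiffOn ℝ (4 : ℕ) (stepResidual T τ t u v i) 𝕀 :=
  contDiffOn_const.mul ((contDiffOn_compDeriv hu.smooth (by norm_num) i hv.mem).sub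
    ((contDiffOn_stepQuotient hu hv i).of_le (by norm_cast)))

theorem iteratedDerivWithin_sourceQuotient (hf : IsCompatibleSource T f)
    (hv : IsCrankNicolsonStep ε T τ t A f u v) {k : ℕ} (hk : k ≤ 6) (i : Fin M) {x : ℝ}
    (hx : x ∈ 𝕀) : iteratedDerivWithin k (sourceQuotient T τ t f i) 𝕀 x
      = τ⁻¹ * (compDeriv T f k 0 i x (t + τ) - compDeriv T f k 0 i x t) := by
  unfold sourceQuotient
  rw [iteratedDerivWithin_const_mul_field, iteratedDerivWithin_sub_apply uniqueDiffOn_unitInterval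
    hx (contDiffOn_compDeriv hf.smooth (by omega) i hv.mem_add)
    (contDiffOn_compDeriv hf.smooth (by omega) i hv.mem), iteratedDerivWithin_compDeriv_zero,
    iteratedDerivWithin_compDeriv_zero]

theorem abs_iteratedDerivWithin_sourceQuotient_le (hT : 0 < T) (hf : IsCompatibleSource T f) {C : ℝ}
    (hC : IsDataBound T A f C) (hv : IsCrankNicolsonStep ε T τ t A f u v) {k : ℕ} (hk : k ≤ 4)
    (i : Fin M) {x : ℝ} (hx : x ∈ 𝕀) :
    |iteratedDerivWithin k (sourceQuotient T τ t f i) 𝕀 x| ≤ C := by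
  rw [iteratedDerivWithin_sourceQuotient hf hv (by omega) i hx, abs_mul, abs_inv, abs_of_pos hv.pos,
    inv_mul_le_iff₀ hv.pos]
  have := abs_sub_le_of_hasDerivWithinAt (g := fun s => compDeriv T f k 0 i x s)
    (fun s hs => hasDerivWithinAt_compDeriv_right hT hf.smooth (b := 0) (by omega) i hx hs)
    (fun s hs => hC.source k 1 (by omega) i x hx s hs) hv.mem_add hv.mem
  rw [add_sub_cancel_left, abs_of_pos hv.pos] at this
  linarith

/-- First order consistency of the difference quotient, by the mean value inequality for `f(s) - s
∂ₜf(t)`. The factor `τ` compensates the `2 / τ` in `stepResidual_eqn`. -/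
theorem abs_sub_sourceQuotient_le (hT : 0 < T) (hf : IsCompatibleSource T f) {C : ℝ}
    (hC : IsDataBound T A f C) (hv : IsCrankNicolsonStep ε T τ t A f u v)
    (i : Fin M) {x : ℝ} (hx : x ∈ 𝕀) :
    |compDeriv T f 0 1 i x t - sourceQuotient T τ t f i x| ≤ C * τ := by
  have hτ := hv.pos
  have hsub : Icc t (t + τ) ⊆ Icc 0 T := Icc_subset_Icc hv.mem.1 hv.mem_add.2
  have hder : ∀ s ∈ Icc t (t + τ), HasDerivWithinAt
      (fun s => compDeriv T f 0 0 i x s - s * compDeriv T f 0 1 i x t)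
      (compDeriv T f 0 1 i x s - 1 * compDeriv T f 0 1 i x t) (Icc t (t + τ)) s := fun s hs =>
    ((hasDerivWithinAt_compDeriv_right hT hf.smooth (by norm_num) i hx (hsub hs)).mono hsub).sub
      ((hasDerivAt_id s).mul_const _).hasDerivWithinAt
  have hbound : ∀ s ∈ Icc t (t + τ),
      |compDeriv T f 0 1 i x s - 1 * compDeriv T f 0 1 i x t| ≤ C * τ := by
    intro s hs
    have := abs_sub_le_of_hasDerivWithinAt (g := fun s => compDeriv T f 0 1 i x s)
      (fun s hs => hasDerivWithinAt_compDeriv_right hT hf.smooth (by norm_num) i hx hs)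
      (fun s hs => hC.source 0 2 (by omega) i x hx s hs) (hsub hs) hv.mem
    rw [one_mul]
    refine this.trans (mul_le_mul_of_nonneg_left ?_ hC.nonneg)
    rw [abs_of_nonneg (by linarith [hs.1])]
    linarith [hs.2]
  have := abs_sub_le_of_hasDerivWithinAt hder hbound (right_mem_Icc.2 (by linarith))
    (left_mem_Icc.2 (by linarith))
  rw [add_sub_cancel_left, abs_of_pos hτ] at this
  have heq : compDeriv T f 0 1 i x t - sourceQuotient T τ t f i x
      = -τ⁻¹ * (compDeriv T f 0 0 i x (t + τ) - (t + τ) * compDeriv T f 0 1 i x t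
        - (compDeriv T f 0 0 i x t - t * compDeriv T f 0 1 i x t)) := by
    unfold sourceQuotient
    field_simp
    ring
  rw [heq, abs_mul, abs_neg, abs_inv, abs_of_pos hτ, inv_mul_le_iff₀ hτ]
  linarith

/-- Discrete analogue of `L ∂ₜu = ∂ₜf - ∂ₜ²u`: the quotient stands for `∂ₜu`, and the residual for
`-∂ₜ²u`. -/
theorem stepQuotient_eqn (hT : 0 < T) (hA : IsCouplingMatrix A βs) (hf : IsCompatibleSource T f)
    (hu : IsParabolicSolution ε T A f u) (hv : IsCrankNicolsonStep ε T τ t A f u v) (i : Fin M)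
    {x : ℝ} (hx : x ∈ 𝕀) :
    -ε * iteratedDerivWithin 2 (stepQuotient T τ t u v i) 𝕀 x
      + ∑ j, A x i j * stepQuotient T τ t u v j x
      = stepResidual T τ t u v i x + sourceQuotient T τ t f i x := by
  have hτ := hv.pos
  have h1 := operator_const_mul_sub (ε := ε) (A := A) (a := v)
    (b := fun j y => compDeriv T u 0 0 j y t) τ⁻¹ i hx
    ((hv.smooth i).of_le (by norm_cast)) (contDiffOn_compDeriv hu.smooth (by norm_num) i hv.mem)
  have h2 := hu.eqn_closed hT hA hf (j := 0) (by norm_num) hx hv.mem i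
  rw [hv.eqn x hx i, iteratedDerivWithin_compDeriv_zero] at h1
  unfold stepResidual sourceQuotient stepQuotient
  rw [h1]
  simp only [zero_add] at h2
  field_simp
  linear_combination -τ * h2

/-- Multiplied by `τ / 2`, this reads `(I + τ/2 L) r = -∂ₜ²u + (∂ₜf - sourceQuotient)`, so the
division by `τ` in the definition of `r` does no harm. -/
theorem stepResidual_eqn (hT : 0 < T) (hA : IsCouplingMatrix A βs) (hf : IsCompatibleSource T f)
    (hu : IsParabolicSolution ε T A f u) (hv : IsCrankNicolsonStep ε T τ t A f u v) (i : Fin M)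
    {x : ℝ} (hx : x ∈ 𝕀) :
    -ε * iteratedDerivWithin 2 (stepResidual T τ t u v i) 𝕀 x
      + ∑ j, A x i j * stepResidual T τ t u v j x
      = 2 / τ * (compDeriv T f 0 1 i x t - compDeriv T u 0 2 i x t
        - stepResidual T τ t u v i x - sourceQuotient T τ t f i x) := by
  have hτ := hv.pos
  have h1 := operator_const_mul_sub (ε := ε) (A := A)
    (a := fun j y => compDeriv T u 0 1 j y t) (b := stepQuotient T τ t u v) (2 / τ) i hx
    (contDiffOn_compDeriv hu.smooth (by norm_num) i hv.mem)
    ((contDiffOn_stepQuotient hu hv i).of_le (by norm_cast))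
  have h2 := hu.eqn_closed hT hA hf (j := 1) (by norm_num) hx hv.mem i
  have h3 := stepQuotient_eqn hT hA hf hu hv i hx
  rw [h3, iteratedDerivWithin_compDeriv_zero] at h1
  refine h1.trans ?_
  norm_num at h2
  linear_combination (2 / τ) * h2

theorem boundary_stepQuotient (hu : IsParabolicSolution ε T A f u)
    (hv : IsCrankNicolsonStep ε T τ t A f u v) {x₀ σ : ℝ} (hend : IsEndpoint x₀ σ) (i : Fin M) :
    stepQuotient T τ t u v i x₀ = 0 := by
  simp [stepQuotient, hv.boundary x₀ σ hend i, hu.boundary_eq_zero hend 0 i hv.mem]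

theorem boundary_stepResidual (hu : IsParabolicSolution ε T A f u)
    (hv : IsCrankNicolsonStep ε T τ t A f u v) {x₀ σ : ℝ} (hend : IsEndpoint x₀ σ) (i : Fin M) :
    stepResidual T τ t u v i x₀ = 0 := by
  simp [stepResidual, boundary_stepQuotient hu hv hend i, hu.boundary_eq_zero hend 1 i hv.mem]

/-- Comparison with a multiple of the barrier at an endpoint. -/
theorem abs_le_endBarrier_of_elliptic (hA : IsCouplingMatrix A βs) (hβ : 0 < β) (hββs : β < βs)
    (hε : 0 < ε) (hτ : 0 < τ) {K : ℝ} (hK : 0 ≤ K) {x₀ σ : ℝ} (hend : IsEndpoint x₀ σ)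
    {w : Fin M → ℝ → ℝ} (hw : ∀ i, ContDiffOn ℝ (2 : ℕ) (w i) 𝕀) (hw0 : ∀ i, w i 0 = 0)
    (hw1 : ∀ i, w i 1 = 0)
    (h : ∀ x ∈ 𝕀, ∀ i, |w i x + τ / 2 * (-ε * iteratedDerivWithin 2 (w i) 𝕀 x
      + ∑ j, A x i j * w j x)| ≤ K * endBarrier β ε x₀ σ x + τ / 2 * (K * β))
    (i : Fin M) {x : ℝ} (hx : x ∈ 𝕀) : |w i x| ≤ K * endBarrier β ε x₀ σ x := by
  obtain ⟨E1, hE1, hE2⟩ := exists_hasDerivAt_endBarrier hend hβ hε K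
  have hE0 : ∀ y ∈ 𝕀, 0 ≤ K * endBarrier β ε x₀ σ y := fun y hy =>
    mul_nonneg hK (endBarrier_nonneg hend hy)
  refine elliptic_abs_le hA (hβ.trans hββs) hε hτ (w := w)
    (w1 := fun i => iteratedDerivWithin 1 (w i) 𝕀) (w2 := fun i => iteratedDerivWithin 2 (w i) 𝕀)
    (fun i y hy => ?_)
    (fun i y hy => hasDerivWithinAt_iteratedDerivWithin uniqueDiffOn_unitInterval (hw i)
      (by norm_num) hy) hE1 hE2 hE0 (fun i => ?_) (fun y hy i => ?_) i hx
  · simpa using hasDerivWithinAt_iteratedDerivWithin uniqueDiffOn_unitInterval (hw i) (k := 0)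
      (by norm_num) hy
  · rw [hw0, hw1, abs_zero]
    exact ⟨hE0 0 (by simp), hE0 1 (by simp)⟩
  · have hyI := Ioo_subset_Icc_self hy
    refine (h y hyI i).trans (add_le_add_right ?_ _)
    exact mul_le_mul_of_nonneg_left (endBarrier_operator_ge hend hK hε hββs.le hyI)
      (half_pos hτ).le

end CrankNicolson

/-! ### Uniform bounds for the Crank–Nicolson step -/

section CrankNicolsonBounds

variable {M : ℕ} {A : ℝ → Matrix (Fin M) (Fin M) ℝ} {βs β T : ℝ} {f : ℝ → ℝ → Fin M → ℝ}

/-- In the equations for `(I + τ/2 L)` of the quotient and of the residual, `∂ₜu` and `∂ₜ²u` lie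
below the end barrier by `exists_abs_le_endBarrier`. The remainders are `O(τ)` and are absorbed by
the term `τ/2 * (K β)`. -/
theorem exists_step_abs_le_endBarrier (hT : 0 < T) (hβ : 0 < β) (hββs : β < βs)
    (hA : IsCouplingMatrix A βs) (hf : IsCompatibleSource T f) :
    ∃ K : ℝ, 0 ≤ K ∧ ∀ (ε : ℝ), 0 < ε → ε ≤ 1 → ∀ u, IsParabolicSolution ε T A f u →
      ∀ τ t v, IsCrankNicolsonStep ε T τ t A f u v →
      ∀ x₀ σ, IsEndpoint x₀ σ → ∀ i, ∀ x ∈ 𝕀,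
        |stepQuotient T τ t u v i x| ≤ K * endBarrier β ε x₀ σ x ∧
        |stepResidual T τ t u v i x| ≤ K * endBarrier β ε x₀ σ x := by
  obtain ⟨C, hC⟩ := exists_isDataBound hA hf
  obtain ⟨B, hB0, hB⟩ := exists_abs_le_endBarrier hT hβ hββs hA hf
  have hC0 := hC.nonneg
  refine ⟨B + 2 * C / β, by positivity, ?_⟩
  intro ε hε hε1 u hu τ t v hv x₀ σ hend i x hx
  have hτ := hv.pos
  set K := B + 2 * C / β with hK
  have hK0 : 0 ≤ K := by positivity
  have hKβ : 2 * C ≤ K * β := by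
    have : K * β = B * β + 2 * C := by rw [hK]; field_simp
    rw [this]; exact le_add_of_nonneg_left (by positivity)
  have hBK : ∀ y ∈ 𝕀, B * endBarrier β ε x₀ σ y ≤ K * endBarrier β ε x₀ σ y := fun y hy =>
    mul_le_mul_of_nonneg_right (by rw [hK]; exact le_add_of_nonneg_right (by positivity))
      (endBarrier_nonneg hend hy)
  have hKτ : τ * C ≤ τ / 2 * (K * β) := by
    have := mul_le_mul_of_nonneg_left hKβ (half_pos hτ).le
    linarith
  have h0 : IsEndpoint 0 1 := Or.inl ⟨rfl, rfl⟩
  have h1 : IsEndpoint 1 (-1) := Or.inr ⟨rfl, rfl⟩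
  constructor
  · refine abs_le_endBarrier_of_elliptic hA hβ hββs hε hτ hK0 hend
      (fun j => (contDiffOn_stepQuotient hu hv j).of_le (by norm_cast))
      (fun j => boundary_stepQuotient hu hv h0 j) (fun j => boundary_stepQuotient hu hv h1 j)
      (fun y hy j => ?_) i hx
    have heq : stepQuotient T τ t u v j y + τ / 2 * (stepResidual T τ t u v j y
        + sourceQuotient T τ t f j y)
        = compDeriv T u 0 1 j y t + τ / 2 * sourceQuotient T τ t f j y := by
      unfold stepResidual
      field_simp
      ring
    rw [stepQuotient_eqn hT hA hf hu hv j hy, heq]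
    have b1 := hB ε hε hε1 u hu 1 (by norm_num) x₀ σ hend j y hy t hv.mem
    have b2 := abs_iteratedDerivWithin_sourceQuotient_le hT hf hC hv (k := 0) (by norm_num) j hy
    rw [iteratedDerivWithin_zero] at b2
    have b3 : |τ / 2 * sourceQuotient T τ t f j y| ≤ τ / 2 * C := by
      rw [abs_mul, abs_of_pos (half_pos hτ)]
      exact mul_le_mul_of_nonneg_left b2 (half_pos hτ).le
    have b4 : τ / 2 * C ≤ τ * C := by nlinarith
    refine (abs_add_le _ _).trans (add_le_add (b1.trans (hBK y hy)) (b3.trans (b4.trans hKτ)))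
  · refine abs_le_endBarrier_of_elliptic hA hβ hββs hε hτ hK0 hend
      (fun j => (contDiffOn_stepResidual hu hv j).of_le (by norm_cast))
      (fun j => boundary_stepResidual hu hv h0 j) (fun j => boundary_stepResidual hu hv h1 j)
      (fun y hy j => ?_) i hx
    have heq : stepResidual T τ t u v j y + τ / 2 * (2 / τ * (compDeriv T f 0 1 j y t
        - compDeriv T u 0 2 j y t - stepResidual T τ t u v j y - sourceQuotient T τ t f j y))
        = -compDeriv T u 0 2 j y t + (compDeriv T f 0 1 j y t - sourceQuotient T τ t f j y) := by
      field_simp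
      ring
    rw [stepResidual_eqn hT hA hf hu hv j hy, heq]
    have b1 := hB ε hε hε1 u hu 2 le_rfl x₀ σ hend j y hy t hv.mem
    have b2 := abs_sub_sourceQuotient_le hT hf hC hv j hy
    refine (abs_add_le _ _).trans (add_le_add ?_ (b2.trans ?_))
    · rw [abs_neg]; exact b1.trans (hBK y hy)
    · rw [mul_comm]; exact hKτ

theorem one_le_one_div_sqrt_pow {ε : ℝ} (hε : 0 < ε) (hε1 : ε ≤ 1) (n : ℕ) :
    1 ≤ 1 / Real.sqrt ε ^ n := by
  have he0 : 0 < Real.sqrt ε := Real.sqrt_pos.2 hε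
  rw [one_le_div (by positivity)]
  exact pow_le_one₀ he0.le (Real.sqrt_le_one.2 hε1)

theorem le_div_sqrt_pow {ε K : ℝ} (hK : 0 ≤ K) (hε : 0 < ε) (hε1 : ε ≤ 1) (n : ℕ) :
    K ≤ K / Real.sqrt ε ^ n := by
  rw [div_eq_mul_one_div]
  exact le_mul_of_one_le_right hK (one_le_one_div_sqrt_pow hε hε1 n)

/-- The value is zero, the first derivative comes from the end barrier, and the second from the
equation, where at the endpoint only `2/τ` times the `O(τ)` consistency error of the source
survives. -/
theorem exists_stepResidual_endpoint_bound (hT : 0 < T) (hβ : 0 < β) (hββs : β < βs)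
    (hA : IsCouplingMatrix A βs) (hf : IsCompatibleSource T f) :
    ∃ K : ℝ, 0 ≤ K ∧ ∀ (ε : ℝ), 0 < ε → ε ≤ 1 → ∀ u, IsParabolicSolution ε T A f u →
      ∀ τ t v, IsCrankNicolsonStep ε T τ t A f u v → ∀ x₀ σ, IsEndpoint x₀ σ → ∀ k ≤ 2, ∀ i,
        |iteratedDerivWithin k (stepResidual T τ t u v i) 𝕀 x₀| ≤ K / Real.sqrt ε ^ k := by
  obtain ⟨C, hC⟩ := exists_isDataBound hA hf
  obtain ⟨B, hB0, hB⟩ := exists_step_abs_le_endBarrier hT hβ hββs hA hf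
  have hC0 := hC.nonneg
  refine ⟨B * Real.sqrt β + 2 * C, by positivity, ?_⟩
  intro ε hε hε1 u hu τ t v hv x₀ σ hend k hk i
  have he0 : 0 < Real.sqrt ε := Real.sqrt_pos.2 hε
  have hτ := hv.pos
  interval_cases k
  · simp only [iteratedDerivWithin_zero, boundary_stepResidual hu hv hend i, abs_zero]
    positivity
  · have hd := hasDerivWithinAt_iteratedDerivWithin uniqueDiffOn_unitInterval
      (contDiffOn_stepResidual hu hv i) (k := 0) (by norm_num) hend.mem
    rw [iteratedDerivWithin_zero] at hd
    refine (abs_deriv_le_of_endBarrier hend hβ hB0 hd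
      (fun y hy => (hB ε hε hε1 u hu τ t v hv x₀ σ hend i y hy).2)).trans ?_
    rw [pow_one]
    gcongr
    exact le_add_of_nonneg_right (by positivity)
  · have heq := stepResidual_eqn hT hA hf hu hv i hend.mem
    simp only [boundary_stepResidual hu hv hend, hu.boundary_eq_zero hend 2 i hv.mem, mul_zero,
      Finset.sum_const_zero, sub_zero, add_zero] at heq
    have b := abs_sub_sourceQuotient_le hT hf hC hv i hend.mem
    rw [Real.sq_sqrt hε.le, le_div_iff₀ hε]
    have h2 : |iteratedDerivWithin 2 (stepResidual T τ t u v i) 𝕀 x₀| * ε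
        = 2 / τ * |compDeriv T f 0 1 i x₀ t - sourceQuotient T τ t f i x₀| := by
      have h := congrArg abs heq
      rw [abs_mul, abs_neg, abs_of_pos hε, abs_mul, abs_of_pos (show 0 < 2 / τ by positivity)] at h
      rw [mul_comm, h]
    rw [h2]
    calc 2 / τ * |compDeriv T f 0 1 i x₀ t - sourceQuotient T τ t f i x₀|
        ≤ 2 / τ * (C * τ) := mul_le_mul_of_nonneg_left b (by positivity)
      _ = 2 * C := by field_simp
      _ ≤ B * Real.sqrt β + 2 * C := le_add_of_nonneg_left (by positivity)

theorem exists_stepQuotient_endpoint_bound (hT : 0 < T) (hβ : 0 < β) (hββs : β < βs)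
    (hA : IsCouplingMatrix A βs) (hf : IsCompatibleSource T f) :
    ∃ K : ℝ, 0 ≤ K ∧ ∀ (ε : ℝ), 0 < ε → ε ≤ 1 → ∀ u, IsParabolicSolution ε T A f u →
      ∀ τ t v, IsCrankNicolsonStep ε T τ t A f u v → ∀ x₀ σ, IsEndpoint x₀ σ → ∀ k ≤ 4, ∀ i,
        |iteratedDerivWithin k (stepQuotient T τ t u v i) 𝕀 x₀| ≤ K / Real.sqrt ε ^ k := by
  obtain ⟨C, hC⟩ := exists_isDataBound hA hf
  obtain ⟨B, hB0, hB⟩ := exists_step_abs_le_endBarrier hT hβ hββs hA hf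
  obtain ⟨R, hR0, hR⟩ := exists_stepResidual_endpoint_bound hT hβ hββs hA hf
  have hC0 := hC.nonneg
  refine ⟨(B * Real.sqrt β + R + C) * (1 + 65 * (M * C)) ^ 6, by positivity, ?_⟩
  intro ε hε hε1 u hu τ t v hv x₀ σ hend k hk i
  have he0 : 0 < Real.sqrt ε := Real.sqrt_pos.2 hε
  set K := B * Real.sqrt β + R + C with hK
  have hK0 : 0 ≤ K := by positivity
  refine abs_iteratedDerivWithin_le_of_eqn hA hC hε hε1 hK0 (m := 2) (by norm_num)
    (g := fun i x => stepResidual T τ t u v i x + sourceQuotient T τ t f i x)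
    (fun j => (contDiffOn_stepQuotient hu hv j).of_le (by norm_cast))
    (fun y hy j => stepQuotient_eqn hT hA hf hu hv j hy) hend.mem
    (fun j => by rw [boundary_stepQuotient hu hv hend j, abs_zero]; exact hK0)
    (fun j => ?_) (fun n hn j => ?_) hk i
  · have hd := hasDerivWithinAt_iteratedDerivWithin uniqueDiffOn_unitInterval
      (contDiffOn_stepQuotient hu hv j) (k := 0) (by norm_num) hend.mem
    rw [iteratedDerivWithin_zero] at hd
    refine (abs_deriv_le_of_endBarrier hend hβ hB0 hd
      (fun y hy => (hB ε hε hε1 u hu τ t v hv x₀ σ hend j y hy).1)).trans ?_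
    gcongr
    rw [hK]; linarith
  · have hsc : ContDiffOn ℝ n (sourceQuotient T τ t f j) 𝕀 :=
      contDiffOn_const.mul ((contDiffOn_compDeriv hf.smooth (by omega) j hv.mem_add).sub
        (contDiffOn_compDeriv hf.smooth (by omega) j hv.mem))
    rw [iteratedDerivWithin_add_apply uniqueDiffOn_unitInterval hend.mem
      ((contDiffOn_stepResidual hu hv j).of_le (by exact_mod_cast (by omega : n ≤ 4))) hsc]
    have b1 := hR ε hε hε1 u hu τ t v hv x₀ σ hend n hn j
    have b2 := abs_iteratedDerivWithin_sourceQuotient_le hT hf hC hv (k := n) (by omega) j hend.mem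
    refine (abs_add_le _ _).trans ((add_le_add b1 (b2.trans (le_div_sqrt_pow hC0 hε hε1 n))).trans ?_)
    rw [← add_div]
    gcongr
    rw [hK]
    have : 0 ≤ B * Real.sqrt β := by positivity
    linarith

/-- The hierarchy closes here: with `q` the quotient, `L v = f⁺ - (2 q - ∂ₜu)`, and four derivatives
of `q` and of `∂ₜu` at the endpoint give six of `v`. Those of `q` rest in turn on two derivatives of
the residual. -/
theorem exists_step_endpoint_bound (hT : 0 < T) (hβ : 0 < β) (hββs : β < βs)
    (hA : IsCouplingMatrix A βs) (hf : IsCompatibleSource T f) :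
    ∃ K : ℝ, 0 ≤ K ∧ ∀ (ε : ℝ), 0 < ε → ε ≤ 1 → ∀ u, IsParabolicSolution ε T A f u →
      ∀ τ t v, IsCrankNicolsonStep ε T τ t A f u v → ∀ x₀ σ, IsEndpoint x₀ σ → ∀ k ≤ 6, ∀ i,
        |iteratedDerivWithin k (v i) 𝕀 x₀| ≤ K / Real.sqrt ε ^ k := by
  obtain ⟨C, hC⟩ := exists_isDataBound hA hf
  obtain ⟨U, hU0, hU⟩ := exists_endpoint_bound hT hβ hββs hA hf
  obtain ⟨W, hW0, hW⟩ := exists_stepQuotient_endpoint_bound hT hβ hββs hA hf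
  have hC0 := hC.nonneg
  -- The `2 W` bounds `2 q`; the `T W` bounds `τ q'` in `v' = u' + τ q'`, using `τ ≤ T`.
  refine ⟨(C + U + (2 + T) * W) * (1 + 65 * (M * C)) ^ 6, by positivity, ?_⟩
  intro ε hε hε1 u hu τ t v hv x₀ σ hend k hk i
  have he0 : 0 < Real.sqrt ε := Real.sqrt_pos.2 hε
  have hτ := hv.pos
  have hτT : τ ≤ T := by linarith [hv.mem.1, hv.mem_add.2]
  set K := C + U + (2 + T) * W with hK
  have hK0 : 0 ≤ K := by positivity
  refine abs_iteratedDerivWithin_le_of_eqn hA hC hε hε1 hK0 (m := 4) (by norm_num)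
    (g := fun i x => compDeriv T f 0 0 i x (t + τ)
      - (2 * stepQuotient T τ t u v i x - compDeriv T u 0 1 i x t))
    hv.smooth (fun y hy j => ?_) hend.mem
    (fun j => by rw [hv.boundary x₀ σ hend j, abs_zero]; exact hK0)
    (fun j => ?_) (fun n hn j => ?_) hk i
  · rw [hv.eqn y hy j]
    unfold stepQuotient
    field_simp
    ring
  · have hvq : EqOn (v j) (fun y => compDeriv T u 0 0 j y t - (-τ) * stepQuotient T τ t u v j y)
        𝕀 := by
      intro y hy
      simp only [stepQuotient]
      field_simp
      ring
    rw [iteratedDerivWithin_congr hvq hend.mem,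
      iteratedDerivWithin_sub_apply uniqueDiffOn_unitInterval hend.mem
        (contDiffOn_compDeriv hu.smooth (by norm_num) j hv.mem)
        (contDiffOn_const.mul ((contDiffOn_stepQuotient hu hv j).of_le (by norm_cast))),
      iteratedDerivWithin_const_mul_field, iteratedDerivWithin_compDeriv_zero]
    have b1 := hU ε hε hε1 u hu 0 (by norm_num) 1 (by norm_num) x₀ σ hend j t hv.mem
    have b2 := hW ε hε hε1 u hu τ t v hv x₀ σ hend 1 (by norm_num) j
    rw [pow_one] at b1 b2
    have b3 : |-τ * iteratedDerivWithin 1 (stepQuotient T τ t u v j) 𝕀 x₀|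
        ≤ T * (W / Real.sqrt ε) := by
      rw [abs_mul, abs_neg, abs_of_pos hτ]
      exact mul_le_mul hτT b2 (abs_nonneg _) hT.le
    refine (abs_sub _ _).trans ((add_le_add b1 b3).trans ?_)
    rw [← mul_div_assoc, ← add_div]
    gcongr
    rw [hK]
    nlinarith
  · have hqc : ContDiffOn ℝ n (stepQuotient T τ t u v j) 𝕀 :=
      (contDiffOn_stepQuotient hu hv j).of_le (by exact_mod_cast (by omega : n ≤ 6))
    have huc := contDiffOn_compDeriv hu.smooth (a := n) (b := 1) (by omega) j hv.mem
    rw [iteratedDerivWithin_sub_apply uniqueDiffOn_unitInterval hend.mem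
        (contDiffOn_compDeriv hf.smooth (by omega) j hv.mem_add)
        ((contDiffOn_const.mul hqc).sub huc),
      iteratedDerivWithin_sub_apply uniqueDiffOn_unitInterval hend.mem
        (contDiffOn_const.mul hqc) huc,
      iteratedDerivWithin_const_mul_field, iteratedDerivWithin_compDeriv_zero,
      iteratedDerivWithin_compDeriv_zero]
    have b1 := (hC.source n 0 (by omega) j x₀ hend.mem _ hv.mem_add).trans
      (le_div_sqrt_pow hC0 hε hε1 n)
    have b2 := hU ε hε hε1 u hu 1 (by norm_num) n (by omega) x₀ σ hend j t hv.mem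
    have b3 := hW ε hε hε1 u hu τ t v hv x₀ σ hend n hn j
    have b4 : |2 * iteratedDerivWithin n (stepQuotient T τ t u v j) 𝕀 x₀|
        ≤ 2 * (W / Real.sqrt ε ^ n) := by
      rw [abs_mul, abs_two]
      exact mul_le_mul_of_nonneg_left b3 (by norm_num)
    refine (abs_sub _ _).trans ((add_le_add b1 ((abs_sub _ _).trans (add_le_add b4 b2))).trans ?_)
    rw [← mul_div_assoc, ← add_div, ← add_div]
    gcongr
    rw [hK]
    nlinarith

/-- Adding the parabolic equation at time `t` cancels `∂ₜu`. After `k` differentiations only `∂ₓ^k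
u` remains from `u` on the right, so no derivatives are lost; an equation for `v` alone would
contain `∂ₓ^(k+2) u` or `∂ₓ^k ∂ₜu`. -/
theorem IsCrankNicolsonStep.sum_eqn (hT : 0 < T) (hA : IsCouplingMatrix A βs)
    (hf : IsCompatibleSource T f) {ε τ t : ℝ} {u : ℝ → ℝ → Fin M → ℝ} {v : Fin M → ℝ → ℝ}
    (hu : IsParabolicSolution ε T A f u) (hv : IsCrankNicolsonStep ε T τ t A f u v) (i : Fin M)
    {x : ℝ} (hx : x ∈ 𝕀) :
    -ε * iteratedDerivWithin 2 (fun y => v i y + compDeriv T u 0 0 i y t) 𝕀 x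
      + ∑ j, A x i j * (v j x + compDeriv T u 0 0 j x t)
      = 2 / τ * (2 * compDeriv T u 0 0 i x t - (v i x + compDeriv T u 0 0 i x t))
        + (compDeriv T f 0 0 i x t + compDeriv T f 0 0 i x (t + τ)) := by
  have h2 := hu.eqn_closed hT hA hf (j := 0) (by norm_num) hx hv.mem i
  have h3 := hv.eqn x hx i
  simp only [zero_add] at h2
  rw [iteratedDerivWithin_add_apply uniqueDiffOn_unitInterval hx
    ((hv.smooth i).of_le (by norm_cast)) (contDiffOn_compDeriv hu.smooth (by norm_num) i hv.mem),
    iteratedDerivWithin_compDeriv_zero]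
  simp only [mul_add, Finset.sum_add_distrib]
  linear_combination h2 + h3

/-- For the same reason the second derivative of `v + u` is of class `C^6`, although each summand is
only given as `C^6`; two more derivatives are needed for comparison at order 6. -/
theorem IsCrankNicolsonStep.contDiffOn_sum (hT : 0 < T) (hA : IsCouplingMatrix A βs)
    (hf : IsCompatibleSource T f) {ε τ t : ℝ} (hε : 0 < ε) {u : ℝ → ℝ → Fin M → ℝ}
    {v : Fin M → ℝ → ℝ} (hu : IsParabolicSolution ε T A f u)
    (hv : IsCrankNicolsonStep ε T τ t A f u v) (i : Fin M) :
    ContDiffOn ℝ (8 : ℕ) (fun y => v i y + compDeriv T u 0 0 i y t) 𝕀 := by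
  have huc : ∀ j, ContDiffOn ℝ (6 : ℕ) (fun y => compDeriv T u 0 0 j y t) 𝕀 := fun j =>
    contDiffOn_compDeriv hu.smooth (by norm_num) j hv.mem
  have hs : ∀ j, ContDiffOn ℝ (6 : ℕ) (fun y => v j y + compDeriv T u 0 0 j y t) 𝕀 := fun j =>
    (hv.smooth j).add (huc j)
  have hd : ∀ k < 6, ∀ x ∈ 𝕀, HasDerivWithinAt
      (iteratedDerivWithin k (fun y => v i y + compDeriv T u 0 0 i y t) 𝕀)
      (iteratedDerivWithin (k + 1) (fun y => v i y + compDeriv T u 0 0 i y t) 𝕀 x) 𝕀 x :=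
    fun k hk x hx => hasDerivWithinAt_iteratedDerivWithin uniqueDiffOn_unitInterval (hs i) hk hx
  refine contDiffOn_add_two (n := 6) uniqueDiffOn_unitInterval
    (by simpa using hd 0 (by norm_num)) (hd 1 (by norm_num)) ?_
  have hR : ContDiffOn ℝ (6 : ℕ) (fun x => ε⁻¹ *
      (∑ j, A x i j * (v j x + compDeriv T u 0 0 j x t)
        - (2 / τ * (2 * compDeriv T u 0 0 i x t - (v i x + compDeriv T u 0 0 i x t))
        + (compDeriv T f 0 0 i x t + compDeriv T f 0 0 i x (t + τ))))) 𝕀 :=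
    contDiffOn_const.mul ((contDiffOn_matVec
      (z := fun j x => v j x + compDeriv T u 0 0 j x t) (fun a b => by
        exact_mod_cast hA.smooth a b) hs i).sub
      ((contDiffOn_const.mul ((contDiffOn_const.mul (huc i)).sub (hs i))).add
        ((contDiffOn_compDeriv hf.smooth (by norm_num) i hv.mem).add
          (contDiffOn_compDeriv hf.smooth (by norm_num) i hv.mem_add))))
  refine hR.congr fun x hx => ?_
  rw [← hv.sum_eqn hT hA hf hu i hx]
  field_simp
  ring

theorem IsCrankNicolsonStep.sum_deriv_eqn (hT : 0 < T) (hA : IsCouplingMatrix A βs)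
    (hf : IsCompatibleSource T f) {ε τ t : ℝ} (hε : 0 < ε) {u : ℝ → ℝ → Fin M → ℝ}
    {v : Fin M → ℝ → ℝ} (hu : IsParabolicSolution ε T A f u)
    (hv : IsCrankNicolsonStep ε T τ t A f u v) {k : ℕ} (hk : k ≤ 6) (i : Fin M)
    {x : ℝ} (hx : x ∈ 𝕀) {s : Fin M → ℝ → ℝ}
    (hs : s = fun i y => v i y + compDeriv T u 0 0 i y t) :
    iteratedDerivWithin k (s i) 𝕀 x + τ / 2 * (-ε * iteratedDerivWithin (k + 2) (s i) 𝕀 x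
      + ∑ j, A x i j * iteratedDerivWithin k (s j) 𝕀 x)
      = 2 * compDeriv T u k 0 i x t + τ / 2 * (compDeriv T f k 0 i x t
        + compDeriv T f k 0 i x (t + τ) - leibnizRemainder A s k i x) := by
  have hτ := hv.pos
  have h8 : ∀ j, ContDiffOn ℝ (8 : ℕ) (s j) 𝕀 := fun j => by
    rw [hs]; exact hv.contDiffOn_sum hT hA hf hε hu j
  have hsk : ContDiffOn ℝ k (s i) 𝕀 := (h8 i).of_le (by exact_mod_cast (by omega : k ≤ 8))
  have huc := contDiffOn_compDeriv hu.smooth (a := k) (b := 0) (by omega) i hv.mem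
  have hf0 := contDiffOn_compDeriv hf.smooth (a := k) (b := 0) (by omega) i hv.mem
  have hf1 := contDiffOn_compDeriv hf.smooth (a := k) (b := 0) (by omega) i hv.mem_add
  have heq := iteratedDerivWithin_of_eqn (k := k) (ε := ε) (z := s)
    (g := fun i x => 2 / τ * (2 * compDeriv T u 0 0 i x t - s i x)
        + (compDeriv T f 0 0 i x t + compDeriv T f 0 0 i x (t + τ)))
    (fun a b => (hA.smooth a b).of_le (by exact_mod_cast hk))
    (fun j => (h8 j).of_le (by exact_mod_cast (by omega : k + 2 ≤ 8)))
    (fun y hy j => by rw [hs]; exact hv.sum_eqn hT hA hf hu j hy) i hx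
  rw [iteratedDerivWithin_add_apply uniqueDiffOn_unitInterval hx
      (contDiffOn_const.mul ((contDiffOn_const.mul huc).sub hsk)) (hf0.add hf1),
    iteratedDerivWithin_const_mul_field,
    iteratedDerivWithin_sub_apply uniqueDiffOn_unitInterval hx (contDiffOn_const.mul huc) hsk,
    iteratedDerivWithin_const_mul_field,
    iteratedDerivWithin_add_apply uniqueDiffOn_unitInterval hx hf0 hf1,
    iteratedDerivWithin_compDeriv_zero, iteratedDerivWithin_compDeriv_zero,
    iteratedDerivWithin_compDeriv_zero] at heq
  have h1 : τ / 2 * (2 / τ) = 1 := by field_simp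
  linear_combination τ / 2 * heq
    + (2 * compDeriv T u k 0 i x t - iteratedDerivWithin k (s i) 𝕀 x) * h1

theorem exists_sum_layer_bound (hT : 0 < T) (hβ : 0 < β) (hββs : β < βs)
    (hA : IsCouplingMatrix A βs) (hf : IsCompatibleSource T f) :
    ∃ K : ℝ, 0 ≤ K ∧ ∀ (ε : ℝ), 0 < ε → ε ≤ 1 → ∀ u, IsParabolicSolution ε T A f u →
      ∀ τ t v, IsCrankNicolsonStep ε T τ t A f u v → ∀ k ≤ 6, ∀ i, ∀ x ∈ 𝕀,
        |iteratedDerivWithin k (fun y => v i y + compDeriv T u 0 0 i y t) 𝕀 x|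
          ≤ K * (1 + (Real.sqrt ε ^ k)⁻¹ * layer β ε x) := by
  obtain ⟨C, hC⟩ := exists_isDataBound hA hf
  obtain ⟨U, hU0, hU⟩ := exists_layer_bound hT hβ hββs hA hf
  obtain ⟨V, hV0, hV⟩ := exists_step_endpoint_bound hT hβ hββs hA hf
  have hC0 := hC.nonneg
  have hσ : 0 < βs - β := sub_pos.2 hββs
  have key : ∀ n ≤ 7, ∃ K : ℝ, 0 ≤ K ∧ ∀ (ε : ℝ), 0 < ε → ε ≤ 1 →
      ∀ u, IsParabolicSolution ε T A f u → ∀ τ t v, IsCrankNicolsonStep ε T τ t A f u v →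
      ∀ k < n, ∀ i, ∀ x ∈ 𝕀,
        |iteratedDerivWithin k (fun y => v i y + compDeriv T u 0 0 i y t) 𝕀 x|
          ≤ K * (1 + (Real.sqrt ε ^ k)⁻¹ * layer β ε x) := by
    intro n
    induction n with
    | zero => exact fun _ => ⟨0, le_rfl, fun _ _ _ _ _ _ _ _ _ k hk => absurd hk (by omega)⟩
    | succ n ih =>
      intro hn
      obtain ⟨K, hK0, hK⟩ := ih (by omega)
      -- `2 U` covers the term `2 ∂ₓ^k u` and, together with `V`, the boundary values of `v + u`;
      -- the fraction covers the two source terms and the commutator multiplied by `τ / 2`.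
      set L := 2 * U + V + (2 * C + M * (64 * C) * K) / (βs - β) with hL
      have hL0 : 0 ≤ L := by positivity
      have hLσ : 2 * C + M * (64 * C) * K ≤ (βs - β) * L := by
        have : (βs - β) * L = (βs - β) * (2 * U + V) + (2 * C + M * (64 * C) * K) := by
          rw [hL]; field_simp
        rw [this]; exact le_add_of_nonneg_left (by positivity)
      have hLUV : 2 * U + V ≤ L := by rw [hL]; exact le_add_of_nonneg_right (by positivity)
      refine ⟨K + L, by positivity, ?_⟩
      intro ε hε hε1 u hu τ t v hv k hk i x hx
      have hτ := hv.pos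
      set q := (Real.sqrt ε ^ k)⁻¹ with hq
      have hq0 : 0 ≤ q := by positivity
      have hE1 : ∀ y, 1 ≤ 1 + q * layer β ε y := fun y =>
        le_add_of_nonneg_right (mul_nonneg hq0 (layer_pos β ε y).le)
      have hE0 : ∀ y, 0 ≤ 1 + q * layer β ε y := fun y => zero_le_one.trans (hE1 y)
      rw [add_mul]
      rcases (Nat.lt_succ_iff.1 hk).lt_or_eq with hlt | rfl
      · exact (hK ε hε hε1 u hu τ t v hv k hlt i x hx).trans
          (le_add_of_nonneg_right (mul_nonneg hL0 (hE0 x)))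
      refine le_trans ?_ (le_add_of_nonneg_left (mul_nonneg hK0 (hE0 x)))
      have h8 := fun j => hv.contDiffOn_sum hT hA hf hε hu j
      obtain ⟨E1, hEd1, hEd2⟩ := exists_hasDerivAt_layer hβ hε L q
      have hUq : ∀ y ∈ 𝕀, ∀ j, |compDeriv T u k 0 j y t| ≤ U * (1 + q * layer β ε y) :=
        fun y hy j => hU ε hε hε1 u hu k (by omega) j y hy t hv.mem
      have hbd : ∀ x₀ σ, IsEndpoint x₀ σ → 1 ≤ layer β ε x₀ → ∀ j,
          |iteratedDerivWithin k (fun y => v j y + compDeriv T u 0 0 j y t) 𝕀 x₀|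
            ≤ L * (1 + q * layer β ε x₀) := by
        intro x₀ σ hend hlay j
        rw [iteratedDerivWithin_add_apply uniqueDiffOn_unitInterval hend.mem
          ((hv.smooth j).of_le (by exact_mod_cast (by omega : k ≤ 6)))
          (contDiffOn_compDeriv hu.smooth (by omega) j hv.mem), iteratedDerivWithin_compDeriv_zero]
        have b1 := (hV ε hε hε1 u hu τ t v hv x₀ σ hend k (by omega) j).trans
          (div_le_layer_weight hV0 hlay)
        have b2 := hUq x₀ hend.mem j
        have b3 := mul_le_mul_of_nonneg_right hLUV (hE0 x₀)
        have b4 := mul_nonneg hU0 (hE0 x₀)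
        refine (abs_add_le _ _).trans ?_
        rw [← hq] at b1
        linarith
      refine elliptic_abs_le hA (hβ.trans hββs) hε hτ
        (w := fun j => iteratedDerivWithin k (fun y => v j y + compDeriv T u 0 0 j y t) 𝕀)
        (w1 := fun j => iteratedDerivWithin (k + 1) (fun y => v j y + compDeriv T u 0 0 j y t) 𝕀)
        (w2 := fun j => iteratedDerivWithin (k + 2) (fun y => v j y + compDeriv T u 0 0 j y t) 𝕀)
        (fun j y hy => hasDerivWithinAt_iteratedDerivWithin uniqueDiffOn_unitInterval (h8 j)
          (by omega) hy)
        (fun j y hy => hasDerivWithinAt_iteratedDerivWithin uniqueDiffOn_unitInterval (h8 j)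
          (by omega) hy)
        hEd1 hEd2 (fun y _ => mul_nonneg hL0 (hE0 y)) (fun j => ⟨?_, ?_⟩) (fun y hy j => ?_) i hx
      · exact hbd 0 1 (Or.inl ⟨rfl, rfl⟩) (one_le_layer_zero β ε) j
      · exact hbd 1 (-1) (Or.inr ⟨rfl, rfl⟩) (one_le_layer_one β ε) j
      · have hyI := Ioo_subset_Icc_self hy
        rw [hv.sum_deriv_eqn hT hA hf hε hu (by omega) j hyI rfl]
        have b1 := hUq y hyI j
        have b2 := abs_leibnizRemainder_le (A := A)
          (z := fun j y => v j y + compDeriv T u 0 0 j y t)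
          (i := j) (x := y) (R := K * (1 + q * layer β ε y)) (k := k) (by omega)
          (fun l hl j' => hC.coeff l hl j j' y hyI)
          (fun m hm j' => (hK ε hε hε1 u hu τ t v hv m hm j' y hyI).trans
            (mul_le_mul_of_nonneg_left (layer_weight_mono hε hε1 hm.le y) hK0))
          (mul_nonneg hK0 (hE0 y))
        have b3 := hC.source k 0 (by omega) j y hyI t hv.mem
        have b4 := hC.source k 0 (by omega) j y hyI (t + τ) hv.mem_add
        have b5 : |compDeriv T f k 0 j y t + compDeriv T f k 0 j y (t + τ)
            - leibnizRemainder A (fun j y => v j y + compDeriv T u 0 0 j y t) k j y|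
            ≤ (βs - β) * (L * (1 + q * layer β ε y)) := by
          refine (abs_sub _ _).trans ((add_le_add ((abs_add_le _ _).trans (add_le_add b3 b4)) b2).trans
            ?_)
          have e1 : C ≤ C * (1 + q * layer β ε y) := le_mul_of_one_le_right hC0 (hE1 y)
          have e2 := mul_le_mul_of_nonneg_right hLσ (hE0 y)
          nlinarith
        refine (abs_add_le _ _).trans (add_le_add ?_ ?_)
        · rw [abs_mul, abs_two]
          have b6 := mul_le_mul_of_nonneg_right hLUV (hE0 y)
          have b7 := mul_nonneg hV0 (hE0 y)
          linarith
        · rw [abs_mul, abs_of_pos (half_pos hτ)]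
          exact mul_le_mul_of_nonneg_left (b5.trans (layer_operator_ge hε hβ.le hL0 y))
            (half_pos hτ).le
  obtain ⟨K, hK0, hK⟩ := key 7 le_rfl
  exact ⟨K, hK0, fun ε hε hε1 u hu τ t v hv k hk => hK ε hε hε1 u hu τ t v hv k (by omega)⟩

end CrankNicolsonBounds

/-! ### Conclusion -/

theorem rpow_neg_half_eq {ε : ℝ} (hε : 0 < ε) (k : ℕ) :
    ε ^ (-(k : ℝ) / 2) = (Real.sqrt ε ^ k)⁻¹ := by
  rw [Real.sqrt_eq_rpow, ← Real.rpow_natCast, ← Real.rpow_mul hε.le, ← Real.rpow_neg hε.le]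
  congr 1
  ring

/-- The constant `C` depends only on the data `M`, `T`, `A`, `f`, `βs` and `β`: it is uniform in
`ε`, in the time step `τ` and in the time level `n`. -/
theorem lemma3p2 (M : ℕ) (T βs β : ℝ) (hT : 0 < T) (hβ : 0 < β) (hββs : β < βs)
    (A : ℝ → Matrix (Fin M) (Fin M) ℝ) (hA : IsCouplingMatrix A βs)
    (f : ℝ → ℝ → Fin M → ℝ) (hf : IsCompatibleSource T f) :
    ∃ C : ℝ, 0 < C ∧
      ∀ (ε : ℝ), 0 < ε → ε ≤ 1 →
      ∀ (u : ℝ → ℝ → Fin M → ℝ), IsParabolicSolution ε T A f u →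
      ∀ (τ : ℝ) (n : ℕ), 0 < τ → ((n : ℝ) + 1) * τ ≤ T →
      ∀ (v : ℝ → Fin M → ℝ), IsAuxCrankNicolsonSolution ε τ n A f u v →
      ∀ i : Fin M,
        ContDiffOn ℝ 6 (fun x => v x i) (Icc 0 1) ∧
        ∀ k : ℕ, k ≤ 6 → ∀ x ∈ Icc (0 : ℝ) 1,
          |iteratedDerivWithin k (fun y => v y i) (Icc 0 1) x| ≤
            C * (1 + ε ^ (-(k : ℝ) / 2) *
              (Real.exp (-x * Real.sqrt (β / ε)) + Real.exp (-(1 - x) * Real.sqrt (β / ε)))) := by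
  obtain ⟨U, hU0, hU⟩ := exists_layer_bound hT hβ hββs hA hf
  obtain ⟨S, hS0, hS⟩ := exists_sum_layer_bound hT hβ hββs hA hf
  refine ⟨S + U + 1, by positivity, ?_⟩
  intro ε hε hε1 u hu τ n hτ hn v hv i
  have hstep := hv.isCrankNicolsonStep hT hA hf hε hu hτ hn
  have hsm := hstep.smooth i
  refine ⟨by exact_mod_cast hsm, fun k hk x hx => ?_⟩
  rw [rpow_neg_half_eq hε]
  change _ ≤ (S + U + 1) * (1 + (Real.sqrt ε ^ k)⁻¹ * layer β ε x)
  have hE0 : 0 ≤ 1 + (Real.sqrt ε ^ k)⁻¹ * layer β ε x := by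
    have := (layer_pos β ε x).le
    positivity
  have b1 := hS ε hε hε1 u hu τ _ _ hstep k hk i x hx
  have b2 := hU ε hε hε1 u hu k hk i x hx _ hstep.mem
  rw [iteratedDerivWithin_add_apply uniqueDiffOn_unitInterval hx
    (hsm.of_le (by exact_mod_cast hk))
    (contDiffOn_compDeriv hu.smooth (by omega) i hstep.mem),
    iteratedDerivWithin_compDeriv_zero] at b1
  -- The bound for `v` is that for `v + u` plus that for `u`; the extra 1 in the constant only makes
  -- it positive.
  have b3 := abs_sub_abs_le_abs_add (iteratedDerivWithin k (fun y => v y i) (Icc 0 1) x)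
    (compDeriv T u k 0 i x (n * τ))
  rw [add_mul, add_mul, one_mul]
  linarith
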